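/- **Proposition 4.2 (Circle recursions).** *Conventions.* Let $0<|A|<1$, $[n]=\frac{A^{2n}-A^{-2n}}{A^2-A^{-2}}$ and $[n]!=[1][2]\cdots[n]$. On the punctured unit disc let $\sqrt{[n]}$ be the holomorphic square root of $[n]$ with value $\sqrt n$ at $A=1$, and let $\sqrt{[n]!}=\prod_{j=1}^n\sqrt{[j]}$. Colours are elements of $\frac{\mathbb N}{2}$. A triple $(a,b,c)$ of half-integers is *admissible* if $a,b,c\ge 0$, $a+b+c\in\mathbb N$ and $a\le b+c$, $b\le c+a$, $c\le a+b$. Put $$\Delta(a,b,c)=\frac{\sqrt{[a+b-c]!}\,\sqrt{[b+c-a]!}\,\sqrt{[c+a-b]!}}{\sqrt{[a+b+c+1]!}}.$$ The unitary $6j$-symbol is $$\begin{Bmatrix}a&b&c\\ d&e&f\end{Bmatrix}=\mathbf i^{2(a+b+c+d+e+f)}\Delta(a,b,c)\Delta(a,e,f)\Delta(d,b,f)\Delta(d,e,c)\sum_{k=\max T_i}^{\min Q_j}\frac{(-1)^k[k+1]!}{\prod_{i=1}^4[k-T_i]!\,\prod_{j=1}^3[Q_j-k]!}$$ with $T_1=a+b+c$,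 $T_2=a+e+f$, $T_3=d+b+f$, $T_4=d+e+c$, $Q_1=a+b+d+e$, $Q_2=a+c+d+f$, $Q_3=b+c+e+f$ if the triples $(a,b,c)$, $(a,e,f)$, $(d,b,f)$, $(d,e,c)$ are admissible; otherwise it is $0$. Let $\Gamma\subset S^2$ be a finite connected trivalent graph, for instance the $1$-skeleton of a convex polyhedron with trivalent vertices. A colouring $c$ of the edges is *admissible* if the colours at every vertex form an admissible triple. Choose a region $r_0$ of $S^2\setminus\Gamma$ (the unbounded region of a planar diagram of $\Gamma$). A *shadow-state* is a map $s$ from the regions to $\frac{\mathbb N}{2}$ with $s(r_0)=0$ such that for every edge $e$ the states of the regions on the two sides of $e$ and the colour $c(e)$ form an admissible triple. The unitary Kauffman bracket is the finite sum $$\langle\Gamma,c\rangle^{\mathrm U}=\sum_{s}\ \prod_{r}(-1)^{2s(r)}[2s(r)+1]\ \prod_{v}\begin{Bmatrix}a_v&b_v&c_v\\ t_v&u_v&w_v\end{Bmatrix}$$ over the shadow-states $s$, with products over all regions $r$ and all vertices $v$, where $a_v,b_v,c_v$ are the colours of the edges at $v$ and $t_v,u_v,w_v$ are the states of the regions at $v$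 lying between the edges coloured $b_v,c_v$, between $c_v,a_v$, and between $a_v,b_v$, respectively. *Statement.* Let $c$ be an admissible colouring of $\Gamma$, and let $D$ be a region of $S^2\setminus\Gamma$ whose boundary is an embedded cycle of $p\ge 2$ edges (for a polyhedron, every face is such a region, with $p\ge3$). Number these edges $e_0,\dots,e_{p-1}$ clockwise around $D$ from an arbitrary starting edge, with indices modulo $p$. Let $a_i=c(e_i)$, and let $b_i$ be the colour of the third edge at the vertex where the clockwise boundary walk passes from $e_i$ to $e_{i+1}$. An *admissible perturbation* is a map $\delta:\{e_0,\dots,e_{p-1}\}\to\{\pm\frac12\}$ such that the colouring $c+\delta$ (equal to $c$ off $\partial D$ and to $a_i+\delta(e_i)$ on $e_i$) is admissible. Write $a_i'=a_i+\delta(e_i)$, $$\mathbb V(j)=\begin{Bmatrix}a_j&a_{j+1}&b_j\\ a'_{j+1}&a'_j&\frac12\end{Bmatrix}\Big/\begin{Bmatrix}a'_j&a'_{j+1}&b_j\\ a'_{j+1}&a'_j&0\end{Bmatrix},$$ where $\mathbb V(j)=0$ if the triple $(a'_j,a'_{j+1},b_j)$ is not admissible, and $$k(c,\delta)=\prod_{i=0}^{p-2}\mathbb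 V(i),\qquad Z(c,\delta(e_0),\delta(e_{p-1}))=\mathbb V(p-1).$$ Then for every choice of $r_0$, every pair $(\varepsilon_0,\varepsilon_1)\in\{\pm\frac12\}^2$, and every $A$ with $0<|A|<1$, $$\sum_{\delta}k(c,\delta)\,\langle\Gamma,c+\delta\rangle^{\mathrm U}=Z(c,\varepsilon_0,\varepsilon_1)\,\langle\Gamma,c\rangle^{\mathrm U},$$ where $\delta$ ranges over all admissible perturbations of $c$ around $D$ with $\delta(e_0)=\varepsilon_0$ and $\delta(e_{p-1})=\varepsilon_1$. -/

import Mathlib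

/-! Half-integer colours are stored doubled: an integer `x` stands for the colour `x / 2`.
Thus a colour in `ℕ/2` is a non-negative integer, the colour `1/2` is `1`, and a perturbation by
`± 1/2` is the addition of `± 1`. -/

noncomputable section

namespace CircleRec

/-! ### Quantum integers and their square roots -/

/-- The quantum integer `[n] = (A^(2n) - A^(-2n)) / (A^2 - A^(-2))`. -/
def qInt (A : ℂ) (n : ℤ) : ℂ := (A ^ (2 * n) - A ^ (-(2 * n))) / (A ^ (2 : ℤ) - A ^ (-2 : ℤ))

/-- The quantum factorial `[n]! = [1] [2] ⋯ [n]`. -/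
def qFact (A : ℂ) (n : ℕ) : ℂ := ∏ j ∈ Finset.range n, qInt A ((j : ℤ) + 1)

/-- The square root of `[n] = A^(2-2n) (1 - A^(4n)) / (1 - A^4)` on the punctured open unit disc
that takes the value `√n` at `A = 1`. The two complex powers are principal square roots, which are
holomorphic in `A` there, since `1 - A^(4n)` and `1 - A^4` have positive real part. -/
def sqrtQInt (A : ℂ) (n : ℕ) : ℂ :=
  A ^ (1 - (n : ℤ)) * ((1 - A ^ (4 * n)) ^ (1 / 2 : ℂ) / (1 - A ^ 4) ^ (1 / 2 : ℂ))

/-- `√([n]!) = √[1] √[2] ⋯ √[n]`. -/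
def sqrtQFact (A : ℂ) (n : ℕ) : ℂ := ∏ j ∈ Finset.range n, sqrtQInt A (j + 1)

/-- `sqrtQInt` is a square root of the quantum integer on the punctured unit disc. -/
theorem sqrtQInt_sq (A : ℂ) (h0 : 0 < ‖A‖) (h1 : ‖A‖ < 1) (n : ℕ) :
    sqrtQInt A n ^ 2 = qInt A n := by
  have hA : A ≠ 0 := norm_pos_iff.mp h0
  have h4 : A ^ 4 ≠ 1 := by
    intro h
    have := congrArg norm h
    rw [norm_pow, norm_one] at this
    exact absurd this (pow_lt_one₀ h0.le h1 (by norm_num)).ne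
  have key : ∀ z : ℂ, (z ^ (1 / 2 : ℂ)) ^ 2 = z := by
    intro z
    rw [← Complex.cpow_nat_mul]
    norm_num
  have e1 : A ^ (2 * (n : ℤ)) = (A ^ n) ^ 2 := by
    rw [← zpow_natCast, ← zpow_natCast, ← zpow_mul]
    congr 1
    push_cast
    ring
  have e2 : A ^ (1 - (n : ℤ)) = A / A ^ n := by
    rw [zpow_sub₀ hA, zpow_one, zpow_natCast]
  have hn : A ^ n ≠ 0 := pow_ne_zero _ hA
  have e3 : A ^ (4 * n) = (A ^ n) ^ 4 := by rw [← pow_mul, mul_comm]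
  have h4' : 1 - A ^ 4 ≠ 0 := sub_ne_zero.mpr h4.symm
  have h4'' : A ^ 4 - 1 ≠ 0 := sub_ne_zero.mpr h4
  have e4 : A ^ (2 : ℤ) - A ^ (-2 : ℤ) = (A ^ 4 - 1) / A ^ 2 := by
    rw [zpow_neg]
    norm_cast
    field_simp
  unfold sqrtQInt qInt
  rw [mul_pow, div_pow, key, key, zpow_neg, e1, e2, e3, e4]
  field_simp
  ring

/-! ### The symmetric 6j-symbol -/

/-- Admissibility of a triple of (doubled) colours: they are colours in `ℕ/2`, they satisfy the
triangle inequalities, and their sum is an integer. -/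
def AdmTriple (a b c : ℤ) : Prop :=
  0 ≤ a ∧ 0 ≤ b ∧ 0 ≤ c ∧ c ≤ a + b ∧ a ≤ b + c ∧ b ≤ c + a ∧ Even (a + b + c)

/-- `Δ(a,b,c) = √([a+b-c]! [b+c-a]! [c+a-b]! / [a+b+c+1]!)`, in doubled colours. -/
def bigDelta (A : ℂ) (a b c : ℤ) : ℂ :=
  sqrtQFact A ((a + b - c) / 2).toNat * sqrtQFact A ((b + c - a) / 2).toNat *
    sqrtQFact A ((c + a - b) / 2).toNat / sqrtQFact A ((a + b + c) / 2 + 1).toNat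

open Classical in
/-- The unitary tetrahedron (symmetric `6j`-symbol) with opposite pairs of edges
`(a, d)`, `(b, e)`, `(c, f)` and vertices `(a,b,c)`, `(a,e,f)`, `(d,b,f)`, `(d,e,c)`; all colours
are doubled. It is `0` if one of the four triples is not admissible. -/
def tet (A : ℂ) (a b c d e f : ℤ) : ℂ :=
  if AdmTriple a b c ∧ AdmTriple a e f ∧ AdmTriple d b f ∧ AdmTriple d e c then
    let T₁ := (a + b + c) / 2
    let T₂ := (a + e + f) / 2
    let T₃ := (d + b + f) / 2
    let T₄ := (d + e + c) / 2
    let Q₁ := (a + b + d + e) / 2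
    let Q₂ := (a + c + d + f) / 2
    let Q₃ := (b + c + e + f) / 2
    Complex.I ^ (a + b + c + d + e + f) *
      (bigDelta A a b c * bigDelta A a e f * bigDelta A d b f * bigDelta A d e c) *
      ∑ k ∈ Finset.Icc (max (max T₁ T₂) (max T₃ T₄)) (min (min Q₁ Q₂) Q₃),
        (-1 : ℂ) ^ k *
          (qFact A (k + 1).toNat /
            (qFact A (k - T₁).toNat * qFact A (k - T₂).toNat * qFact A (k - T₃).toNat *
              qFact A (k - T₄).toNat * qFact A (Q₁ - k).toNat * qFact A (Q₂ - k).toNat *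
              qFact A (Q₃ - k).toNat * qFact A 1))
  else 0

/-! ### Trivalent graphs on the sphere -/

/-- A trivalent graph with vertex set `V`, cellularly embedded in an oriented closed surface, as a
rotation system. The half-edges (darts) at `v` are `(v, 0), (v, 1), (v, 2)` in counterclockwise
order, and `opp` exchanges the two halves of every edge. Loops and multiple edges are allowed. -/
structure CubicMap (V : Type*) where
  opp : Equiv.Perm (V × Fin 3)
  opp_opp : ∀ d, opp (opp d) = d
  opp_ne : ∀ d, opp d ≠ d

namespace CubicMap

variable {V : Type*} (G : CubicMap V)

/-- The next dart counterclockwise around the same vertex. -/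
def rot : Equiv.Perm (V × Fin 3) := Equiv.prodCongr (Equiv.refl V) (Equiv.addRight 1)

/-- The face permutation. A dart `d` is an oriented edge leaving its vertex; `G.next d` is the
oriented edge that follows `d` on the boundary of the region to the right of `d`. Its orbits are the
boundaries of the regions, walked clockwise. -/
def next : Equiv.Perm (V × Fin 3) := G.opp.trans rot

/-- The edges: orbits of `opp`. -/
def Edge : Type _ := Quotient (Equiv.Perm.SameCycle.setoid G.opp)

/-- The regions: orbits of the face permutation. -/
def Face : Type _ := Quotient (Equiv.Perm.SameCycle.setoid G.next)

/-- The edge that contains a dart. -/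
def edge (d : V × Fin 3) : G.Edge := Quotient.mk (Equiv.Perm.SameCycle.setoid G.opp) d

/-- The region to the right of a dart. At the vertex of the darts `(v, 0), (v, 1), (v, 2)` it is the
sector between `(v, i - 1)` and `(v, i)`, for the dart `(v, i)`. -/
def face (d : V × Fin 3) : G.Face := Quotient.mk (Equiv.Perm.SameCycle.setoid G.next) d

instance [Finite V] : Fintype G.Edge :=
  haveI : Finite G.Edge := Quotient.finite (Equiv.Perm.SameCycle.setoid G.opp)
  Fintype.ofFinite _

instance [Finite V] : Fintype G.Face :=
  haveI : Finite G.Face := Quotient.finite (Equiv.Perm.SameCycle.setoid G.next)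
  Fintype.ofFinite _

/-- The graph is connected. -/
def IsConnected : Prop :=
  ∀ v w : V, Relation.ReflTransGen (fun x y => ∃ i, (G.opp (x, i)).1 = y) v w

/-- The graph is connected and its surface has Euler characteristic `2`, that is, it is the
sphere. -/
def IsSpherical : Prop :=
  G.IsConnected ∧ Nat.card V + Nat.card G.Face = Nat.card G.Edge + 2

/-! ### Colourings and the bracket -/

/-- A (doubled) colouring of the edges is admissible if the colours at every vertex form an
admissible triple. -/
def Admissible (c : G.Edge → ℤ) : Prop :=
  ∀ v : V, AdmTriple (c (G.edge (v, 0))) (c (G.edge (v, 1))) (c (G.edge (v, 2)))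

/-- A (doubled) shadow-state with distinguished region `r₀`: the region `r₀` has state `0`, and for
every edge the states on its two sides and its colour form an admissible triple. -/
def IsShadowState (c : G.Edge → ℤ) (r₀ : G.Face) (s : G.Face → ℤ) : Prop :=
  s r₀ = 0 ∧ ∀ d, AdmTriple (s (G.face d)) (s (G.face (G.opp d))) (c (G.edge d))

/-- The weight of a shadow-state. A region with state `u` contributes `(-1)^(2u) [2u+1]` (a disc,
hence with Euler characteristic `1`; the factor of the distinguished region is `1`). A vertex
contributes the tetrahedron in which every edge at the vertex is opposite to the region that does
not touch this edge there. -/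
def weight [Fintype V] (A : ℂ) (c : G.Edge → ℤ) (s : G.Face → ℤ) : ℂ :=
  (∏ r : G.Face, (-1 : ℂ) ^ (s r) * qInt A (s r + 1)) *
    ∏ v : V, tet A (c (G.edge (v, 0))) (c (G.edge (v, 1))) (c (G.edge (v, 2)))
      (s (G.face (v, 2))) (s (G.face (v, 0))) (s (G.face (v, 1)))

/-- The unitary Kauffman bracket of the coloured planar graph as a shadow-state sum, for the planar
diagram in which `r₀` is the unbounded region, as a function of `A`. The sum is finite by
`finite_shadowStates`. -/
def bracket [Fintype V] (r₀ : G.Face) (c : G.Edge → ℤ) (A : ℂ) : ℂ :=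
  ∑ᶠ s ∈ {s | G.IsShadowState c r₀ s}, G.weight A c s

theorem face_opp (d : V × Fin 3) : G.face (G.opp d) = G.face (rot d) := by
  apply Quotient.sound
  change G.next.SameCycle (G.opp d) (rot d)
  refine ⟨1, ?_⟩
  simp [next, G.opp_opp]

/-- On a connected graph there are finitely many shadow-states. -/
theorem finite_shadowStates [Finite V] (hG : G.IsConnected) (c : G.Edge → ℤ) (r₀ : G.Face) :
    {s | G.IsShadowState c r₀ s}.Finite := by
  obtain ⟨⟨v₀, i₀⟩, rfl⟩ := Quotient.exists_rep r₀
  change {s | G.IsShadowState c (G.face (v₀, i₀)) s}.Finite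
  have step : ∀ d s, G.IsShadowState c (G.face (v₀, i₀)) s →
      s (G.face (rot d)) ≤ s (G.face d) + c (G.edge d) := by
    intro d s hs
    have := (hs.2 d)
    rw [face_opp] at this
    obtain ⟨_, _, _, _, _, h, _⟩ := this
    linarith
  have around : ∀ v i, (∃ B : ℤ, ∀ s, G.IsShadowState c (G.face (v₀, i₀)) s →
      s (G.face (v, i)) ≤ B) → ∀ j, ∃ B : ℤ, ∀ s, G.IsShadowState c (G.face (v₀, i₀)) s →
      s (G.face (v, j)) ≤ B := by
    rintro v i ⟨B, hB⟩ j
    have h1 : rot (v, i) = (v, i + 1) := rfl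
    have h2 : rot (v, i + 1) = (v, i + 2) := by
      change (v, i + 1 + 1) = _
      rw [add_assoc]; rfl
    have h3 : ∀ i j : Fin 3, j = i ∨ j = i + 1 ∨ j = i + 2 := by decide
    have hj := h3 i j
    rcases hj with rfl | rfl | rfl
    · exact ⟨B, hB⟩
    · refine ⟨B + c (G.edge (v, i)), fun s hs => ?_⟩
      have := step (v, i) s hs
      rw [h1] at this
      linarith [hB s hs]
    · refine ⟨B + c (G.edge (v, i)) + c (G.edge (v, i + 1)), fun s hs => ?_⟩
      have a1 := step (v, i) s hs
      have a2 := step (v, i + 1) s hs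
      rw [h1] at a1
      rw [h2] at a2
      linarith [hB s hs]
  have all : ∀ v, ∀ j, ∃ B : ℤ, ∀ s, G.IsShadowState c (G.face (v₀, i₀)) s →
      s (G.face (v, j)) ≤ B := by
    intro v
    induction hG v₀ v with
    | refl => exact around v₀ i₀ ⟨0, fun s hs => hs.1.le⟩
    | @tail x y _ hxy ih =>
      obtain ⟨i, rfl⟩ := hxy
      obtain ⟨B, hB⟩ := around x i (ih i) (i + 1)
      refine around _ (G.opp (x, i)).2 ⟨B, fun s hs => ?_⟩
      have := G.face_opp (x, i)
      change s (G.face (G.opp (x, i))) ≤ B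
      rw [this]
      exact hB s hs
  choose B hB using all
  have hout : ∀ r : G.Face, ∃ b : ℤ, ∀ s, G.IsShadowState c (G.face (v₀, i₀)) s → s r ≤ b := by
    intro r
    obtain ⟨⟨v, i⟩, rfl⟩ := Quotient.exists_rep r
    exact ⟨B v i, fun s hs => hB v i s hs⟩
  choose b hb using hout
  refine Set.Finite.subset (Set.Finite.pi' fun r => Set.finite_Icc (0 : ℤ) (b r)) ?_
  intro s hs r
  refine ⟨?_, hb r s hs⟩
  obtain ⟨d, rfl⟩ := Quotient.exists_rep r
  exact (hs.2 d).1

/-! ### Recursion around a face -/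

/-- The number `p` of oriented edges in the boundary walk of the region to the right of `d`. -/
def faceLength (d : V × Fin 3) : ℕ := Function.minimalPeriod G.next d

/-- The boundary of the region to the right of `d` is an embedded cycle: its boundary walk does not
visit a vertex twice. -/
def IsEmbeddedFace (d : V × Fin 3) : Prop :=
  ∀ x y, G.face x = G.face d → G.face y = G.face d → x.1 = y.1 → x = y

/-- The edges in the boundary of the region to the right of `d`. -/
def bdry (d : V × Fin 3) : Set G.Edge := {e | ∃ i : ℕ, e = G.edge ((G.next ^ i) d)}

/-- The boundary edges `e₀, e₁, …` of the region to the right of `d`, clockwise, starting with the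
edge of `d`; the index is modulo `p`. -/
def bEdge (d : V × Fin 3) (i : ℕ) : G.bdry d := ⟨G.edge ((G.next ^ i) d), i, rfl⟩

/-- The third edge at the common vertex of `eᵢ` and `eᵢ₊₁`; its colour is `bᵢ`. -/
def legEdge (d : V × Fin 3) (i : ℕ) : G.Edge := G.edge (rot ((G.next ^ (i + 1)) d))

open Classical in
/-- The colouring `c + δ`, where `δ` perturbs the boundary edges by `± 1/2` (doubled: `± 1`). -/
def perturb (d : V × Fin 3) (c : G.Edge → ℤ) (δ : G.bdry d → ℤˣ) : G.Edge → ℤ :=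
  fun e => if h : e ∈ G.bdry d then c e + (δ ⟨e, h⟩ : ℤ) else c e

/-- The quotient `𝕍(j)`, as a function of `ε = δ(eⱼ)` and `ε' = δ(eⱼ₊₁)`. -/
def quot (d : V × Fin 3) (c : G.Edge → ℤ) (A : ℂ) (j : ℕ) (ε ε' : ℤˣ) : ℂ :=
  let a : ℤ := c (G.bEdge d j)
  let a₁ : ℤ := c (G.bEdge d (j + 1))
  let b : ℤ := c (G.legEdge d j)
  tet A a a₁ b (a₁ + ε') (a + ε) 1 / tet A (a + ε) (a₁ + ε') b (a₁ + ε') (a + ε) 0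

/-- The coefficient `k(c, δ) = 𝕍(0) ⋯ 𝕍(p-2)`. -/
def coeffK (d : V × Fin 3) (c : G.Edge → ℤ) (A : ℂ) (δ : G.bdry d → ℤˣ) : ℂ :=
  ∏ i ∈ Finset.range (G.faceLength d - 1), G.quot d c A i (δ (G.bEdge d i)) (δ (G.bEdge d (i + 1)))

/-- The coefficient `Z(c, δ(e₀), δ(e_{p-1})) = 𝕍(p-1)`, for `ε₀ = δ(e₀)` and `ε₁ = δ(e_{p-1})`. -/
def coeffZ (d : V × Fin 3) (c : G.Edge → ℤ) (A : ℂ) (ε₀ ε₁ : ℤˣ) : ℂ :=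
  G.quot d c A (G.faceLength d - 1) ε₁ ε₀

open Classical in
/-- The admissible perturbations of `c` around the region to the right of `d` whose values on `e₀`
and `e_{p-1}` are `ε₀` and `ε₁`. -/
def admPerturbations [Finite V] (d : V × Fin 3) (c : G.Edge → ℤ) (ε₀ ε₁ : ℤˣ) :
    Finset (G.bdry d → ℤˣ) :=
  Finset.univ.filter fun δ => G.Admissible (G.perturb d c δ) ∧
    δ (G.bEdge d 0) = ε₀ ∧ δ (G.bEdge d (G.faceLength d - 1)) = ε₁

end CubicMap

end CircleRec

end

/-! The recursion comes from a strand of colour 1/2 that runs along the boundary of `D` and may be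
pulled to either side of it. Algebraically, suppose that `D` is not the distinguished region, fix
the states of all other regions and let `u` be the state of `D`. The numerator of `𝕍(i)` times the
weight of the perturbed vertex is, by the Biedenharn-Elliott identity with one edge of colour 1/2
(`pentagon`, `tet_mul_tet`), a sum over the two neighbours `v` of `u`: the weight of the unperturbed
vertex with `D` in state `v`, times one crossing symbol `rho` for each of the two boundary edges.
The denominators of the `𝕍(i)` are inverse square roots of region weights (`tet_zero_mul`), and
these supply exactly the weights needed to sum over `δ` on the inner edges of the chain.
Orthogonality of `rho` then forces the states `v` of consecutive vertices to agree (`chain_eq`).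
What remains is a chain with open ends at `e₀` and `e_{p-1}`. Summing over `u`, the pentagon
identity read backwards at the last vertex closes it and leaves the numerator of `𝕍(p-1)`
(`sum_wt_mul_chain`).

The pentagon identity itself reduces to three contiguous relations between Racah sums, because a
Racah sum with an edge of colour 1/2 is a single term (`tri_sq_mul_rhoRacah`). The contiguous
relations are proved by telescoping.

If `D` is the distinguished region, its state is frozen at 0 and there is no sum over `u`. The
bracket is then moved to another distinguished region (`exists_bracket_eq`). The product of all
vertex weights is a function of the closed path of states around a spanning tree, and this function
is flat (`IsFlat`): it is compatible with transport across a strand of colour 1/2. Flatness survives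
attaching a vertex (by the pentagon identity) and summing over the state of a region that is a dead
end of the path (by orthogonality). The Euler characteristic of the sphere guarantees dead ends
until a single edge between `r₀` and a neighbour `r₁` is left. A flat function of such a path takes
the same value at the states `(0, c)` and `(c, 0)`, and these values are the two brackets up to a
common factor. -/

noncomputable section

namespace CircleRec

/-! ### Quantum integers -/

theorem qInt_zero (A : ℂ) : qInt A 0 = 0 := by simp [qInt]

theorem qInt_neg (A : ℂ) (n : ℤ) : qInt A (-n) = -qInt A n := by
  unfold qInt
  rw [show 2 * -n = -(2 * n) by ring, neg_neg]
  ring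

theorem qInt_one {A : ℂ} (h0 : 0 < ‖A‖) (h1 : ‖A‖ < 1) : qInt A 1 = 1 := by
  have hA : A ≠ 0 := norm_pos_iff.mp h0
  have h4 : A ^ 4 ≠ 1 := by
    intro h
    have := congrArg norm h
    rw [norm_pow, norm_one] at this
    exact absurd this (pow_lt_one₀ h0.le h1 (by norm_num)).ne
  unfold qInt
  rw [mul_one]
  refine div_self ?_
  rw [sub_ne_zero]
  intro h
  apply h4
  have : A ^ 4 = A ^ (2 : ℤ) * A ^ (2 : ℤ) := by rw [← zpow_add₀ hA]; norm_cast
  rw [this]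
  nth_rewrite 1 [h]
  rw [← zpow_add₀ hA]
  norm_num

theorem qInt_ne_zero {A : ℂ} (h0 : 0 < ‖A‖) (h1 : ‖A‖ < 1) {n : ℤ} (hn : n ≠ 0) :
    qInt A n ≠ 0 := by
  have hA : A ≠ 0 := norm_pos_iff.mp h0
  have key : ∀ m : ℤ, m ≠ 0 → A ^ (2 * m) - A ^ (-(2 * m)) ≠ 0 := by
    intro m hm h
    rw [sub_eq_zero] at h
    have h2 : A ^ (4 * m) = 1 := by
      have : A ^ (4 * m) = A ^ (2 * m) * A ^ (2 * m) := by
        rw [← zpow_add₀ hA]; ring_nf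
      rw [this]
      nth_rewrite 2 [h]
      rw [← zpow_add₀ hA]
      norm_num
    have h3 := congrArg norm h2
    rw [norm_zpow, norm_one] at h3
    rw [zpow_eq_one_iff_right₀ h0.le h1.ne] at h3
    omega
  exact div_ne_zero (key n hn) (by simpa using key 1 one_ne_zero)

/-- The addition formula for products of quantum integers, from which all others follow. -/
theorem qInt_mul_sub_mul {A : ℂ} (h0 : 0 < ‖A‖) {x y z t : ℤ} (m n : ℤ)
    (h : x + y = z + t) (hm : m = x - z) (hn : n = x - t) :
    qInt A x * qInt A y - qInt A z * qInt A t = -(qInt A m * qInt A n) := by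
  have hA : A ≠ 0 := norm_pos_iff.mp h0
  have add : ∀ u v : ℤ, A ^ (2 * (u + v)) = A ^ (2 * u) * A ^ (2 * v) := by
    intro u v
    rw [← zpow_add₀ hA]; ring_nf
  have neg : ∀ u : ℤ, A ^ (2 * -u) = (A ^ (2 * u))⁻¹ := by
    intro u
    rw [← zpow_neg]; ring_nf
  obtain rfl : y = z + t - x := by omega
  subst hm hn
  unfold qInt
  simp only [zpow_neg, sub_eq_add_neg, add, neg]
  have hx : A ^ (2 * x) ≠ 0 := zpow_ne_zero _ hA
  have hz : A ^ (2 * z) ≠ 0 := zpow_ne_zero _ hA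
  have ht : A ^ (2 * t) ≠ 0 := zpow_ne_zero _ hA
  generalize A ^ (2 * x) = X at *
  generalize A ^ (2 * z) = Z at *
  generalize A ^ (2 * t) = T at *
  generalize A ^ (2 : ℤ) + -(A ^ (2 : ℤ))⁻¹ = D
  rw [div_mul_div_comm, div_mul_div_comm, div_mul_div_comm, ← neg_div, ← neg_div, ← add_div]
  congr 1
  field_simp
  ring

/-- The previous formula with `y` and `t` negated, for pairs with equal difference instead of equal
sum. -/
theorem qInt_mul_sub_mul' {A : ℂ} (h0 : 0 < ‖A‖) {x y z t : ℤ} (m n : ℤ)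
    (h : x - y = z - t) (hm : m = x - z) (hn : n = x + t) :
    qInt A x * qInt A y - qInt A z * qInt A t = qInt A m * qInt A n := by
  have := qInt_mul_sub_mul h0 (x := x) (y := -y) (z := z) (t := -t) m n (by omega) hm (by omega)
  rw [qInt_neg, qInt_neg] at this
  linear_combination -this

/-! ### Quantum factorials with integer argument -/

/-- The quantum factorial of an integer, with value `1` at negative integers. -/
def qF (A : ℂ) (n : ℤ) : ℂ := qFact A n.toNat

/-- The inverse of the quantum factorial, with value `0` at negative integers. -/
def invF (A : ℂ) (n : ℤ) : ℂ := if n < 0 then 0 else (qFact A n.toNat)⁻¹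

theorem qFact_ne_zero {A : ℂ} (h0 : 0 < ‖A‖) (h1 : ‖A‖ < 1) (n : ℕ) : qFact A n ≠ 0 :=
  Finset.prod_ne_zero_iff.mpr fun j _ => qInt_ne_zero h0 h1 (by omega)

theorem qF_ne_zero {A : ℂ} (h0 : 0 < ‖A‖) (h1 : ‖A‖ < 1) (n : ℤ) : qF A n ≠ 0 :=
  qFact_ne_zero h0 h1 _

theorem qF_succ (A : ℂ) {n : ℤ} (hn : 0 ≤ n) : qF A (n + 1) = qInt A (n + 1) * qF A n := by
  obtain ⟨m, rfl⟩ := Int.eq_ofNat_of_zero_le hn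
  unfold qF
  rw [show ((m : ℤ) + 1).toNat = m + 1 by omega, show (m : ℤ).toNat = m by omega, qFact,
    Finset.prod_range_succ, mul_comm]
  rfl

theorem invF_of_neg (A : ℂ) {n : ℤ} (hn : n < 0) : invF A n = 0 := if_pos hn

theorem invF_of_nonneg (A : ℂ) {n : ℤ} (hn : 0 ≤ n) : invF A n = (qF A n)⁻¹ :=
  if_neg (not_lt.mpr hn)

theorem invF_zero (A : ℂ) : invF A 0 = 1 := by simp [invF, qFact]

theorem invF_one {A : ℂ} (h0 : 0 < ‖A‖) (h1 : ‖A‖ < 1) : invF A 1 = 1 := by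
  simp [invF, qFact, qInt_one h0 h1]

theorem qF_mul_invF {A : ℂ} (h0 : 0 < ‖A‖) (h1 : ‖A‖ < 1) {n : ℤ} (hn : 0 ≤ n) :
    qF A n * invF A n = 1 := by
  rw [invF_of_nonneg A hn, mul_inv_cancel₀ (qF_ne_zero h0 h1 n)]

/-- The value 0 at negative integers makes this recursion hold for every integer: at `m = -1` the
right side vanishes because `[0] = 0`. Hence the telescoping arguments below need no case
distinctions at the ends of the summation range. -/
theorem invF_eq {A : ℂ} (h0 : 0 < ‖A‖) (h1 : ‖A‖ < 1) {m : ℤ} (n : ℤ) (h : m + 1 = n) :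
    invF A m = qInt A n * invF A n := by
  subst h
  rcases lt_trichotomy (m + 1) 0 with h | h | h
  · rw [invF_of_neg A h, invF_of_neg A (by omega), mul_zero]
  · rw [h, qInt_zero, zero_mul, invF_of_neg A (by omega)]
  · rw [invF_of_nonneg A h.le, invF_of_nonneg A (by omega : 0 ≤ m), qF_succ A (by omega), mul_inv,
      mul_inv_cancel_left₀ (qInt_ne_zero h0 h1 h.ne')]

/-! ### Racah sums -/

/-- The term of the Racah sum. -/
def racahTerm (A : ℂ) (T₁ T₂ T₃ T₄ Q₁ Q₂ Q₃ k : ℤ) : ℂ :=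
  (-1) ^ k * qF A (k + 1) * (invF A (k - T₁) * invF A (k - T₂) * invF A (k - T₃) *
    invF A (k - T₄)) * (invF A (Q₁ - k) * invF A (Q₂ - k) * invF A (Q₃ - k))

/-- The Racah sum. -/
def racah (A : ℂ) (T₁ T₂ T₃ T₄ Q₁ Q₂ Q₃ : ℤ) : ℂ :=
  ∑ k ∈ Finset.range (Q₁.toNat + 1), racahTerm A T₁ T₂ T₃ T₄ Q₁ Q₂ Q₃ k

theorem racahTerm_of_T_lt (A : ℂ) {T₁ T₂ T₃ T₄ Q₁ Q₂ Q₃ k : ℤ}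
    (h : k < T₁ ∨ k < T₂ ∨ k < T₃ ∨ k < T₄) : racahTerm A T₁ T₂ T₃ T₄ Q₁ Q₂ Q₃ k = 0 := by
  unfold racahTerm
  rcases h with h | h | h | h <;> simp [invF_of_neg A (sub_neg.mpr h)]

theorem racahTerm_of_Q_lt (A : ℂ) {T₁ T₂ T₃ T₄ Q₁ Q₂ Q₃ k : ℤ}
    (h : Q₁ < k ∨ Q₂ < k ∨ Q₃ < k) : racahTerm A T₁ T₂ T₃ T₄ Q₁ Q₂ Q₃ k = 0 := by
  unfold racahTerm
  rcases h with h | h | h <;> simp [invF_of_neg A (sub_neg.mpr h)]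

/-- Racah sums with different parameters can thus be compared term by term over one common range. -/
theorem racah_eq_sum (A : ℂ) {T₁ T₂ T₃ T₄ Q₁ Q₂ Q₃ : ℤ} {N : ℕ}
    (h : Q₁ < N ∨ Q₂ < N ∨ Q₃ < N) :
    racah A T₁ T₂ T₃ T₄ Q₁ Q₂ Q₃ =
      ∑ k ∈ Finset.range N, racahTerm A T₁ T₂ T₃ T₄ Q₁ Q₂ Q₃ k := by
  have aux : ∀ M N : ℕ, M ≤ N → (Q₁ < M ∨ Q₂ < M ∨ Q₃ < M) →
      ∑ k ∈ Finset.range M, racahTerm A T₁ T₂ T₃ T₄ Q₁ Q₂ Q₃ k =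
      ∑ k ∈ Finset.range N, racahTerm A T₁ T₂ T₃ T₄ Q₁ Q₂ Q₃ k := by
    intro M N hMN hM
    refine Finset.sum_subset (Finset.range_mono hMN) fun k _ hk => racahTerm_of_Q_lt A ?_
    rw [Finset.mem_range] at hk
    omega
  unfold racah
  rcases le_total (Q₁.toNat + 1) N with h' | h'
  · exact aux _ _ h' (by omega)
  · exact (aux _ _ h' h).symm

theorem racah_eq_zero (A : ℂ) {T₁ T₂ T₃ T₄ Q₁ Q₂ Q₃ : ℤ}
    (h : min Q₁ (min Q₂ Q₃) < max (max T₁ T₂) (max T₃ T₄)) :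
    racah A T₁ T₂ T₃ T₄ Q₁ Q₂ Q₃ = 0 := by
  refine Finset.sum_eq_zero fun k _ => ?_
  by_cases hk : (k : ℤ) < T₁ ∨ (k : ℤ) < T₂ ∨ (k : ℤ) < T₃ ∨ (k : ℤ) < T₄
  · exact racahTerm_of_T_lt A hk
  · exact racahTerm_of_Q_lt A (by omega)

/-- A lower limit that equals an upper limit leaves room for one summation index only. This happens
for tetrahedra with an edge of colour 0 or 1/2. -/
theorem racah_eq_term (A : ℂ) {T₁ T₂ T₃ T₄ Q₁ Q₂ Q₃ : ℤ} (k : ℤ) (hk : 0 ≤ k)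
    (hT : k = T₁ ∨ k = T₂ ∨ k = T₃ ∨ k = T₄) (hQ : k = Q₁ ∨ k = Q₂ ∨ k = Q₃) :
    racah A T₁ T₂ T₃ T₄ Q₁ Q₂ Q₃ = racahTerm A T₁ T₂ T₃ T₄ Q₁ Q₂ Q₃ k := by
  obtain ⟨n, rfl⟩ := Int.eq_ofNat_of_zero_le hk
  rw [racah_eq_sum A (N := n + 1) (by omega)]
  refine Finset.sum_eq_single n (fun m _ hm => ?_) fun h => absurd (Finset.self_mem_range_succ n) h
  rcases lt_or_gt_of_ne hm with h | h
  · exact racahTerm_of_T_lt A (by omega)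
  · exact racahTerm_of_Q_lt A (by omega)

/-- The hypotheses express equality of multisets of parameters in a form that `ring` can verify. -/
theorem racah_perm (A : ℂ) {T₁ T₂ T₃ T₄ Q₁ Q₂ Q₃ S₁ S₂ S₃ S₄ P₁ P₂ P₃ : ℤ}
    (hT : ∀ f : ℤ → ℂ, f T₁ * f T₂ * f T₃ * f T₄ = f S₁ * f S₂ * f S₃ * f S₄)
    (hQ : ∀ f : ℤ → ℂ, f Q₁ * f Q₂ * f Q₃ = f P₁ * f P₂ * f P₃) :
    racah A T₁ T₂ T₃ T₄ Q₁ Q₂ Q₃ = racah A S₁ S₂ S₃ S₄ P₁ P₂ P₃ := by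
  obtain ⟨N, hN⟩ : ∃ N : ℕ, Q₁ < N ∧ P₁ < N :=
    ⟨Q₁.toNat + P₁.toNat + 1, by omega, by omega⟩
  rw [racah_eq_sum A (N := N) (by omega), racah_eq_sum A (N := N) (by omega)]
  refine Finset.sum_congr rfl fun k _ => ?_
  unfold racahTerm
  rw [hT fun T => invF A (k - T), hQ fun Q => invF A (Q - k)]

/-! ### Contiguous relations -/

section Contiguous

variable {A : ℂ} (h0 : 0 < ‖A‖) (h1 : ‖A‖ < 1) {T₁ T₂ T₃ T₄ Q₁ Q₂ Q₃ : ℤ}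

theorem neg_one_zpow_succ (k : ℤ) : (-1 : ℂ) ^ (k + 1) = -(-1) ^ k := by
  rw [zpow_add_one₀ (by norm_num)]; ring

include h0 h1

/-- The difference of the two sides, term by term, is a telescoping difference. Here `G` is the
telescoping certificate, and the differences of `F` shift the index of the first sum by one so that
its factorials match those of the others. -/
theorem racah_contiguous_up_up (hs : Q₁ + Q₂ + Q₃ = T₁ + T₂ + T₃ + T₄) (hT : 0 ≤ T₂) :
    qInt A (Q₂ - T₁ + 1) * qInt A (Q₃ - T₁ + 1) *
        racah A T₁ (T₂ + 1) (T₃ + 1) (T₄ + 1) (Q₁ + 1) (Q₂ + 1) (Q₃ + 1) -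
      qInt A (Q₁ + 1 - T₂) * qInt A (Q₁ + 1 - T₃) *
        racah A T₁ T₂ T₃ (T₄ + 1) (Q₁ + 1) Q₂ Q₃ =
    -(qInt A (T₄ + 2) * qInt A (Q₂ + Q₃ - T₁ - T₄ + 1) * racah A T₁ T₂ T₃ T₄ Q₁ Q₂ Q₃) := by
  obtain ⟨N, hN⟩ : ∃ N : ℕ, Q₁ + 1 < N := ⟨(Q₁ + 1).toNat + 1, by omega⟩
  rw [racah_eq_sum A (N := N) (by omega), racah_eq_sum A (N := N) (by omega),
    racah_eq_sum A (N := N) (by omega)]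
  set c₂ := qInt A (Q₂ - T₁ + 1) * qInt A (Q₃ - T₁ + 1)
  set F : ℕ → ℂ := fun k => racahTerm A T₁ (T₂ + 1) (T₃ + 1) (T₄ + 1) (Q₁ + 1) (Q₂ + 1) (Q₃ + 1) k
  set G : ℕ → ℂ := fun k => (-1) ^ (k : ℤ) * qF A (k + 1) * (invF A (k - T₁) *
    invF A (k - 1 - T₂) * invF A (k - 1 - T₃) * invF A (k - 1 - T₄)) *
    (invF A (Q₁ + 1 - k) * invF A (Q₂ - k) * invF A (Q₃ - k))
  have hF : ∑ k ∈ Finset.range N, (F (k + 1) - F k) = 0 := by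
    rw [Finset.sum_range_sub]
    simp only [F]
    rw [racahTerm_of_Q_lt A (by omega), racahTerm_of_T_lt A (by right; left; push_cast; omega),
      sub_zero]
  have hG : ∑ k ∈ Finset.range N, (G (k + 1) - G k) = 0 := by
    rw [Finset.sum_range_sub]
    simp only [G]
    rw [invF_of_neg A (by omega : Q₁ + 1 - (N : ℤ) < 0),
      invF_of_neg A (by push_cast; omega : ((0 : ℕ) : ℤ) - 1 - T₂ < 0)]
    simp
  rw [← sub_eq_zero, Finset.mul_sum, Finset.mul_sum, Finset.mul_sum, ← Finset.sum_neg_distrib,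
    ← Finset.sum_sub_distrib, ← Finset.sum_sub_distrib]
  refine Eq.trans (Finset.sum_congr rfl fun k _ => ?_)
    (b := ∑ k ∈ Finset.range N, ((G (k + 1) - G k) - c₂ * (F (k + 1) - F k)))
    (by rw [Finset.sum_sub_distrib, ← Finset.mul_sum, hF, hG]; simp)
  -- `a₁` and `a₂` split each constant coefficient into a `k`-dependent product, which telescopes,
  -- and a factorised remainder. By `a₃`, which needs the balance condition `hs`, the two remainders
  -- add up to the coefficient on the right.
  have a₁ : qInt A (Q₂ - T₁ + 1) * qInt A (Q₃ - T₁ + 1) - qInt A (Q₂ - k) * qInt A (Q₃ - k) =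
      qInt A (k + 1 - T₁) * qInt A (Q₂ + Q₃ - T₁ + 1 - k) :=
    qInt_mul_sub_mul' h0 _ _ (by omega) (by omega) (by omega)
  have a₂ : qInt A (Q₁ + 1 - T₂) * qInt A (Q₁ + 1 - T₃) - qInt A (k - T₂) * qInt A (k - T₃) =
      qInt A (Q₁ + 1 - k) * qInt A (Q₁ + 1 + k - T₂ - T₃) :=
    qInt_mul_sub_mul' h0 _ _ (by omega) (by omega) (by omega)
  have a₃ : qInt A (k + 2) * qInt A (Q₂ + Q₃ - T₁ + 1 - k) +
      qInt A (k - T₄) * qInt A (Q₁ + 1 + k - T₂ - T₃) =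
      qInt A (T₄ + 2) * qInt A (Q₂ + Q₃ - T₁ - T₄ + 1) := by
    have := qInt_mul_sub_mul h0 (x := k + 2) (y := Q₂ + Q₃ - T₁ + 1 - k) (z := T₄ + 2)
      (t := Q₂ + Q₃ - T₁ - T₄ + 1) (k - T₄) (Q₁ + 1 + k - T₂ - T₃)
      (by omega) (by omega) (by omega)
    linear_combination this
  have q₁ : qF A ((k : ℤ) + 1 + 1) = qInt A (k + 2) * qF A (k + 1) := by
    rw [qF_succ A (by omega)]; ring_nf
  simp only [F, G, racahTerm, c₂]
  push_cast
  rw [neg_one_zpow_succ, q₁, show (k : ℤ) + 1 - (T₂ + 1) = k - T₂ by ring,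
    show (k : ℤ) + 1 - (T₃ + 1) = k - T₃ by ring, show (k : ℤ) + 1 - (T₄ + 1) = k - T₄ by ring,
    show Q₁ + 1 - ((k : ℤ) + 1) = Q₁ - k by ring, show Q₂ + 1 - ((k : ℤ) + 1) = Q₂ - k by ring,
    show Q₃ + 1 - ((k : ℤ) + 1) = Q₃ - k by ring, show (k : ℤ) + 1 - 1 - T₂ = k - T₂ by ring,
    show (k : ℤ) + 1 - 1 - T₃ = k - T₃ by ring, show (k : ℤ) + 1 - 1 - T₄ = k - T₄ by ring,
    show (k : ℤ) - (T₄ + 1) = k - 1 - T₄ by ring,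
    invF_eq h0 h1 (k - T₂) (by ring : (k : ℤ) - 1 - T₂ + 1 = k - T₂),
    invF_eq h0 h1 (k - T₃) (by ring : (k : ℤ) - 1 - T₃ + 1 = k - T₃),
    invF_eq h0 h1 (k - T₄) (by ring : (k : ℤ) - 1 - T₄ + 1 = k - T₄),
    invF_eq h0 h1 (k + 1 - T₁) (by ring : (k : ℤ) - T₁ + 1 = k + 1 - T₁),
    invF_eq h0 h1 (Q₁ + 1 - k) (by ring : Q₁ - (k : ℤ) + 1 = Q₁ + 1 - k),
    invF_eq h0 h1 (Q₂ - k) (by ring : Q₂ - ((k : ℤ) + 1) + 1 = Q₂ - k),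
    invF_eq h0 h1 (Q₃ - k) (by ring : Q₃ - ((k : ℤ) + 1) + 1 = Q₃ - k)]
  linear_combination (-1) ^ (k : ℤ) * qF A (k + 1) * invF A (k + 1 - T₁) * invF A (k - T₂) *
    invF A (k - T₃) * invF A (k - T₄) * invF A (Q₁ + 1 - k) * invF A (Q₂ - k) *
    invF A (Q₃ - k) * (-(qInt A (k + 2) * qInt A (Q₁ + 1 - k)) * a₁ -
      qInt A (k + 1 - T₁) * qInt A (k - T₄) * a₂ -
      qInt A (k + 1 - T₁) * qInt A (Q₁ + 1 - k) * a₃)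

/-- Same telescoping method; this time the first sum is shifted by one in the opposite direction. -/
theorem racah_contiguous_down_down (hs : Q₁ + Q₂ + Q₃ = T₁ + T₂ + T₃ + T₄) (hT : 0 ≤ T₁) :
    qInt A (T₂ + 1) * qInt A (T₃ + 1) *
        racah A T₁ (T₂ - 1) (T₃ - 1) (T₄ - 1) (Q₁ - 1) (Q₂ - 1) (Q₃ - 1) -
      qInt A (Q₂ - T₄ + 1) * qInt A (Q₃ - T₄ + 1) *
        racah A T₁ T₂ T₃ (T₄ - 1) (Q₁ - 1) Q₂ Q₃ =
    -(qInt A (Q₁ - T₁) * qInt A (T₂ + T₃ + 1 - Q₁) * racah A T₁ T₂ T₃ T₄ Q₁ Q₂ Q₃) := by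
  obtain ⟨N, hN⟩ : ∃ N : ℕ, Q₁ < N := ⟨Q₁.toNat + 1, by omega⟩
  rw [racah_eq_sum A (N := N) (by omega), racah_eq_sum A (N := N) (by omega),
    racah_eq_sum A (N := N) (by omega)]
  set c₂ := qInt A (T₂ + 1) * qInt A (T₃ + 1)
  set F : ℕ → ℂ := fun k =>
    racahTerm A T₁ (T₂ - 1) (T₃ - 1) (T₄ - 1) (Q₁ - 1) (Q₂ - 1) (Q₃ - 1) (k - 1)
  set G : ℕ → ℂ := fun k => (-1) ^ (k : ℤ) * qF A k * (invF A (k - 1 - T₁) *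
    invF A (k - 1 - T₂) * invF A (k - 1 - T₃) * invF A (k - T₄)) *
    (invF A (Q₁ - k) * invF A (Q₂ - k) * invF A (Q₃ - k))
  have hF : ∑ k ∈ Finset.range N, (F (k + 1) - F k) = 0 := by
    rw [Finset.sum_range_sub]
    simp only [F]
    rw [racahTerm_of_Q_lt A (by omega), racahTerm_of_T_lt A (by left; push_cast; omega),
      sub_zero]
  have hG : ∑ k ∈ Finset.range N, (G (k + 1) - G k) = 0 := by
    rw [Finset.sum_range_sub]
    simp only [G]
    rw [invF_of_neg A (by omega : Q₁ - (N : ℤ) < 0),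
      invF_of_neg A (by push_cast; omega : ((0 : ℕ) : ℤ) - 1 - T₁ < 0)]
    simp
  rw [← sub_eq_zero, Finset.mul_sum, Finset.mul_sum, Finset.mul_sum, ← Finset.sum_neg_distrib,
    ← Finset.sum_sub_distrib, ← Finset.sum_sub_distrib]
  refine Eq.trans (Finset.sum_congr rfl fun k _ => ?_)
    (b := ∑ k ∈ Finset.range N, ((G (k + 1) - G k) + c₂ * (F (k + 1) - F k)))
    (by rw [Finset.sum_add_distrib, ← Finset.mul_sum, hF, hG]; simp)
  have a₁ : qInt A (T₂ + 1) * qInt A (T₃ + 1) - qInt A (k - T₂) * qInt A (k - T₃) =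
      qInt A (k + 1) * qInt A (T₂ + T₃ + 1 - k) := by
    rw [show (k : ℤ) - T₂ = -(T₂ - k) by ring, show (k : ℤ) - T₃ = -(T₃ - k) by ring, qInt_neg,
      qInt_neg, neg_mul_neg]
    exact qInt_mul_sub_mul' h0 _ _ (by omega) (by omega) (by omega)
  have a₂ : qInt A (Q₂ - T₄ + 1) * qInt A (Q₃ - T₄ + 1) - qInt A (Q₂ - k) * qInt A (Q₃ - k) =
      qInt A (k + 1 - T₄) * qInt A (Q₂ + Q₃ - T₄ + 1 - k) :=
    qInt_mul_sub_mul' h0 _ _ (by omega) (by omega) (by omega)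
  have a₃ : qInt A (k - T₁) * qInt A (T₂ + T₃ + 1 - k) +
      qInt A (Q₁ - k) * qInt A (Q₂ + Q₃ - T₄ + 1 - k) =
      qInt A (Q₁ - T₁) * qInt A (T₂ + T₃ + 1 - Q₁) := by
    have := qInt_mul_sub_mul h0 (x := Q₁ - T₁) (y := T₂ + T₃ + 1 - Q₁) (z := k - T₁)
      (t := T₂ + T₃ + 1 - k) (Q₁ - k) (-(Q₂ + Q₃ - T₄ + 1 - k))
      (by omega) (by omega) (by omega)
    rw [qInt_neg] at this
    linear_combination -this
  simp only [F, G, racahTerm, c₂]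
  push_cast
  rw [neg_one_zpow_succ, show (-1 : ℂ) ^ ((k : ℤ) - 1) = -(-1) ^ (k : ℤ) by
      rw [zpow_sub_one₀ (by norm_num)]; ring]
  simp only [add_sub_cancel_right, sub_add_cancel, sub_sub_sub_cancel_right]
  rw [qF_succ A (by omega : (0 : ℤ) ≤ k), show (k : ℤ) - (T₂ - 1) = k + 1 - T₂ by ring,
    show (k : ℤ) - (T₃ - 1) = k + 1 - T₃ by ring, show (k : ℤ) - (T₄ - 1) = k + 1 - T₄ by ring,
    invF_eq h0 h1 (k - T₁) (by ring : (k : ℤ) - 1 - T₁ + 1 = k - T₁),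
    invF_eq h0 h1 (k - T₂) (by ring : (k : ℤ) - 1 - T₂ + 1 = k - T₂),
    invF_eq h0 h1 (k - T₃) (by ring : (k : ℤ) - 1 - T₃ + 1 = k - T₃),
    invF_eq h0 h1 (k + 1 - T₄) (by ring : (k : ℤ) - T₄ + 1 = k + 1 - T₄),
    invF_eq h0 h1 (Q₁ - k) (by ring : Q₁ - ((k : ℤ) + 1) + 1 = Q₁ - k),
    invF_eq h0 h1 (Q₁ - k) (by ring : Q₁ - 1 - (k : ℤ) + 1 = Q₁ - k),
    invF_eq h0 h1 (Q₂ - k) (by ring : Q₂ - ((k : ℤ) + 1) + 1 = Q₂ - k),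
    invF_eq h0 h1 (Q₃ - k) (by ring : Q₃ - ((k : ℤ) + 1) + 1 = Q₃ - k)]
  linear_combination (-1) ^ (k : ℤ) * qF A k * invF A (k - T₁) * invF A (k - T₂) *
    invF A (k - T₃) * invF A (k + 1 - T₄) * invF A (Q₁ - k) * invF A (Q₂ - k) *
    invF A (Q₃ - k) * (-(qInt A (k - T₁) * qInt A (k + 1 - T₄)) * a₁ -
      qInt A (k + 1) * qInt A (Q₁ - k) * a₂ -
      qInt A (k + 1) * qInt A (k + 1 - T₄) * a₃)

/-- Same telescoping method; the three sums are already aligned, so the certificate `G` suffices. -/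
theorem racah_contiguous_up_down (hs : Q₁ + Q₂ + Q₃ = T₁ + T₂ + T₃ + T₄) (hT : 0 ≤ T₁) :
    qInt A (Q₂ + 1 - T₁) * qInt A (Q₂ + 1 - T₄) * racah A T₁ T₂ (T₃ + 1) T₄ Q₁ (Q₂ + 1) Q₃ +
      qInt A (T₂ + 1) * qInt A (Q₁ - T₂ + 1) * racah A T₁ (T₂ - 1) T₃ T₄ Q₁ Q₂ (Q₃ - 1) =
    qInt A (Q₃ - T₃) * qInt A (Q₂ + Q₃ + 1 - T₁ - T₄) * racah A T₁ T₂ T₃ T₄ Q₁ Q₂ Q₃ := by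
  obtain ⟨N, hN⟩ : ∃ N : ℕ, Q₁ < N := ⟨Q₁.toNat + 1, by omega⟩
  rw [racah_eq_sum A (N := N) (by omega), racah_eq_sum A (N := N) (by omega),
    racah_eq_sum A (N := N) (by omega)]
  set G : ℕ → ℂ := fun k => -((-1) ^ (k : ℤ) * qF A (k + 1) * (invF A (k - 1 - T₁) *
    invF A (k - T₂) * invF A (k - 1 - T₃) * invF A (k - 1 - T₄)) *
    (invF A (Q₁ - k) * invF A (Q₂ + 1 - k) * invF A (Q₃ - k)))
  have hG : ∑ k ∈ Finset.range N, (G (k + 1) - G k) = 0 := by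
    rw [Finset.sum_range_sub]
    simp only [G]
    rw [invF_of_neg A (by omega : Q₁ - (N : ℤ) < 0),
      invF_of_neg A (by push_cast; omega : ((0 : ℕ) : ℤ) - 1 - T₁ < 0)]
    simp
  rw [← sub_eq_zero, Finset.mul_sum, Finset.mul_sum, Finset.mul_sum, ← Finset.sum_add_distrib,
    ← Finset.sum_sub_distrib]
  refine Eq.trans (Finset.sum_congr rfl fun k _ => ?_) hG
  have a₁ : qInt A (T₂ + 1) * qInt A (Q₁ - T₂ + 1) - qInt A (k + 2) * qInt A (Q₁ - k) =
      qInt A (k + 1 - T₂) * qInt A (k + 1 + T₂ - Q₁) := by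
    have := qInt_mul_sub_mul h0 (x := k + 2) (y := Q₁ - k) (z := T₂ + 1)
      (t := Q₁ - T₂ + 1) (k + 1 - T₂) (k + 1 + T₂ - Q₁) (by omega) (by omega) (by omega)
    linear_combination -this
  have a₂ : qInt A (Q₂ + 1 - T₁) * qInt A (Q₂ + 1 - T₄) - qInt A (k - T₁) * qInt A (k - T₄) =
      qInt A (Q₂ + 1 - k) * qInt A (Q₂ + 1 + k - T₁ - T₄) :=
    qInt_mul_sub_mul' h0 _ _ (by omega) (by omega) (by omega)
  have a₃ : qInt A (Q₃ - k) * qInt A (k + 1 + T₂ - Q₁) +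
      qInt A (k - T₃) * qInt A (Q₂ + 1 + k - T₁ - T₄) =
      qInt A (Q₃ - T₃) * qInt A (Q₂ + Q₃ + 1 - T₁ - T₄) := by
    have := qInt_mul_sub_mul h0 (x := k - T₃) (y := Q₂ + 1 + k - T₁ - T₄) (z := k - Q₃)
      (t := k + 1 + T₂ - Q₁) (Q₃ - T₃) (-(Q₂ + Q₃ + 1 - T₁ - T₄))
      (by omega) (by omega) (by omega)
    rw [qInt_neg, show (k : ℤ) - Q₃ = -(Q₃ - k) by ring, qInt_neg] at this
    linear_combination this
  have q₁ : qF A ((k : ℤ) + 1 + 1) = qInt A (k + 2) * qF A (k + 1) := by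
    rw [qF_succ A (by omega)]; ring_nf
  simp only [G, racahTerm]
  push_cast
  rw [neg_one_zpow_succ, q₁]
  simp only [add_sub_cancel_right, add_sub_add_right_eq_sub]
  rw [show (k : ℤ) - (T₃ + 1) = k - 1 - T₃ by ring,
    show (k : ℤ) - (T₂ - 1) = k + 1 - T₂ by ring,
    invF_eq h0 h1 (k - T₁) (by ring : (k : ℤ) - 1 - T₁ + 1 = k - T₁),
    invF_eq h0 h1 (k + 1 - T₂) (by ring : (k : ℤ) - T₂ + 1 = k + 1 - T₂),
    invF_eq h0 h1 (k - T₃) (by ring : (k : ℤ) - 1 - T₃ + 1 = k - T₃),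
    invF_eq h0 h1 (k - T₄) (by ring : (k : ℤ) - 1 - T₄ + 1 = k - T₄),
    invF_eq h0 h1 (Q₁ - k) (by ring : Q₁ - ((k : ℤ) + 1) + 1 = Q₁ - k),
    invF_eq h0 h1 (Q₂ + 1 - k) (by ring : Q₂ - (k : ℤ) + 1 = Q₂ + 1 - k),
    invF_eq h0 h1 (Q₃ - k) (by ring : Q₃ - ((k : ℤ) + 1) + 1 = Q₃ - k),
    invF_eq h0 h1 (Q₃ - k) (by ring : Q₃ - 1 - (k : ℤ) + 1 = Q₃ - k)]
  linear_combination (-1) ^ (k : ℤ) * qF A (k + 1) * invF A (k - T₁) * invF A (k + 1 - T₂) *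
    invF A (k - T₃) * invF A (k - T₄) * invF A (Q₁ - k) * invF A (Q₂ + 1 - k) *
    invF A (Q₃ - k) * (qInt A (Q₂ + 1 - k) * qInt A (Q₃ - k) * a₁ +
      qInt A (k + 1 - T₂) * qInt A (k - T₃) * a₂ +
      qInt A (k + 1 - T₂) * qInt A (Q₂ + 1 - k) * a₃)

end Contiguous
/-! ### Powers of the imaginary unit -/

theorem I_zpow_congr {m n : ℤ} (h : (m - n) % 4 = 0) : Complex.I ^ m = Complex.I ^ n := by
  obtain ⟨k, hk⟩ := Int.dvd_of_emod_eq_zero h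
  obtain rfl : m = n + 4 * k := by omega
  rw [zpow_add₀ Complex.I_ne_zero, zpow_mul, show (4 : ℤ) = ((4 : ℕ) : ℤ) from rfl, zpow_natCast,
    Complex.I_pow_four, one_zpow, mul_one]

theorem I_zpow_eq_neg {m n : ℤ} (h : (m - n) % 4 = 2) : Complex.I ^ m = -Complex.I ^ n := by
  rw [I_zpow_congr (show (m - (n + 2)) % 4 = 0 by omega), zpow_add₀ Complex.I_ne_zero,
    show (2 : ℤ) = ((2 : ℕ) : ℤ) from rfl, zpow_natCast, Complex.I_sq]
  ring

theorem neg_one_zpow_eq (n : ℤ) : (-1 : ℂ) ^ n = Complex.I ^ (2 * n) := by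
  rw [zpow_mul, show (2 : ℤ) = ((2 : ℕ) : ℤ) from rfl, zpow_natCast, Complex.I_sq]

theorem I_zpow_mul (m n : ℤ) : Complex.I ^ m * Complex.I ^ n = Complex.I ^ (m + n) :=
  (zpow_add₀ Complex.I_ne_zero m n).symm

/-! ### Normalised triangles -/

theorem admTriple_comm {a b c : ℤ} : AdmTriple a b c ↔ AdmTriple b a c := by
  unfold AdmTriple
  rw [show b + a + c = a + b + c by ring]
  constructor <;> rintro ⟨h1, h2, h3, h4, h5, h6, h7⟩ <;>
    exact ⟨h2, h1, h3, by omega, by omega, by omega, h7⟩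

theorem admTriple_rotate {a b c : ℤ} : AdmTriple a b c ↔ AdmTriple b c a := by
  unfold AdmTriple
  rw [show b + c + a = a + b + c by ring]
  constructor <;> rintro ⟨h1, h2, h3, h4, h5, h6, h7⟩ <;>
    exact ⟨by omega, by omega, by omega, by omega, by omega, by omega, h7⟩

/-- Adding two of the triangle inequalities gives nonnegativity, so those conditions are redundant.
-/
theorem admTriple_iff {a b c : ℤ} : AdmTriple a b c ↔
    c ≤ a + b ∧ a ≤ b + c ∧ b ≤ c + a ∧ (a + b + c) % 2 = 0 := by
  unfold AdmTriple
  rw [Int.even_iff]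
  omega

open Classical in
/-- `Δ(a,b,c)`, extended by zero to triples that are not admissible. -/
def tri (A : ℂ) (a b c : ℤ) : ℂ := if AdmTriple a b c then bigDelta A a b c else 0

theorem tri_of_not {A : ℂ} {a b c : ℤ} (h : ¬AdmTriple a b c) : tri A a b c = 0 := if_neg h

theorem tri_comm (A : ℂ) (a b c : ℤ) : tri A a b c = tri A b a c := by
  by_cases h : AdmTriple a b c
  swap
  · rw [tri_of_not h, tri_of_not (mt admTriple_comm.mpr h)]
  rw [tri, tri, if_pos h, if_pos (admTriple_comm.mp h), bigDelta, bigDelta]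
  rw [add_comm b a, add_comm b c, add_comm c a]
  ring

theorem tri_rotate (A : ℂ) (a b c : ℤ) : tri A a b c = tri A b c a := by
  by_cases h : AdmTriple a b c
  swap
  · rw [tri_of_not h, tri_of_not (mt admTriple_rotate.mpr h)]
  rw [tri, tri, if_pos h, if_pos (admTriple_rotate.mp h), bigDelta, bigDelta]
  rw [show b + c + a = a + b + c by ring]
  ring

section
variable {A : ℂ} (h0 : 0 < ‖A‖) (h1 : ‖A‖ < 1)
include h0 h1

theorem sqrtQFact_sq (n : ℕ) : sqrtQFact A n ^ 2 = qFact A n := by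
  unfold sqrtQFact qFact
  rw [← Finset.prod_pow]
  refine Finset.prod_congr rfl fun j _ => ?_
  rw [sqrtQInt_sq A h0 h1]
  push_cast
  rfl

theorem sqrtQFact_ne_zero (n : ℕ) : sqrtQFact A n ≠ 0 := by
  intro h
  apply qFact_ne_zero h0 h1 n
  rw [← sqrtQFact_sq h0 h1, h]
  norm_num

theorem tri_ne_zero {a b c : ℤ} (h : AdmTriple a b c) : tri A a b c ≠ 0 := by
  rw [tri, if_pos h]
  have := sqrtQFact_ne_zero h0 h1
  exact div_ne_zero (mul_ne_zero (mul_ne_zero (this _) (this _)) (this _)) (this _)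

theorem tri_sq {a b c t : ℤ} (h : AdmTriple a b c) (ht : a + b + c = 2 * t) :
    tri A a b c ^ 2 = qF A (t - a) * qF A (t - b) * qF A (t - c) * invF A (t + 1) := by
  have h' := h
  rw [tri, if_pos h']
  rw [admTriple_iff] at h
  rw [invF_of_nonneg A (by omega), bigDelta, div_pow, mul_pow, mul_pow, sqrtQFact_sq h0 h1,
    sqrtQFact_sq h0 h1, sqrtQFact_sq h0 h1, sqrtQFact_sq h0 h1,
    show (a + b - c) / 2 = t - c by omega, show (b + c - a) / 2 = t - a by omega,
    show (c + a - b) / 2 = t - b by omega, show (a + b + c) / 2 + 1 = t + 1 by omega]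
  unfold qF
  ring

theorem tri_sq_one {a b : ℤ} (ha : 0 ≤ a) (hb : 0 ≤ b) (hab : b = a + 1 ∨ b = a - 1) :
    tri A a b 1 ^ 2 * (qInt A (a + 1) * qInt A (b + 1)) = 1 := by
  wlog h : b = a + 1 generalizing a b
  · have := this hb ha (by omega) (by omega)
    rw [tri_comm, mul_comm (qInt A (a + 1))]
    exact this
  subst h
  rw [tri_sq h0 h1 (t := a + 1) (by rw [admTriple_iff]; omega) (by ring)]
  rw [show a + 1 - a = 0 + 1 by ring, qF_succ A le_rfl, sub_self,
    show a + 1 - 1 = a by ring]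
  have e1 := qF_succ A ha
  have e2 := qF_succ A hb
  have e3 := qF_mul_invF h0 h1 (by omega : 0 ≤ a + 1 + 1)
  rw [e2, e1] at e3
  have : qF A 0 = 1 := by simp [qF, qFact]
  rw [this, zero_add, qInt_one h0 h1]
  linear_combination e3

/-! ### Tetrahedra -/

/-- No case distinction remains: `tri` vanishes on triples that are not admissible, and the inverse
factorials vanish outside the range of summation. -/
theorem tet_eq (a b c d e f : ℤ) : tet A a b c d e f =
    Complex.I ^ (a + b + c + d + e + f) *
      (tri A a b c * tri A a e f * tri A d b f * tri A d e c) *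
      racah A ((a + b + c) / 2) ((a + e + f) / 2) ((d + b + f) / 2) ((d + e + c) / 2)
        ((a + b + d + e) / 2) ((a + c + d + f) / 2) ((b + c + e + f) / 2) := by
  unfold tet
  split_ifs with h
  · obtain ⟨hT₁, hT₂, hT₃, hT₄⟩ := h
    simp only [tri, if_pos hT₁, if_pos hT₂, if_pos hT₃, if_pos hT₄]
    congr 1
    rw [admTriple_iff] at *
    generalize hA₁ : (a + b + c) / 2 = T₁
    generalize hA₂ : (a + e + f) / 2 = T₂
    generalize hA₃ : (d + b + f) / 2 = T₃
    generalize hA₄ : (d + e + c) / 2 = T₄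
    generalize hB₁ : (a + b + d + e) / 2 = Q₁
    generalize hB₂ : (a + c + d + f) / 2 = Q₂
    generalize hB₃ : (b + c + e + f) / 2 = Q₃
    rw [racah, show ∑ k ∈ Finset.range (Q₁.toNat + 1), racahTerm A T₁ T₂ T₃ T₄ Q₁ Q₂ Q₃ k =
      ∑ k ∈ (Finset.range (Q₁.toNat + 1)).map Nat.castEmbedding,
        racahTerm A T₁ T₂ T₃ T₄ Q₁ Q₂ Q₃ k by rw [Finset.sum_map]; rfl]
    refine Eq.trans (Finset.sum_congr rfl fun k hk => ?_) (Finset.sum_subset ?_ ?_)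
    · rw [Finset.mem_Icc] at hk
      unfold racahTerm
      rw [invF_of_nonneg A (by omega), invF_of_nonneg A (by omega), invF_of_nonneg A (by omega),
        invF_of_nonneg A (by omega), invF_of_nonneg A (by omega), invF_of_nonneg A (by omega),
        invF_of_nonneg A (by omega)]
      have : qFact A 1 = 1 := by simp [qFact, qInt_one h0 h1]
      rw [this]
      simp only [qF, div_eq_mul_inv, mul_inv, inv_one]
      ring
    · intro k hk
      rw [Finset.mem_Icc] at hk
      rw [Finset.mem_map]
      refine ⟨k.toNat, Finset.mem_range.mpr (by omega), ?_⟩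
      change (k.toNat : ℤ) = k
      omega
    · intro k _ hk
      rw [Finset.mem_Icc] at hk
      by_cases hk' : k < T₁ ∨ k < T₂ ∨ k < T₃ ∨ k < T₄
      · exact racahTerm_of_T_lt A hk'
      · exact racahTerm_of_Q_lt A (by omega)
  · have : tri A a b c * tri A a e f * tri A d b f * tri A d e c = 0 := by
      by_contra hne
      simp only [mul_ne_zero_iff] at hne
      obtain ⟨⟨⟨n₁, n₂⟩, n₃⟩, n₄⟩ := hne
      exact h ⟨not_imp_comm.mp tri_of_not n₁, not_imp_comm.mp tri_of_not n₂,
        not_imp_comm.mp tri_of_not n₃, not_imp_comm.mp tri_of_not n₄⟩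
    rw [this]
    ring

/-- Together with `tet_rotate` and `tet_flip` this generates the full symmetry of the tetrahedron.
Each symmetry permutes the four triangles, the `T`'s and the `Q`'s. -/
theorem tet_swap (a b c d e f : ℤ) : tet A a b c d e f = tet A b a c e d f := by
  have t₁ := tri_comm A a b c
  have t₂ := tri_comm A d e c
  have t₃ := tri_comm A a e f
  have t₄ := tri_comm A d b f
  rw [tet_eq h0 h1, tet_eq h0 h1 b, show b + a + c + e + d + f = a + b + c + d + e + f by ring,
    t₁, t₂, t₃, t₄, racah_perm A (S₁ := (b + a + c) / 2) (S₂ := (b + d + f) / 2)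
    (S₃ := (e + a + f) / 2) (S₄ := (e + d + c) / 2) (P₁ := (b + a + e + d) / 2)
    (P₂ := (b + c + e + f) / 2) (P₃ := (a + c + d + f) / 2) ?_ ?_]
  · ring
  · intro g
    rw [add_comm a e, add_comm d b, add_comm a b, add_comm d e]
    ring
  · intro g
    rw [show b + a + e + d = a + b + d + e by ring]
    ring

theorem tet_rotate (a b c d e f : ℤ) : tet A a b c d e f = tet A b c a e f d := by
  have t₁ : tri A a b c = tri A b c a := tri_rotate A a b c
  have t₂ : tri A a e f = tri A e f a := tri_rotate A a e f
  have t₃ : tri A d b f = tri A b f d := tri_rotate A d b f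
  have t₄ : tri A d e c = tri A e c d := tri_rotate A d e c
  rw [tet_eq h0 h1, tet_eq h0 h1 b, show b + c + a + e + f + d = a + b + c + d + e + f by ring,
    t₁, t₂, t₃, t₄, racah_perm A (S₁ := (b + c + a) / 2) (S₂ := (b + f + d) / 2)
    (S₃ := (e + c + d) / 2) (S₄ := (e + f + a) / 2) (P₁ := (b + c + e + f) / 2)
    (P₂ := (b + a + e + d) / 2) (P₃ := (c + a + f + d) / 2) ?_ ?_]
  · ring
  · intro g
    rw [show b + c + a = a + b + c by ring, show b + f + d = d + b + f by ring,
      show e + c + d = d + e + c by ring, show e + f + a = a + e + f by ring]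
    ring
  · intro g
    rw [show b + a + e + d = a + b + d + e by ring, show c + a + f + d = a + c + d + f by ring]
    ring

theorem tet_flip (a b c d e f : ℤ) : tet A a b c d e f = tet A a e f d b c := by
  rw [tet_eq h0 h1, tet_eq h0 h1 a e, show a + e + f + d + b + c = a + b + c + d + e + f by ring]
  rw [racah_perm A (S₁ := (a + e + f) / 2) (S₂ := (a + b + c) / 2) (S₃ := (d + e + c) / 2)
    (S₄ := (d + b + f) / 2) (P₁ := (a + e + d + b) / 2) (P₂ := (a + f + d + c) / 2)
    (P₃ := (e + f + b + c) / 2) ?_ ?_]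
  · ring
  · intro g
    ring
  · intro g
    rw [show a + e + d + b = a + b + d + e by ring, show a + f + d + c = a + c + d + f by ring,
      show e + f + b + c = b + c + e + f by ring]

end

theorem tet_of_not {A : ℂ} {a b c d e f : ℤ}
    (h : ¬(AdmTriple a b c ∧ AdmTriple a e f ∧ AdmTriple d b f ∧ AdmTriple d e c)) :
    tet A a b c d e f = 0 := if_neg h

/-! ### Tetrahedra with an edge of colour one half -/

/-- The tetrahedron with an edge of colour `1/2`, for a strand of colour `c` that separates the
states `x`, `y` on one side of a strand of colour `1/2` and `x'`, `y'` on its other side. -/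
def rho (A : ℂ) (c x y x' y' : ℤ) : ℂ := tet A x x' 1 y' y c

/-- The Racah sum of `rho`. -/
def rhoRacah (A : ℂ) (c x y x' y' : ℤ) : ℂ :=
  racah A ((x + x' + 1) / 2) ((x + y + c) / 2) ((y' + x' + c) / 2) ((y' + y + 1) / 2)
    ((x + x' + y' + y) / 2) ((x + 1 + y' + c) / 2) ((x' + 1 + y + c) / 2)

/-- The value of the Racah sum of `rho` times `Δ(x,y,c)²`, up to a power of `i`. -/
def rhoVal (A : ℂ) (c x y x' y' : ℤ) : ℂ :=
  if x' = x + 1 then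
    if y' = y + 1 then -qInt A ((x + y + c) / 2 + 2) else qInt A ((x + y + c) / 2 - x)
  else if y' = y + 1 then qInt A ((x + y + c) / 2 - y) else qInt A ((x + y + c) / 2 - c)

section
variable {A : ℂ} (h0 : 0 < ‖A‖) (h1 : ‖A‖ < 1)
include h0 h1

theorem rho_eq (c x y x' y' : ℤ) : rho A c x y x' y' = Complex.I ^ (x + x' + 1 + y' + y + c) *
    (tri A x x' 1 * tri A x y c * tri A y' x' c * tri A y' y 1) * rhoRacah A c x y x' y' :=
  tet_eq h0 h1 ..

theorem rho_symm (c x y x' y' : ℤ) : rho A c x y x' y' = rho A c x' y' x y :=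
  tet_swap h0 h1 ..

theorem rho_swap (c x y x' y' : ℤ) : rho A c x y x' y' = rho A c y x y' x' := by
  unfold rho
  rw [tet_rotate h0 h1 x, tet_rotate h0 h1 x', tet_flip h0 h1, tet_rotate h0 h1, tet_swap h0 h1]

omit h0 h1 in
theorem rhoRacah_symm (c x y x' y' : ℤ) : rhoRacah A c x y x' y' = rhoRacah A c x' y' x y := by
  unfold rhoRacah
  apply racah_perm
  · intro g
    rw [add_comm x x', add_comm x y, add_comm y' x', add_comm y y']
    ring
  · intro g
    rw [show x + x' + y' + y = x' + x + y + y' by ring]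
    ring

/-- In each of the four sign cases some `T` equals some `Q`, so one term survives, and its
factorials cancel those of `Δ(x,y,c)²` up to one quantum integer. The square of `Δ` keeps the
identity free of square roots. -/
theorem tri_sq_mul_rhoRacah {c x y x' y' : ℤ} (h : AdmTriple x y c)
    (hx : x' = x + 1 ∨ x' = x - 1) (hy : y' = y + 1 ∨ y' = y - 1) :
    tri A x y c ^ 2 * rhoRacah A c x y x' y' =
      Complex.I ^ (x + y + c) * rhoVal A c x y x' y' := by
  obtain ⟨t, ht⟩ : ∃ t, x + y + c = 2 * t := (even_iff_two_dvd.mp h.2.2.2.2.2.2)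
  rw [tri_sq h0 h1 h ht, ht, ← neg_one_zpow_eq]
  rw [admTriple_iff] at h
  have ht' : (x + y + c) / 2 = t := by omega
  have z₁ := qF_mul_invF h0 h1 (by omega : 0 ≤ t - x)
  have z₂ := qF_mul_invF h0 h1 (by omega : 0 ≤ t - y)
  have z₃ := qF_mul_invF h0 h1 (by omega : 0 ≤ t - c)
  have z₄ := qF_mul_invF h0 h1 (by omega : 0 ≤ t + 1)
  have s₀ := invF_zero A
  have s₁ := invF_one h0 h1
  unfold rhoRacah rhoVal
  rw [ht']
  rcases hx with rfl | rfl <;> rcases hy with rfl | rfl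
  · rw [if_pos rfl, if_pos rfl, show (x + (x + 1) + 1) / 2 = x + 1 by omega,
      show (y + 1 + (x + 1) + c) / 2 = t + 1 by omega, show (y + 1 + y + 1) / 2 = y + 1 by omega,
      show (x + (x + 1) + (y + 1) + y) / 2 = x + y + 1 by omega,
      show (x + 1 + (y + 1) + c) / 2 = t + 1 by omega,
      show (x + 1 + 1 + y + c) / 2 = t + 1 by omega,
      racah_eq_term A (t + 1) (by omega) (by omega) (by omega), racahTerm,
      show t + 1 - (x + 1) = t - x by ring, show t + 1 - t = 1 by ring, sub_self,
      show t + 1 - (y + 1) = t - y by ring, show x + y + 1 - (t + 1) = t - c by omega, s₀, s₁,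
      qF_succ A (by omega : 0 ≤ t + 1), neg_one_zpow_succ, show t + 1 + 1 = t + 2 by ring]
    linear_combination (-1) ^ t * qInt A (t + 2) * (-(qF A (t - x) * invF A (t - x) *
      (qF A (t - y) * invF A (t - y)) * (qF A (t - c) * invF A (t - c))) * z₄ -
      (qF A (t - x) * invF A (t - x) * (qF A (t - y) * invF A (t - y))) * z₃ -
      (qF A (t - x) * invF A (t - x)) * z₂ - z₁)
  · rw [if_pos rfl, if_neg (by omega), show (x + (x + 1) + 1) / 2 = x + 1 by omega,
      show (y - 1 + (x + 1) + c) / 2 = t by omega, show (y - 1 + y + 1) / 2 = y by omega,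
      show (x + (x + 1) + (y - 1) + y) / 2 = x + y by omega,
      show (x + 1 + (y - 1) + c) / 2 = t by omega,
      show (x + 1 + 1 + y + c) / 2 = t + 1 by omega,
      racah_eq_term A t (by omega) (by omega) (by omega), racahTerm,
      sub_self, show x + y - t = t - c by omega, show t + 1 - t = 1 by ring, s₀, s₁,
      invF_eq h0 h1 (t - x) (by ring : t - (x + 1) + 1 = t - x)]
    linear_combination (-1) ^ t * qInt A (t - x) * ((qF A (t - x) * invF A (t - x) *
      (qF A (t - y) * invF A (t - y)) * (qF A (t - c) * invF A (t - c))) * z₄ +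
      (qF A (t - x) * invF A (t - x) * (qF A (t - y) * invF A (t - y))) * z₃ +
      (qF A (t - x) * invF A (t - x)) * z₂ + z₁)
  · rw [if_neg (by omega), if_pos rfl, show (x + (x - 1) + 1) / 2 = x by omega,
      show (y + 1 + (x - 1) + c) / 2 = t by omega, show (y + 1 + y + 1) / 2 = y + 1 by omega,
      show (x + (x - 1) + (y + 1) + y) / 2 = x + y by omega,
      show (x + 1 + (y + 1) + c) / 2 = t + 1 by omega,
      show (x - 1 + 1 + y + c) / 2 = t by omega,
      racah_eq_term A t (by omega) (by omega) (by omega), racahTerm,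
      sub_self, show x + y - t = t - c by omega, show t + 1 - t = 1 by ring, s₀, s₁,
      invF_eq h0 h1 (t - y) (by ring : t - (y + 1) + 1 = t - y)]
    linear_combination (-1) ^ t * qInt A (t - y) * ((qF A (t - x) * invF A (t - x) *
      (qF A (t - y) * invF A (t - y)) * (qF A (t - c) * invF A (t - c))) * z₄ +
      (qF A (t - x) * invF A (t - x) * (qF A (t - y) * invF A (t - y))) * z₃ +
      (qF A (t - x) * invF A (t - x)) * z₂ + z₁)
  · rw [if_neg (by omega), if_neg (by omega), show (x + (x - 1) + 1) / 2 = x by omega,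
      show (y - 1 + (x - 1) + c) / 2 = t - 1 by omega, show (y - 1 + y + 1) / 2 = y by omega,
      show (x + (x - 1) + (y - 1) + y) / 2 = x + y - 1 by omega,
      show (x + 1 + (y - 1) + c) / 2 = t by omega,
      show (x - 1 + 1 + y + c) / 2 = t by omega,
      racah_eq_term A t (by omega) (by omega) (by omega), racahTerm,
      sub_self, show t - (t - 1) = 1 by ring, s₀, s₁,
      invF_eq h0 h1 (t - c) (by omega : x + y - 1 - t + 1 = t - c)]
    linear_combination (-1) ^ t * qInt A (t - c) * ((qF A (t - x) * invF A (t - x) *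
      (qF A (t - y) * invF A (t - y)) * (qF A (t - c) * invF A (t - c))) * z₄ +
      (qF A (t - x) * invF A (t - x) * (qF A (t - y) * invF A (t - y))) * z₃ +
      (qF A (t - x) * invF A (t - x)) * z₂ + z₁)

-- A nonzero sum requires every `T` to be at most every `Q`. These twelve inequalities are exactly
-- the twelve triangle inequalities of the four triples.
omit h0 h1 in
theorem admTriple_of_racah_ne_zero {a b c d e f : ℤ} (h₁ : (a + b + c) % 2 = 0)
    (h₂ : (a + e + f) % 2 = 0) (h₃ : (d + b + f) % 2 = 0)
    (h : racah A ((a + b + c) / 2) ((a + e + f) / 2) ((d + b + f) / 2) ((d + e + c) / 2)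
        ((a + b + d + e) / 2) ((a + c + d + f) / 2) ((b + c + e + f) / 2) ≠ 0) :
    AdmTriple a b c ∧ AdmTriple a e f ∧ AdmTriple d b f ∧ AdmTriple d e c := by
  have := mt (racah_eq_zero A) h
  have key : ∀ T₁ T₂ T₃ T₄ Q₁ Q₂ Q₃ : ℤ,
      ¬min Q₁ (min Q₂ Q₃) < max (max T₁ T₂) (max T₃ T₄) →
      (T₁ ≤ Q₁ ∧ T₂ ≤ Q₁ ∧ T₃ ≤ Q₁ ∧ T₄ ≤ Q₁) ∧ (T₁ ≤ Q₂ ∧ T₂ ≤ Q₂ ∧ T₃ ≤ Q₂ ∧ T₄ ≤ Q₂) ∧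
        T₁ ≤ Q₃ ∧ T₂ ≤ Q₃ ∧ T₃ ≤ Q₃ ∧ T₄ ≤ Q₃ := by
    intros
    omega
  obtain ⟨⟨a₁, a₂, a₃, a₄⟩, ⟨b₁, b₂, b₃, b₄⟩, c₁, c₂, c₃, c₄⟩ := key _ _ _ _ _ _ _ this
  clear this h key
  simp only [admTriple_iff]
  have p : (d + e + c) % 2 = 0 := by clear * - h₁ h₂ h₃; omega
  refine ⟨⟨?_, ?_, ?_, h₁⟩, ⟨?_, ?_, ?_, h₂⟩, ⟨?_, ?_, ?_, h₃⟩, ?_, ?_, ?_, p⟩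
  · clear * - a₄ h₁ h₂ h₃; omega
  · clear * - c₂ h₁ h₂ h₃; omega
  · clear * - b₃ h₁ h₂ h₃; omega
  · clear * - a₃ h₁ h₂ h₃; omega
  · clear * - c₁ h₁ h₂ h₃; omega
  · clear * - b₄ h₁ h₂ h₃; omega
  · clear * - a₂ h₁ h₂ h₃; omega
  · clear * - c₄ h₁ h₂ h₃; omega
  · clear * - b₁ h₁ h₂ h₃; omega
  · clear * - a₁ h₁ h₂ h₃; omega
  · clear * - c₃ h₁ h₂ h₃; omega
  · clear * - b₂ h₁ h₂ h₃; omega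

/-- The weight of a region of state `u`. -/
def wt (A : ℂ) (u : ℤ) : ℂ := (-1) ^ u * qInt A (u + 1)

omit h0 h1 in
theorem wt_eq (u : ℤ) : wt A u = Complex.I ^ (2 * u) * qInt A (u + 1) := by
  rw [wt, neg_one_zpow_eq]

theorem wt_ne_zero {u : ℤ} (hu : 0 ≤ u) : wt A u ≠ 0 :=
  mul_ne_zero (zpow_ne_zero _ (by norm_num)) (qInt_ne_zero h0 h1 (by omega))

end
/-- Two (doubled) states on the two sides of a strand of colour `1/2`. -/
def Adj (x x' : ℤ) : Prop := x' = x + 1 ∨ x' = x - 1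

theorem Adj.symm {x x' : ℤ} (h : Adj x x') : Adj x' x := by
  unfold Adj at *
  omega

/-! ### The Biedenharn-Elliott identity with one edge of colour 1/2 -/

section
variable {A : ℂ} (h0 : 0 < ‖A‖) (h1 : ‖A‖ < 1)
include h0 h1

/-- The sum over a state `f'` in the pentagon identity, before the outer triangles are
split off. -/
theorem pentagon_term {a b c d e f d' e' f' : ℤ} (hd : Adj d d') (he : Adj e e') (hf : Adj f f')
    (hf0 : 0 ≤ f) (p₁ : (a + b + c) % 2 = 0) (p₂ : (a + e + f) % 2 = 0)
    (p₃ : (d + b + f) % 2 = 0) :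
    wt A f' * tet A a b c d' e' f' * rho A b d f d' f' * rho A a e f e' f' * qInt A (f + 1) =
      tri A a b c * tri A a e f * tri A d b f * tri A d d' 1 * tri A e e' 1 * tri A d' e' c *
      (Complex.I ^ (a + b + d + e + 2 * d' + 2 * e' + c + d' + e' + 2 * f + 7 * f' + 2 * a + 2 * b
          + 2) * rhoVal A b d' f' d f * rhoVal A a e' f' e f *
        racah A ((a + b + c) / 2) ((a + e' + f') / 2) ((d' + b + f') / 2) ((d' + e' + c) / 2)
          ((a + b + d' + e') / 2) ((a + c + d' + f') / 2) ((b + c + e' + f') / 2)) := by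
  have t₁ : tri A d f b = tri A d b f := by rw [tri_comm A d b, tri_rotate A b d]
  have t₂ : tri A e f a = tri A a e f := (tri_rotate A a e f).symm
  have t₃ : tri A f' d' b = tri A d' f' b := tri_comm ..
  have t₄ : tri A f' e' a = tri A e' f' a := tri_comm ..
  have t₅ : tri A a e' f' = tri A e' f' a := tri_rotate ..
  have t₆ : tri A d' b f' = tri A d' f' b := by rw [tri_comm A d' b, tri_rotate A b d']
  rw [tet_eq h0 h1, rho_eq h0 h1, rho_eq h0 h1, t₁, t₂, t₃, t₄, t₅, t₆]
  set S := racah A ((a + b + c) / 2) ((a + e' + f') / 2) ((d' + b + f') / 2) ((d' + e' + c) / 2)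
          ((a + b + d' + e') / 2) ((a + c + d' + f') / 2) ((b + c + e' + f') / 2) with hS
  -- Both sides contain the factor `S`. If it is nonzero, the triples containing `f'` are
  -- admissible, so both `rho` can be evaluated. Each inner triangle with `f'` occurs twice, hence
  -- as a square, and `tri_sq_one` cancels the weight of `f'`, leaving `[f+1]`.
  by_cases hS0 : S = 0
  · rw [hS0]
    ring
  unfold Adj at hd he hf
  obtain ⟨-, g₁, g₂, -⟩ := admTriple_of_racah_ne_zero p₁ (by omega) (by omega) hS0
  have u₁ := tri_sq_mul_rhoRacah h0 h1 (c := b) (x := d') (y := f') (x' := d) (y' := f)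
    (admTriple_rotate.mp (admTriple_comm.mp g₂)) (by omega) (by omega)
  have u₂ := tri_sq_mul_rhoRacah h0 h1 (c := a) (x := e') (y := f') (x' := e) (y' := f)
    (admTriple_rotate.mp g₁) (by omega) (by omega)
  have u₃ := tri_sq_one h0 h1 (a := f') (b := f) g₁.2.2.1 hf0 (by omega)
  rw [rhoRacah_symm] at u₁ u₂
  rw [wt_eq]
  have key : Complex.I ^ (2 * f') * Complex.I ^ (a + b + c + d' + e' + f') *
      Complex.I ^ (d + d' + 1 + f' + f + b) * Complex.I ^ (e + e' + 1 + f' + f + a) *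
      Complex.I ^ (d' + f' + b) * Complex.I ^ (e' + f' + a) =
      Complex.I ^ (a + b + d + e + 2 * d' + 2 * e' + c + d' + e' + 2 * f + 7 * f' + 2 * a + 2 * b
          + 2) := by
    simp only [I_zpow_mul]
    congr 1
    ring
  rw [← key]
  linear_combination (exp := 1) Complex.I ^ (2 * f') * Complex.I ^ (a + b + c + d' + e' + f') *
      Complex.I ^ (d + d' + 1 + f' + f + b) * Complex.I ^ (e + e' + 1 + f' + f + a) *
      (tri A a b c * tri A a e f * tri A d b f * tri A d d' 1 * tri A e e' 1 * tri A d' e' c) * S *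
      ((tri A d' f' b ^ 2 * rhoRacah A b d f d' f') * (tri A e' f' a ^ 2 * rhoRacah A a e f e' f')
        * u₃ + (tri A e' f' a ^ 2 * rhoRacah A a e f e' f') * u₁ +
        Complex.I ^ (d' + f' + b) * rhoVal A b d' f' d f * u₂)

/-- The left side of the pentagon identity has the same six outer triangles as the terms in
`pentagon_term`, so they can be cancelled. -/
theorem pentagon_left {a b c d e f d' e' : ℤ} (hd : Adj d d') (he : Adj e e')
    (p₁ : (a + b + c) % 2 = 0) (p₂ : (a + e + f) % 2 = 0)
    (p₃ : (d + b + f) % 2 = 0) :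
    tet A a b c d e f * rho A c d e d' e' =
      tri A a b c * tri A a e f * tri A d b f * tri A d d' 1 * tri A e e' 1 * tri A d' e' c *
      (Complex.I ^ (a + b + 3 * c + 3 * d + 3 * e + f + d' + e' + 1) * rhoVal A c d e d' e' *
        racah A ((a + b + c) / 2) ((a + e + f) / 2) ((d + b + f) / 2) ((d + e + c) / 2)
          ((a + b + d + e) / 2) ((a + c + d + f) / 2) ((b + c + e + f) / 2)) := by
  have t₁ : tri A e' e 1 = tri A e e' 1 := tri_comm ..
  have t₂ : tri A e' d' c = tri A d' e' c := tri_comm ..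
  rw [tet_eq h0 h1, rho_eq h0 h1, t₁, t₂]
  set S := racah A ((a + b + c) / 2) ((a + e + f) / 2) ((d + b + f) / 2) ((d + e + c) / 2)
          ((a + b + d + e) / 2) ((a + c + d + f) / 2) ((b + c + e + f) / 2) with hS
  by_cases hS0 : S = 0
  · rw [hS0]
    ring
  obtain ⟨-, -, -, g⟩ := admTriple_of_racah_ne_zero p₁ p₂ p₃ hS0
  have u := tri_sq_mul_rhoRacah h0 h1 g hd he
  have key : Complex.I ^ (a + b + c + d + e + f) * Complex.I ^ (d + d' + 1 + e' + e + c) *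
      Complex.I ^ (d + e + c) =
      Complex.I ^ (a + b + 3 * c + 3 * d + 3 * e + f + d' + e' + 1) := by
    simp only [I_zpow_mul]
    congr 1
    ring
  rw [← key]
  linear_combination Complex.I ^ (a + b + c + d + e + f) *
    Complex.I ^ (d + d' + 1 + e' + e + c) *
    (tri A a b c * tri A a e f * tri A d b f * tri A d d' 1 * tri A e e' 1 * tri A d' e' c) * S * u

/-- The Biedenharn-Elliott identity with one edge of colour `1/2`. -/
theorem pentagon {a b c d e f d' e' : ℤ} (hd : Adj d d') (he : Adj e e') :
    tet A a b c d e f * rho A c d e d' e' =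
      wt A (f + 1) * tet A a b c d' e' (f + 1) * rho A b d f d' (f + 1) * rho A a e f e' (f + 1) +
      wt A (f - 1) * tet A a b c d' e' (f - 1) * rho A b d f d' (f - 1) *
        rho A a e f e' (f - 1) := by
  -- The symmetry that exchanges `a`, `d`, `d'` with `b`, `e`, `e'` removes one of the two cases of
  -- opposite signs.
  wlog hde : d' = d + 1 ∨ e' = e - 1 generalizing a b d e d' e'
  · have := this (a := b) (b := a) he hd (by unfold Adj at *; omega)
    rw [tet_swap h0 h1, rho_swap h0 h1, this, tet_swap h0 h1 b, tet_swap h0 h1 b]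
    ring
  -- These conditions do not involve `f'` and are necessary for any term on either side to be
  -- nonzero.
  by_cases hadm : AdmTriple a b c ∧ AdmTriple a e f ∧ AdmTriple d b f ∧ 0 ≤ d' ∧ 0 ≤ e'
  swap
  · have z : tet A a b c d e f * rho A c d e d' e' = 0 := by
      by_contra h
      rw [mul_eq_zero, not_or] at h
      have z₁ := not_imp_comm.mp tet_of_not h.1
      have z₂ := not_imp_comm.mp tet_of_not h.2
      exact hadm ⟨z₁.1, z₁.2.1, z₁.2.2.1, z₂.1.2.1, z₂.2.2.2.1⟩
    have z' : ∀ f', wt A f' * tet A a b c d' e' f' * rho A b d f d' f' * rho A a e f e' f' = 0 := by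
      intro f'
      by_contra h
      rw [mul_eq_zero, not_or, mul_eq_zero, not_or, mul_eq_zero, not_or] at h
      have z₁ := not_imp_comm.mp tet_of_not h.1.1.2
      have z₂ := not_imp_comm.mp tet_of_not h.1.2
      have z₃ := not_imp_comm.mp tet_of_not h.2
      exact hadm ⟨z₁.1, admTriple_rotate.mpr z₃.2.1,
        admTriple_comm.mpr (admTriple_rotate.mpr z₂.2.1), z₂.1.2.1, z₃.1.2.1⟩
    rw [z, z', z', add_zero]
  obtain ⟨g₁, g₂, g₃, hd0, he0⟩ := hadm
  rw [admTriple_iff] at g₁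
  have hf0 := g₂.2.2.1
  have hd0 := g₃.1
  rw [admTriple_iff] at g₂ g₃
  obtain ⟨T₁, hT₁⟩ : ∃ T, a + b + c = 2 * T := ⟨(a + b + c) / 2, by omega⟩
  obtain ⟨T₂, hT₂⟩ : ∃ T, a + e + f = 2 * T := ⟨(a + e + f) / 2, by omega⟩
  obtain ⟨T₃, hT₃⟩ : ∃ T, d + b + f = 2 * T := ⟨(d + b + f) / 2, by omega⟩
  obtain ⟨T₄, hT₄⟩ : ∃ T, d + e + c = 2 * T := ⟨(d + e + c) / 2, by omega⟩
  obtain ⟨Q₁, hQ₁⟩ : ∃ T, a + b + d + e = 2 * T := ⟨(a + b + d + e) / 2, by omega⟩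
  obtain ⟨Q₂, hQ₂⟩ : ∃ T, a + c + d + f = 2 * T := ⟨(a + c + d + f) / 2, by omega⟩
  obtain ⟨Q₃, hQ₃⟩ : ∃ T, b + c + e + f = 2 * T := ⟨(b + c + e + f) / 2, by omega⟩
  have hs : Q₁ + Q₂ + Q₃ = T₁ + T₂ + T₃ + T₄ := by omega
  refine mul_right_cancel₀ (qInt_ne_zero h0 h1 (by omega : f + 1 ≠ 0)) ?_
  rw [add_mul, pentagon_term h0 h1 hd he (Or.inl rfl) hf0 g₁.2.2.2 g₂.2.2.2 g₃.2.2.2,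
    pentagon_term h0 h1 hd he (Or.inr rfl) hf0 g₁.2.2.2 g₂.2.2.2 g₃.2.2.2,
    pentagon_left h0 h1 hd he g₁.2.2.2 g₂.2.2.2 g₃.2.2.2, ← mul_add, mul_assoc]
  congr 1
  -- Each sign pattern is one contiguous relation: the values of `rho` are its coefficients, and the
  -- shifts of `d`, `e`, `f` are its shifts of parameters. The powers of `i` for `f + 1` and `f - 1`
  -- differ by a sign.
  rcases hd with rfl | rfl <;> rcases he with rfl | rfl
  · have rel := racah_contiguous_up_up h0 h1 hs (by omega)
    rw [show Q₂ + Q₃ - T₁ - T₄ + 1 = f + 1 by omega] at rel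
    have v₀ : rhoVal A c d e (d + 1) (e + 1) = -qInt A (T₄ + 2) := by
      rw [rhoVal, if_pos (by omega), if_pos (by omega)]
      congr 2
      omega
    have v₁ : rhoVal A b (d + 1) (f + 1) d f = qInt A (Q₂ - T₁ + 1) := by
      rw [rhoVal, if_neg (by omega), if_neg (by omega)]
      congr 1
      omega
    have v₂ : rhoVal A a (e + 1) (f + 1) e f = qInt A (Q₃ - T₁ + 1) := by
      rw [rhoVal, if_neg (by omega), if_neg (by omega)]
      congr 1
      omega
    have v₃ : rhoVal A b (d + 1) (f - 1) d f = qInt A (Q₁ + 1 - T₂) := by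
      rw [rhoVal, if_neg (by omega), if_pos (by omega)]
      congr 1
      omega
    have v₄ : rhoVal A a (e + 1) (f - 1) e f = qInt A (Q₁ + 1 - T₃) := by
      rw [rhoVal, if_neg (by omega), if_pos (by omega)]
      congr 1
      omega
    have r₀ : racah A ((a + b + c) / 2) ((a + e + f) / 2) ((d + b + f) / 2) ((d + e + c) / 2)
        ((a + b + d + e) / 2) ((a + c + d + f) / 2) ((b + c + e + f) / 2) =
        racah A T₁ T₂ T₃ T₄ Q₁ Q₂ Q₃ := by
      congr 1 <;> omega
    have r₁ : racah A ((a + b + c) / 2) ((a + (e + 1) + (f + 1)) / 2) (((d + 1) + b + (f + 1)) / 2) (((d + 1) + (e + 1) + c) / 2)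
        ((a + b + (d + 1) + (e + 1)) / 2) ((a + c + (d + 1) + (f + 1)) / 2) ((b + c + (e + 1) + (f + 1)) / 2) =
        racah A T₁ (T₂ + 1) (T₃ + 1) (T₄ + 1) (Q₁ + 1) (Q₂ + 1) (Q₃ + 1) := by
      congr 1 <;> omega
    have r₂ : racah A ((a + b + c) / 2) ((a + (e + 1) + (f - 1)) / 2) (((d + 1) + b + (f - 1)) / 2) (((d + 1) + (e + 1) + c) / 2)
        ((a + b + (d + 1) + (e + 1)) / 2) ((a + c + (d + 1) + (f - 1)) / 2) ((b + c + (e + 1) + (f - 1)) / 2) =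
        racah A T₁ T₂ T₃ (T₄ + 1) (Q₁ + 1) Q₂ Q₃ := by
      congr 1 <;> omega
    have i1 : Complex.I ^ (a + b + d + e + 2 * (d + 1) + 2 * (e + 1) + c + (d + 1) + (e + 1) + 2 * f + 7 * (f + 1) + 2 * a + 2 * b + 2) =
        Complex.I ^ (a + b + 3 * c + 3 * d + 3 * e + f + (d + 1) + (e + 1) + 1) :=
      I_zpow_congr (by omega)
    have i2 : Complex.I ^ (a + b + d + e + 2 * (d + 1) + 2 * (e + 1) + c + (d + 1) + (e + 1) + 2 * f + 7 * (f - 1) + 2 * a + 2 * b + 2) =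
        -Complex.I ^ (a + b + 3 * c + 3 * d + 3 * e + f + (d + 1) + (e + 1) + 1) :=
      I_zpow_eq_neg (by omega)
    rw [v₀, v₁, v₂, v₃, v₄, r₀, r₁, r₂, i1, i2]
    linear_combination -Complex.I ^ (a + b + 3 * c + 3 * d + 3 * e + f + (d + 1) + (e + 1) + 1) * rel
  · have rel := racah_contiguous_up_down h0 h1 hs (by omega)
    rw [show Q₂ + Q₃ + 1 - T₁ - T₄ = f + 1 by omega] at rel
    have v₀ : rhoVal A c d e (d + 1) (e - 1) = qInt A (Q₃ - T₃) := by
      rw [rhoVal, if_pos (by omega), if_neg (by omega)]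
      congr 1
      omega
    have v₁ : rhoVal A b (d + 1) (f + 1) d f = qInt A (Q₂ + 1 - T₁) := by
      rw [rhoVal, if_neg (by omega), if_neg (by omega)]
      congr 1
      omega
    have v₂ : rhoVal A a (e - 1) (f + 1) e f = qInt A (Q₂ + 1 - T₄) := by
      rw [rhoVal, if_pos (by omega), if_neg (by omega)]
      congr 1
      omega
    have v₃ : rhoVal A b (d + 1) (f - 1) d f = qInt A (Q₁ - T₂ + 1) := by
      rw [rhoVal, if_neg (by omega), if_pos (by omega)]
      congr 1
      omega
    have v₄ : rhoVal A a (e - 1) (f - 1) e f = -qInt A (T₂ + 1) := by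
      rw [rhoVal, if_pos (by omega), if_pos (by omega)]
      congr 2
      omega
    have r₀ : racah A ((a + b + c) / 2) ((a + e + f) / 2) ((d + b + f) / 2) ((d + e + c) / 2)
        ((a + b + d + e) / 2) ((a + c + d + f) / 2) ((b + c + e + f) / 2) =
        racah A T₁ T₂ T₃ T₄ Q₁ Q₂ Q₃ := by
      congr 1 <;> omega
    have r₁ : racah A ((a + b + c) / 2) ((a + (e - 1) + (f + 1)) / 2) (((d + 1) + b + (f + 1)) / 2) (((d + 1) + (e - 1) + c) / 2)
        ((a + b + (d + 1) + (e - 1)) / 2) ((a + c + (d + 1) + (f + 1)) / 2) ((b + c + (e - 1) + (f + 1)) / 2) =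
        racah A T₁ T₂ (T₃ + 1) T₄ Q₁ (Q₂ + 1) Q₃ := by
      congr 1 <;> omega
    have r₂ : racah A ((a + b + c) / 2) ((a + (e - 1) + (f - 1)) / 2) (((d + 1) + b + (f - 1)) / 2) (((d + 1) + (e - 1) + c) / 2)
        ((a + b + (d + 1) + (e - 1)) / 2) ((a + c + (d + 1) + (f - 1)) / 2) ((b + c + (e - 1) + (f - 1)) / 2) =
        racah A T₁ (T₂ - 1) T₃ T₄ Q₁ Q₂ (Q₃ - 1) := by
      congr 1 <;> omega
    have i1 : Complex.I ^ (a + b + d + e + 2 * (d + 1) + 2 * (e - 1) + c + (d + 1) + (e - 1) + 2 * f + 7 * (f + 1) + 2 * a + 2 * b + 2) =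
        Complex.I ^ (a + b + 3 * c + 3 * d + 3 * e + f + (d + 1) + (e - 1) + 1) :=
      I_zpow_congr (by omega)
    have i2 : Complex.I ^ (a + b + d + e + 2 * (d + 1) + 2 * (e - 1) + c + (d + 1) + (e - 1) + 2 * f + 7 * (f - 1) + 2 * a + 2 * b + 2) =
        -Complex.I ^ (a + b + 3 * c + 3 * d + 3 * e + f + (d + 1) + (e - 1) + 1) :=
      I_zpow_eq_neg (by omega)
    rw [v₀, v₁, v₂, v₃, v₄, r₀, r₁, r₂, i1, i2]
    linear_combination -Complex.I ^ (a + b + 3 * c + 3 * d + 3 * e + f + (d + 1) + (e - 1) + 1) * rel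
  · omega
  · have rel := racah_contiguous_down_down h0 h1 hs (by omega)
    rw [show T₂ + T₃ + 1 - Q₁ = f + 1 by omega] at rel
    have v₀ : rhoVal A c d e (d - 1) (e - 1) = qInt A (Q₁ - T₁) := by
      rw [rhoVal, if_neg (by omega), if_neg (by omega)]
      congr 1
      omega
    have v₁ : rhoVal A b (d - 1) (f + 1) d f = qInt A (Q₃ - T₄ + 1) := by
      rw [rhoVal, if_pos (by omega), if_neg (by omega)]
      congr 1
      omega
    have v₂ : rhoVal A a (e - 1) (f + 1) e f = qInt A (Q₂ - T₄ + 1) := by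
      rw [rhoVal, if_pos (by omega), if_neg (by omega)]
      congr 1
      omega
    have v₃ : rhoVal A b (d - 1) (f - 1) d f = -qInt A (T₃ + 1) := by
      rw [rhoVal, if_pos (by omega), if_pos (by omega)]
      congr 2
      omega
    have v₄ : rhoVal A a (e - 1) (f - 1) e f = -qInt A (T₂ + 1) := by
      rw [rhoVal, if_pos (by omega), if_pos (by omega)]
      congr 2
      omega
    have r₀ : racah A ((a + b + c) / 2) ((a + e + f) / 2) ((d + b + f) / 2) ((d + e + c) / 2)
        ((a + b + d + e) / 2) ((a + c + d + f) / 2) ((b + c + e + f) / 2) =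
        racah A T₁ T₂ T₃ T₄ Q₁ Q₂ Q₃ := by
      congr 1 <;> omega
    have r₁ : racah A ((a + b + c) / 2) ((a + (e - 1) + (f + 1)) / 2) (((d - 1) + b + (f + 1)) / 2) (((d - 1) + (e - 1) + c) / 2)
        ((a + b + (d - 1) + (e - 1)) / 2) ((a + c + (d - 1) + (f + 1)) / 2) ((b + c + (e - 1) + (f + 1)) / 2) =
        racah A T₁ T₂ T₃ (T₄ - 1) (Q₁ - 1) Q₂ Q₃ := by
      congr 1 <;> omega
    have r₂ : racah A ((a + b + c) / 2) ((a + (e - 1) + (f - 1)) / 2) (((d - 1) + b + (f - 1)) / 2) (((d - 1) + (e - 1) + c) / 2)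
        ((a + b + (d - 1) + (e - 1)) / 2) ((a + c + (d - 1) + (f - 1)) / 2) ((b + c + (e - 1) + (f - 1)) / 2) =
        racah A T₁ (T₂ - 1) (T₃ - 1) (T₄ - 1) (Q₁ - 1) (Q₂ - 1) (Q₃ - 1) := by
      congr 1 <;> omega
    have i1 : Complex.I ^ (a + b + d + e + 2 * (d - 1) + 2 * (e - 1) + c + (d - 1) + (e - 1) + 2 * f + 7 * (f + 1) + 2 * a + 2 * b + 2) =
        Complex.I ^ (a + b + 3 * c + 3 * d + 3 * e + f + (d - 1) + (e - 1) + 1) :=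
      I_zpow_congr (by omega)
    have i2 : Complex.I ^ (a + b + d + e + 2 * (d - 1) + 2 * (e - 1) + c + (d - 1) + (e - 1) + 2 * f + 7 * (f - 1) + 2 * a + 2 * b + 2) =
        -Complex.I ^ (a + b + 3 * c + 3 * d + 3 * e + f + (d - 1) + (e - 1) + 1) :=
      I_zpow_eq_neg (by omega)
    rw [v₀, v₁, v₂, v₃, v₄, r₀, r₁, r₂, i1, i2]
    linear_combination Complex.I ^ (a + b + 3 * c + 3 * d + 3 * e + f + (d - 1) + (e - 1) + 1) * rel

end

/-! ### Orthogonality of the crossing symbols -/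

section

variable {A : ℂ} (h0 : 0 < ‖A‖) (h1 : ‖A‖ < 1)
include h0 h1

theorem rho_mul_rho_term {c x y z x' y' : ℤ} (hx : Adj x x') (hz : Adj z x') (hy : Adj y y')
    (hy0 : 0 ≤ y) (p : (x + y + c) % 2 = 0) :
    wt A y' * rho A c x y x' y' * rho A c z y x' y' * qInt A (y + 1) =
      tri A x x' 1 * tri A x y c * (tri A z x' 1 * tri A z y c) *
      (Complex.I ^ (x + z + 2 * y + 3 * x' + 5 * y' + 3 * c + 2) * rhoVal A c x' y' x y *
        rhoRacah A c z y x' y') := by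
  have t₁ : tri A y' x' c = tri A x' y' c := tri_comm ..
  rw [rho_eq h0 h1, rho_eq h0 h1, t₁]
  by_cases hS0 : rhoRacah A c z y x' y' = 0
  · rw [hS0]
    ring
  unfold Adj at hx hz hy
  obtain ⟨-, -, g, -⟩ := admTriple_of_racah_ne_zero (A := A) (a := z) (b := x') (c := 1) (d := y')
    (e := y) (f := c) (by omega) (by omega) (by omega) hS0
  have u := tri_sq_mul_rhoRacah h0 h1 (x' := x) (y' := y) (admTriple_comm.mp g) (by omega)
    (by omega)
  have u' := tri_sq_one h0 h1 (a := y') (b := y) g.1 hy0 (by omega)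
  rw [rhoRacah_symm] at u
  rw [wt_eq]
  have key : Complex.I ^ (2 * y') * Complex.I ^ (x + x' + 1 + y' + y + c) *
      Complex.I ^ (z + x' + 1 + y' + y + c) * Complex.I ^ (x' + y' + c) =
      Complex.I ^ (x + z + 2 * y + 3 * x' + 5 * y' + 3 * c + 2) := by
    simp only [I_zpow_mul]
    congr 1
    ring
  rw [← key]
  linear_combination Complex.I ^ (2 * y') * Complex.I ^ (x + x' + 1 + y' + y + c) *
      Complex.I ^ (z + x' + 1 + y' + y + c) * (tri A x x' 1 * tri A x y c *
      (tri A z x' 1 * tri A z y c)) * rhoRacah A c z y x' y' *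
      (u + tri A x' y' c ^ 2 * rhoRacah A c x y x' y' * u')

/-- After clearing `[y+1]` and one triangle, the two terms have equal products of values of `rho`
and opposite powers of `i`. -/
theorem rho_orthogonal_of_ne {c x y z x' : ℤ} (hx : Adj x x') (hz : Adj z x') (hxz : x ≠ z) :
    wt A (y + 1) * rho A c x y x' (y + 1) * rho A c z y x' (y + 1) +
      wt A (y - 1) * rho A c x y x' (y - 1) * rho A c z y x' (y - 1) = 0 := by
  by_cases h : AdmTriple x y c ∧ AdmTriple z y c
  swap
  · have : ∀ y', rho A c x y x' y' * rho A c z y x' y' = 0 := by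
      intro y'
      by_contra hne
      rw [mul_eq_zero, not_or] at hne
      exact h ⟨(not_imp_comm.mp tet_of_not hne.1).2.1, (not_imp_comm.mp tet_of_not hne.2).2.1⟩
    rw [mul_assoc, this, mul_assoc, this]
    ring
  obtain ⟨g₁, g₂⟩ := h
  have hy0 := g₁.2.1
  refine mul_right_cancel₀ (qInt_ne_zero h0 h1 (by omega : y + 1 ≠ 0)) ?_
  refine mul_right_cancel₀ (tri_ne_zero h0 h1 g₂) ?_
  have g₁' := g₁
  have g₂' := g₂
  rw [admTriple_iff] at g₁' g₂'
  rw [add_mul, rho_mul_rho_term h0 h1 hx hz (Or.inl rfl) hy0 g₁'.2.2.2,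
    rho_mul_rho_term h0 h1 hx hz (Or.inr rfl) hy0 g₁'.2.2.2, zero_mul, zero_mul]
  have u₁ := tri_sq_mul_rhoRacah h0 h1 g₂ hz (Or.inl rfl)
  have u₂ := tri_sq_mul_rhoRacah h0 h1 g₂ hz (Or.inr rfl)
  have e : Complex.I ^ (x + z + 2 * y + 3 * x' + 5 * (y + 1) + 3 * c + 2) =
    -Complex.I ^ (x + z + 2 * y + 3 * x' + 5 * (y - 1) + 3 * c + 2) := I_zpow_eq_neg (by omega)
  have v : rhoVal A c x' (y + 1) x y * rhoVal A c z y x' (y + 1) =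
      rhoVal A c x' (y - 1) x y * rhoVal A c z y x' (y - 1) := by
    unfold Adj at hx hz
    obtain ⟨τ, hτ⟩ : ∃ T, z + y + c = 2 * T := ⟨(z + y + c) / 2, by omega⟩
    unfold rhoVal
    rcases hz with h | h
    · rw [if_pos (by omega : x = x' + 1), if_neg (by omega : ¬y = y + 1 + 1),
        if_pos h, if_pos rfl, if_pos (by omega : x = x' + 1), if_pos (by omega : y = y - 1 + 1),
        if_pos h, if_neg (by omega), show (x' + (y + 1) + c) / 2 - x' = τ - z by omega,
        show (z + y + c) / 2 = τ by omega, show (x' + (y - 1) + c) / 2 = τ by omega]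
      ring
    · rw [if_neg (by omega : ¬x = x' + 1), if_neg (by omega : ¬y = y + 1 + 1),
        if_neg (by omega : ¬x' = z + 1), if_pos rfl, if_neg (by omega : ¬x = x' + 1),
        if_pos (by omega : y = y - 1 + 1),
        if_neg (by omega : ¬x' = z + 1), if_neg (by omega), show (x' + (y + 1) + c) / 2 = τ by omega,
        show (z + y + c) / 2 = τ by omega, show (x' + (y - 1) + c) / 2 - (y - 1) = τ - y by omega]
      ring
  rw [e]
  linear_combination tri A x x' 1 * tri A x y c * tri A z x' 1 *
    Complex.I ^ (x + z + 2 * y + 3 * x' + 5 * (y - 1) + 3 * c + 2) *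
    (rhoVal A c x' (y - 1) x y * u₂ - rhoVal A c x' (y + 1) x y * u₁ -
      Complex.I ^ (z + y + c) * v)

/-- With the triangles squared away, the identity becomes a single instance of the addition formula
for quantum integers, isolated as `v`. -/
theorem rho_orthogonal_self {c x y x' : ℤ} (hx : Adj x x') (hx' : 0 ≤ x') (g : AdmTriple x y c) :
    wt A x * (wt A (y + 1) * rho A c x y x' (y + 1) * rho A c x y x' (y + 1) +
      wt A (y - 1) * rho A c x y x' (y - 1) * rho A c x y x' (y - 1)) = 1 := by
  have hx0 := g.1
  have hy0 := g.2.1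
  refine mul_right_cancel₀ (qInt_ne_zero h0 h1 (by omega : y + 1 ≠ 0)) ?_
  refine mul_right_cancel₀ (qInt_ne_zero h0 h1 (by omega : x' + 1 ≠ 0)) ?_
  have g' := g
  rw [admTriple_iff] at g'
  rw [mul_assoc (wt A x), add_mul, rho_mul_rho_term h0 h1 hx hx (Or.inl rfl) hy0 g'.2.2.2,
    rho_mul_rho_term h0 h1 hx hx (Or.inr rfl) hy0 g'.2.2.2]
  have u₁ := tri_sq_mul_rhoRacah h0 h1 g hx (Or.inl rfl)
  have u₂ := tri_sq_mul_rhoRacah h0 h1 g hx (Or.inr rfl)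
  have u₃ := tri_sq_one h0 h1 hx0 hx' hx
  have e₁ : Complex.I ^ (2 * x) *
      Complex.I ^ (x + x + 2 * y + 3 * x' + 5 * (y + 1) + 3 * c + 2) * Complex.I ^ (x + y + c) =
      -Complex.I ^ (5 * x + 3 * x' + 1) := by
    simp only [I_zpow_mul]
    exact I_zpow_eq_neg (by omega)
  have e₂ : Complex.I ^ (2 * x) *
      Complex.I ^ (x + x + 2 * y + 3 * x' + 5 * (y - 1) + 3 * c + 2) * Complex.I ^ (x + y + c) =
      Complex.I ^ (5 * x + 3 * x' + 1) := by
    simp only [I_zpow_mul]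
    exact I_zpow_congr (by omega)
  have v : Complex.I ^ (5 * x + 3 * x' + 1) *
      (rhoVal A c x' (y - 1) x y * rhoVal A c x y x' (y - 1) -
        rhoVal A c x' (y + 1) x y * rhoVal A c x y x' (y + 1)) =
      qInt A (x' + 1) * qInt A (y + 1) := by
    unfold Adj at hx
    obtain ⟨t, ht⟩ : ∃ T, x + y + c = 2 * T := ⟨(x + y + c) / 2, by omega⟩
    unfold rhoVal
    rw [show (x + y + c) / 2 = t by omega]
    rcases hx with rfl | rfl
    · rw [if_neg (by omega : ¬x = x + 1 + 1), if_pos (by omega : y = y - 1 + 1), if_pos rfl,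
        if_neg (by omega : ¬y - 1 = y + 1), if_neg (by omega : ¬x = x + 1 + 1),
        if_neg (by omega : ¬y = y + 1 + 1), if_pos rfl, if_pos rfl,
        show (x + 1 + (y - 1) + c) / 2 - (y - 1) = t - y + 1 by omega,
        show (x + 1 + (y + 1) + c) / 2 - c = t + 1 - c by omega,
        I_zpow_congr (by omega : (5 * x + 3 * (x + 1) + 1 - 0) % 4 = 0), zpow_zero]
      have := qInt_mul_sub_mul h0 (x := x + 2) (y := y + 1) (z := t + 2) (t := t + 1 - c)
        (-(t - x)) (t - y + 1) (by omega) (by omega) (by omega)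
      rw [qInt_neg] at this
      rw [show x + 1 + 1 = x + 2 by ring]
      linear_combination -this
    · rw [if_pos (by omega : x = x - 1 + 1), if_pos (by omega : y = y - 1 + 1),
        if_neg (by omega : ¬x - 1 = x + 1), if_neg (by omega : ¬y - 1 = y + 1),
        if_pos (by omega : x = x - 1 + 1), if_neg (by omega : ¬y = y + 1 + 1),
        if_neg (by omega : ¬x - 1 = x + 1), if_pos rfl,
        show (x - 1 + (y - 1) + c) / 2 + 2 = t + 1 by omega,
        show (x - 1 + (y + 1) + c) / 2 - (x - 1) = t - x + 1 by omega,
        I_zpow_eq_neg (by omega : (5 * x + 3 * (x - 1) + 1 - 0) % 4 = 2), zpow_zero]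
      have := qInt_mul_sub_mul h0 (x := x) (y := y + 1) (z := t + 1) (t := t - c)
        (-(t - x + 1)) (t - y) (by omega) (by omega) (by omega)
      rw [qInt_neg] at this
      rw [show x - 1 + 1 = x by ring]
      linear_combination -this
  rw [wt_eq]
  linear_combination (exp := 1) Complex.I ^ (2 * x) * qInt A (x + 1) *
    tri A x x' 1 ^ 2 * qInt A (x' + 1) *
    (Complex.I ^ (x + x + 2 * y + 3 * x' + 5 * (y + 1) + 3 * c + 2) * rhoVal A c x' (y + 1) x y * u₁
    + Complex.I ^ (x + x + 2 * y + 3 * x' + 5 * (y - 1) + 3 * c + 2) *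
      rhoVal A c x' (y - 1) x y * u₂) + qInt A (x + 1) * tri A x x' 1 ^ 2 * qInt A (x' + 1) * (
      rhoVal A c x' (y + 1) x y * rhoVal A c x y x' (y + 1) * e₁ +
      rhoVal A c x' (y - 1) x y * rhoVal A c x y x' (y - 1) * e₂ + v) +
      qInt A (x' + 1) * qInt A (y + 1) * u₃

/-! ### The degenerate tetrahedron -/

/-- A square root of the weight of a region. -/
def sqrtWt (A : ℂ) (u : ℤ) : ℂ := Complex.I ^ (-u) * sqrtQInt A (u + 1).toNat

/-- The value `u = -1`, where both sides vanish, is needed for an edge of colour 0 that is perturbed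
downwards. -/
theorem sqrtWt_sq {u : ℤ} (hu : -1 ≤ u) : sqrtWt A u ^ 2 = wt A u := by
  rw [sqrtWt, mul_pow, sqrtQInt_sq A h0 h1, wt_eq, sq, I_zpow_mul,
    show (((u + 1).toNat : ℕ) : ℤ) = u + 1 by omega]
  rw [I_zpow_congr (by omega : (-u + -u - 2 * u) % 4 = 0)]

theorem tri_zero_mul_sqrtQInt {a : ℤ} (ha : 0 ≤ a) :
    tri A a a 0 * sqrtQInt A (a + 1).toNat = 1 := by
  obtain ⟨n, rfl⟩ := Int.eq_ofNat_of_zero_le ha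
  have hadm : AdmTriple (n : ℤ) n 0 := by
    rw [admTriple_iff]
    omega
  rw [tri, if_pos hadm, bigDelta, show (((n : ℤ) + n - 0) / 2).toNat = n by omega,
    show (((n : ℤ) + 0 - n) / 2).toNat = 0 by omega,
    show ((0 + (n : ℤ) - n) / 2).toNat = 0 by omega,
    show (((n : ℤ) + n + 0) / 2 + 1).toNat = n + 1 by omega,
    show ((n : ℤ) + 1).toNat = n + 1 by omega]
  have h := sqrtQFact_ne_zero h0 h1 n
  have h' := sqrtQFact_ne_zero h0 h1 (n + 1)
  have e : sqrtQFact A (n + 1) = sqrtQFact A n * sqrtQInt A (n + 1) := Finset.prod_range_succ ..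
  have e0 : sqrtQFact A 0 = 1 := Finset.prod_range_zero _
  rw [div_mul_eq_mul_div, div_eq_one_iff_eq h', e, e0]
  ring

/-- An edge of colour 0 leaves one Racah term, which cancels `Δ(a,b,c)²`; the two triangles with
colour 0 are inverse square roots of `[a+1]` and `[b+1]`. This evaluates the denominator of `𝕍`. -/
theorem tet_zero_mul {a b c : ℤ} (h : AdmTriple a b c) :
    tet A a b c b a 0 * (sqrtWt A a * sqrtWt A b) = 1 := by
  have ha := tri_zero_mul_sqrtQInt h0 h1 h.1
  have hb := tri_zero_mul_sqrtQInt h0 h1 h.2.1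
  have h' := h
  rw [admTriple_iff] at h'
  obtain ⟨t, ht⟩ : ∃ t, a + b + c = 2 * t := ⟨(a + b + c) / 2, by omega⟩
  have u := tri_sq h0 h1 h ht
  have z₁ := qF_mul_invF h0 h1 (by omega : 0 ≤ t - a)
  have z₂ := qF_mul_invF h0 h1 (by omega : 0 ≤ t - b)
  have z₃ := qF_mul_invF h0 h1 (by omega : 0 ≤ t - c)
  have z₄ := qF_mul_invF h0 h1 (by omega : 0 ≤ t + 1)
  have s : tri A a b c ^ 2 * racah A t a b t (a + b) t t = (-1) ^ t := by
    rw [racah_eq_term A t (by omega) (by omega) (by omega), racahTerm, u, sub_self, invF_zero,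
      show a + b - t = t - c by omega]
    linear_combination (-1) ^ t * ((qF A (t - a) * invF A (t - a) *
      (qF A (t - b) * invF A (t - b)) * (qF A (t - c) * invF A (t - c))) * z₄ +
      (qF A (t - a) * invF A (t - a) * (qF A (t - b) * invF A (t - b))) * z₃ +
      (qF A (t - a) * invF A (t - a)) * z₂ + z₁)
  rw [neg_one_zpow_eq] at s
  rw [tet_eq h0 h1, tri_comm A b a c, sqrtWt, sqrtWt, show (a + b + c) / 2 = t by omega,
    show (a + a + 0) / 2 = a by omega, show (b + b + 0) / 2 = b by omega,
    show (b + a + c) / 2 = t by omega, show (a + b + b + a) / 2 = a + b by omega,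
    show (a + c + b + 0) / 2 = t by omega, show (b + c + a + 0) / 2 = t by omega]
  have e : Complex.I ^ (a + b + c + b + a + 0) * Complex.I ^ (-a) * Complex.I ^ (-b) *
      Complex.I ^ (2 * t) = 1 := by
    simp only [I_zpow_mul]
    rw [I_zpow_congr (by omega : (a + b + c + b + a + 0 + -a + -b + 2 * t - 0) % 4 = 0), zpow_zero]
  linear_combination (exp := 1) Complex.I ^ (a + b + c + b + a + 0) * Complex.I ^ (-a) *
    Complex.I ^ (-b) * (tri A a a 0 * sqrtQInt A (a + 1).toNat) *
    (tri A b b 0 * sqrtQInt A (b + 1).toNat) * s +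
    (tri A a a 0 * sqrtQInt A (a + 1).toNat) * (tri A b b 0 * sqrtQInt A (b + 1).toNat) * e +
    (tri A a a 0 * sqrtQInt A (a + 1).toNat) * hb + ha

end
/-! ### Sums over the two neighbours of a state -/

/-- The sum over the two states that differ from `y` by `1/2`. -/
def adjSum (y : ℤ) (f : ℤ → ℂ) : ℂ := f (y + 1) + f (y - 1)

theorem adjSum_congr {y : ℤ} {f g : ℤ → ℂ} (h : ∀ y', Adj y y' → f y' = g y') :
    adjSum y f = adjSum y g := by
  rw [adjSum, adjSum, h _ (Or.inl rfl), h _ (Or.inr rfl)]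

theorem mul_adjSum (y : ℤ) (k : ℂ) (f : ℤ → ℂ) : k * adjSum y f = adjSum y fun z => k * f z := by
  unfold adjSum
  ring

theorem adjSum_mul (y : ℤ) (k : ℂ) (f : ℤ → ℂ) : adjSum y f * k = adjSum y fun z => f z * k := by
  unfold adjSum
  ring

theorem adjSum_comm (x y : ℤ) (f : ℤ → ℤ → ℂ) :
    (adjSum x fun z => adjSum y fun w => f z w) = adjSum y fun w => adjSum x fun z => f z w := by
  unfold adjSum
  ring

theorem adjSum_ite {x y : ℤ} (h : Adj x y) (f : ℤ → ℂ) :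
    (adjSum x fun z => if y = z then f z else 0) = f y := by
  simp only [adjSum]
  rcases h with rfl | rfl
  · rw [if_pos rfl, if_neg (by omega), add_zero]
  · rw [if_neg (by omega), if_pos rfl, zero_add]

open Classical in
theorem adjSum_eq_sum {N y : ℤ} (h0 : 0 ≤ y) (hN : y < N) (f : ℤ → ℂ) :
    adjSum y f = ∑ z ∈ Finset.Icc (-1) N, if Adj y z then f z else 0 := by
  rw [← Finset.sum_filter, show (Finset.Icc (-1) N).filter (Adj y) = {y + 1, y - 1} by
    ext z
    simp only [Finset.mem_filter, Finset.mem_Icc, Adj, Finset.mem_insert, Finset.mem_singleton]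
    omega, Finset.sum_pair (by omega)]
  rfl

/-- Exchange of the sums over two adjacent states. -/
theorem sum_adjSum_comm {M M' : ℤ} {g : ℤ → ℤ → ℂ}
    (hg : ∀ m m', Adj m m' → g m m' ≠ 0 → (0 ≤ m ∧ m ≤ M) ∧ 0 ≤ m' ∧ m' ≤ M') :
    (∑ m ∈ Finset.Icc 0 M, adjSum m fun m' => g m m') =
      ∑ m' ∈ Finset.Icc 0 M', adjSum m' fun m => g m m' := by
  classical
  -- Both sides are compared with a double sum over one square. It starts at `-1` and ends beyond
  -- `M` and `M'` so that it contains both neighbours of every state in question.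
  obtain ⟨N, hN, hN'⟩ : ∃ N, M < N ∧ M' < N := ⟨max M M' + 1, by omega, by omega⟩
  have l : ∀ m ∈ Finset.Icc 0 M, (adjSum m fun m' => g m m') =
      ∑ m' ∈ Finset.Icc (-1) N, if Adj m m' then g m m' else 0 := by
    intro m hm
    rw [Finset.mem_Icc] at hm
    exact adjSum_eq_sum (by omega) (by omega) _
  have r : ∀ m' ∈ Finset.Icc 0 M', (adjSum m' fun m => g m m') =
      ∑ m ∈ Finset.Icc (-1) N, if Adj m' m then g m m' else 0 := by
    intro m hm
    rw [Finset.mem_Icc] at hm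
    exact adjSum_eq_sum (by omega) (by omega) _
  rw [Finset.sum_congr rfl l, Finset.sum_congr rfl r]
  have z : ∀ m m', (if Adj m m' then g m m' else 0) ≠ 0 → (0 ≤ m ∧ m ≤ M) ∧ 0 ≤ m' ∧ m' ≤ M' := by
    intro m m' h
    by_cases ha : Adj m m'
    · rw [if_pos ha] at h
      exact hg m m' ha h
    · rw [if_neg ha] at h
      exact absurd rfl h
  trans ∑ m ∈ Finset.Icc (-1) N, ∑ m' ∈ Finset.Icc (-1) N, if Adj m m' then g m m' else 0
  · refine Finset.sum_subset (Finset.Icc_subset_Icc (by omega) (by omega)) fun m _ hm => ?_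
    refine Finset.sum_eq_zero fun m' _ => by_contra fun h => hm ?_
    exact Finset.mem_Icc.mpr (z m m' h).1
  · rw [Finset.sum_comm]
    symm
    refine Eq.trans (Finset.sum_congr rfl fun m' _ => Finset.sum_congr rfl fun m _ =>
      if_congr (Q := Adj m m') ⟨Adj.symm, Adj.symm⟩ rfl rfl) ?_
    refine Finset.sum_subset (Finset.Icc_subset_Icc (by omega) (by omega)) fun m' _ hm => ?_
    refine Finset.sum_eq_zero fun m _ => by_contra fun h => hm ?_
    exact Finset.mem_Icc.mpr (z m m' h).2

/-! ### Pentagon and orthogonality as sums over neighbours -/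

/-- The weight of a vertex with edges `c`, `c₁`, `c₂` in counterclockwise order, where `x` is the
state between `c` and `c₁`, `m` the state between `c₁` and `c₂`, and `y` the state between `c₂`
and `c`. -/
def vtx (A : ℂ) (c c₁ c₂ x m y : ℤ) : ℂ := tet A c c₁ c₂ m y x

section
variable {A : ℂ} (h0 : 0 < ‖A‖) (h1 : ‖A‖ < 1)
include h0 h1

/-- The pentagon identity as a move: a strand of colour 1/2 that crosses `c₁` and `c₂` is pulled
over the vertex and crosses `c` instead. -/
theorem adjSum_vtx (c c₁ c₂ m : ℤ) {x y x' y' : ℤ} (hx : Adj x x') (hy : Adj y y') :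
    (adjSum m fun m' => wt A m' * rho A c₁ x m x' m' * rho A c₂ m y m' y' *
      vtx A c c₁ c₂ x' m' y') = vtx A c c₁ c₂ x m y * rho A c x y x' y' := by
  have := pentagon h0 h1 (a := c₁) (b := c₂) (c := c) (f := m) hy hx
  simp only [vtx, adjSum]
  rw [tet_rotate h0 h1 c, tet_rotate h0 h1 c, tet_rotate h0 h1 c, rho_swap h0 h1 c x y, this,
    rho_swap h0 h1 c₂ m, rho_swap h0 h1 c₂ m]
  ring

open Classical in
theorem adjSum_rho_mul_rho (c y : ℤ) {x z x' : ℤ} (hx : Adj x x') (hz : Adj z x') (hx' : 0 ≤ x') :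
    wt A x * (adjSum y fun y' => wt A y' * rho A c x y x' y' * rho A c z y x' y') =
      if x = z ∧ AdmTriple x y c then 1 else 0 := by
  by_cases h : x = z
  · subst h
    by_cases g : AdmTriple x y c
    · rw [if_pos ⟨rfl, g⟩, ← rho_orthogonal_self h0 h1 hx hx' g]
      rfl
    · have : ∀ y', rho A c x y x' y' = 0 := fun y' => tet_of_not fun h => g h.2.1
      simp [adjSum, this, g]
  · rw [if_neg (fun g => h g.1), adjSum, rho_orthogonal_of_ne h0 h1 hx hz h, mul_zero]

end

theorem nonneg_of_rho_ne_zero {A : ℂ} {c x y x' y' : ℤ} (h : rho A c x y x' y' ≠ 0) :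
    AdmTriple x y c ∧ AdmTriple x' y' c := by
  have := not_imp_comm.mp tet_of_not h
  exact ⟨this.2.1, admTriple_comm.mp this.2.2.1⟩

/-! ### Transfer of functions of closed paths of states -/

/-- Transports a function of paths of states across a strand of colour `1/2`. The edges crossed by
the paths have colours `cs`, the path `x :: σ` on the near side and the first state `x'` on the
far side are given, and the other states on the far side are summed over. -/
def transfer (A : ℂ) : List ℤ → ℤ → List ℤ → ℤ → (List ℤ → ℂ) → ℂ
  | c :: cs, x, y :: σ, x', f => adjSum y fun y' =>
      wt A y' * rho A c x y x' y' * transfer A cs y σ y' fun τ => f (y' :: τ)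
  | _, _, _, _, f => f []

theorem transfer_mul (A : ℂ) (cs : List ℤ) (x : ℤ) (σ : List ℤ) (x' : ℤ) (f : List ℤ → ℂ) (k : ℂ) :
    transfer A cs x σ x' (fun τ => f τ * k) = transfer A cs x σ x' f * k := by
  induction cs generalizing x σ x' f with
  | nil => rfl
  | cons c cs ih =>
    cases σ with
    | nil => rfl
    | cons y σ =>
      simp only [transfer, ih, adjSum_mul, mul_assoc]

theorem transfer_sum (A : ℂ) {ι : Type*} (s : Finset ι) (cs : List ℤ) (x : ℤ) (σ : List ℤ) (x' : ℤ)
    (f : ι → List ℤ → ℂ) :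
    transfer A cs x σ x' (fun τ => ∑ i ∈ s, f i τ) = ∑ i ∈ s, transfer A cs x σ x' (f i) := by
  induction cs generalizing x σ x' f with
  | nil => rfl
  | cons c cs ih =>
    cases σ with
    | nil => rfl
    | cons y σ =>
      simp only [transfer, ih, adjSum, Finset.mul_sum, Finset.sum_add_distrib]

/-- Paths of states with admissible steps across edges of colours `cs`, from `x` to `z`. -/
def AdmPath : List ℤ → ℤ → List ℤ → ℤ → Prop
  | c :: cs, x, y :: σ, z => AdmTriple x y c ∧ AdmPath cs y σ z
  | [], x, [], z => x = z
  | _, _, _, _ => False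

/-- Functions of closed paths of states across edges of colours `cs` that are compatible with a
strand of colour `1/2`. They come from invariant tensors. -/
structure IsFlat (A : ℂ) (cs : List ℤ) (W : ℤ → List ℤ → ℂ) : Prop where
  supp : ∀ x σ, W x σ ≠ 0 → AdmPath cs x σ x
  flat : ∀ x x' σ, 0 ≤ x → 0 ≤ x' → Adj x x' → σ.length = cs.length →
    wt A x * transfer A cs x σ x' (W x') = wt A x' * W x σ

/-! ### Attaching a vertex -/

/-- Splits the step number `n` of a path into two steps, with a weight `X`. -/
def growFn (X : ℤ → ℤ → ℤ → ℂ) : ℕ → ℤ → (List ℤ → ℂ) → List ℤ → ℂ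
  | 0, x, F, m :: y :: τ => F (y :: τ) * X x m y
  | n + 1, _, F, z :: τ => growFn X n z (fun σ => F (z :: σ)) τ
  | _, _, _, _ => 0

theorem growFn_mul (X : ℤ → ℤ → ℤ → ℂ) (n : ℕ) (x : ℤ) (F : List ℤ → ℂ) (τ : List ℤ) (k : ℂ) :
    growFn X n x (fun σ => k * F σ) τ = k * growFn X n x F τ := by
  induction n generalizing x F τ with
  | zero =>
    match τ with
    | [] | [_] => simp [growFn]
    | m :: y :: τ => simp only [growFn, mul_assoc]
  | succ n ih =>
    cases τ with
    | nil => simp [growFn]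
    | cons z τ => exact ih z _ τ

theorem growFn_adjSum (X : ℤ → ℤ → ℤ → ℂ) (n : ℕ) (x y : ℤ) (F : ℤ → List ℤ → ℂ) (τ : List ℤ) :
    growFn X n x (fun σ => adjSum y fun y' => F y' σ) τ =
      adjSum y fun y' => growFn X n x (F y') τ := by
  induction n generalizing x F τ with
  | zero =>
    match τ with
    | [] | [_] => simp [growFn, adjSum]
    | m :: y :: τ => simp only [growFn, adjSum_mul]
  | succ n ih =>
    cases τ with
    | nil => simp [growFn, adjSum]
    | cons z τ => exact ih z (fun y' σ => F y' (z :: σ)) τ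

theorem growFn_congr (X : ℤ → ℤ → ℤ → ℂ) (n : ℕ) (x : ℤ) {F F' : List ℤ → ℂ} {τ : List ℤ}
    (h : ∀ σ : List ℤ, σ.length + 1 = τ.length → F σ = F' σ) :
    growFn X n x F τ = growFn X n x F' τ := by
  induction n generalizing x F F' τ with
  | zero =>
    match τ with
    | [] | [_] => rfl
    | m :: y :: τ => simp only [growFn, h (y :: τ) rfl]
  | succ n ih =>
    cases τ with
    | nil => rfl
    | cons z τ => exact ih z fun σ hσ => h (z :: σ) (by simpa using hσ)

theorem exists_ne_zero_of_growFn {X : ℤ → ℤ → ℤ → ℂ} {n : ℕ} {x : ℤ} {F : List ℤ → ℂ}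
    {τ : List ℤ} (h : growFn X n x F τ ≠ 0) : ∃ σ, F σ ≠ 0 := by
  by_contra! hF
  refine h ?_
  rw [show F = fun σ => 0 * F σ from funext fun σ => by rw [hF, zero_mul], growFn_mul, zero_mul]

section
variable {A : ℂ} (h0 : 0 < ‖A‖) (h1 : ‖A‖ < 1)
include h0 h1

/-- Transport commutes with attaching a vertex. Away from the vertex nothing happens; at the vertex
it is `adjSum_vtx`. -/
theorem transfer_growFn (pre post : List ℤ) (c c₁ c₂ : ℤ) {x x' : ℤ} (hx : Adj x x')
    (σ : List ℤ) (hσ : σ.length = pre.length + post.length + 2) (F : List ℤ → ℂ) :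
    transfer A (pre ++ c₁ :: c₂ :: post) x σ x' (growFn (vtx A c c₁ c₂) pre.length x' F) =
      growFn (vtx A c c₁ c₂) pre.length x
        (fun τ => transfer A (pre ++ c :: post) x τ x' F) σ := by
  induction pre generalizing x x' σ F with
  | nil =>
    match σ, hσ with
    | m :: y :: σ, _ =>
      simp only [List.nil_append, List.length_nil, transfer, growFn, transfer_mul, mul_adjSum,
        adjSum_mul]
      rw [adjSum_comm]
      refine adjSum_congr fun y' hy => ?_
      have := adjSum_vtx h0 h1 c c₁ c₂ m hx hy
      trans (wt A y' * transfer A post y σ y' fun τ => F (y' :: τ)) *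
        (vtx A c c₁ c₂ x m y * rho A c x y x' y')
      · rw [← this, mul_adjSum]
        refine adjSum_congr fun m' _ => ?_
        ring
      · ring
  | cons c₀ pre ih =>
    match σ, hσ with
    | z :: σ, hσ =>
      simp only [List.cons_append, List.length_cons, transfer, growFn]
      rw [growFn_adjSum]
      refine adjSum_congr fun z' hz => ?_
      rw [growFn_mul, ih hz σ (by simp at hσ; omega)]

theorem IsFlat.grow {pre post : List ℤ} {c c₁ c₂ : ℤ} {W : ℤ → List ℤ → ℂ}
    (h : IsFlat A (pre ++ c :: post) W) :
    IsFlat A (pre ++ c₁ :: c₂ :: post) fun x => growFn (vtx A c c₁ c₂) pre.length x (W x) where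
  supp x σ hσ := by
    have : ∀ x z σ (F : List ℤ → ℂ), growFn (vtx A c c₁ c₂) pre.length x F σ ≠ 0 →
        (∀ τ, F τ ≠ 0 → AdmPath (pre ++ c :: post) x τ z) →
        AdmPath (pre ++ c₁ :: c₂ :: post) x σ z := by
      clear * -
      induction pre with
      | nil =>
        intro x z σ F hσ hF
        match σ, hσ with
        | [], hσ | [_], hσ => exact absurd rfl hσ
        | m :: y :: σ, hσ =>
          have h₁ := hF (y :: σ) (left_ne_zero_of_mul hσ)
          have h₂ := not_imp_comm.mp tet_of_not (right_ne_zero_of_mul hσ)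
          refine ⟨?_, ?_, h₁.2⟩
          · exact admTriple_rotate.mp (admTriple_rotate.mp h₂.2.2.1)
          · exact h₂.2.2.2
      | cons c₀ pre ih =>
        intro x z σ F hσ hF
        match σ, hσ with
        | [], hσ => exact absurd rfl hσ
        | w :: σ, hσ =>
          have hF' : ∀ τ, F (w :: τ) ≠ 0 →
              AdmTriple x w c₀ ∧ AdmPath (pre ++ c :: post) w τ z := fun τ hτ => hF _ hτ
          have := ih w z σ _ hσ fun τ hτ => (hF' τ hτ).2
          refine ⟨?_, this⟩
          obtain ⟨τ, hτ⟩ := exists_ne_zero_of_growFn (n := pre.length) (x := w)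
            (F := fun τ => F (w :: τ)) hσ
          exact (hF' τ hτ).1
    exact this x x σ (W x) hσ (h.supp x)
  flat x x' σ hx hx' hxx' hσ := by
    rw [transfer_growFn h0 h1 pre post c c₁ c₂ hxx' σ (by simp at hσ; omega), ← growFn_mul,
      ← growFn_mul]
    refine growFn_congr _ _ _ fun τ hτ => h.flat x x' τ hx hx' hxx' ?_
    simp at hσ ⊢
    omega

end

/-! ### Capping off two consecutive edges -/

/-- Sums over the state between the steps number `n` and `n + 1` of a path, if the states before and
after it agree. -/
def capFn (A : ℂ) (c : ℤ) : ℕ → ℤ → (List ℤ → ℂ) → List ℤ → ℂ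
  | 0, x, F, τ => ∑ m ∈ Finset.Icc 0 (x + c), wt A m * F (m :: x :: τ)
  | n + 1, _, F, z :: τ => capFn A c n z (fun σ => F (z :: σ)) τ
  | _, _, _, _ => 0

theorem capFn_mul (A : ℂ) (c : ℤ) (n : ℕ) (x : ℤ) (F : List ℤ → ℂ) (τ : List ℤ) (k : ℂ) :
    capFn A c n x (fun σ => k * F σ) τ = k * capFn A c n x F τ := by
  induction n generalizing x F τ with
  | zero =>
    simp only [capFn, Finset.mul_sum, mul_left_comm]
  | succ n ih =>
    cases τ with
    | nil => simp [capFn]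
    | cons z τ => exact ih z _ τ

theorem capFn_adjSum (A : ℂ) (c : ℤ) (n : ℕ) (x y : ℤ) (F : ℤ → List ℤ → ℂ) (τ : List ℤ) :
    capFn A c n x (fun σ => adjSum y fun y' => F y' σ) τ =
      adjSum y fun y' => capFn A c n x (F y') τ := by
  induction n generalizing x F τ with
  | zero =>
    simp only [capFn, adjSum, mul_add, Finset.sum_add_distrib]
  | succ n ih =>
    cases τ with
    | nil => simp [capFn, adjSum]
    | cons z τ => exact ih z (fun y' σ => F y' (z :: σ)) τ

theorem capFn_congr (A : ℂ) (c : ℤ) (n : ℕ) (x : ℤ) {F F' : List ℤ → ℂ} {τ : List ℤ}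
    (h : ∀ σ : List ℤ, σ.length = τ.length + 2 → F σ = F' σ) :
    capFn A c n x F τ = capFn A c n x F' τ := by
  induction n generalizing x F F' τ with
  | zero =>
    simp only [capFn]
    exact Finset.sum_congr rfl fun m _ => by rw [h _ rfl]
  | succ n ih =>
    cases τ with
    | nil => rfl
    | cons z τ => exact ih z fun σ hσ => h (z :: σ) (by simpa using hσ)

theorem exists_ne_zero_of_capFn {A : ℂ} {c : ℤ} {n : ℕ} {x : ℤ} {F : List ℤ → ℂ}
    {τ : List ℤ} (h : capFn A c n x F τ ≠ 0) : ∃ σ, F σ ≠ 0 := by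
  by_contra! hF
  refine h ?_
  rw [show F = fun σ => 0 * F σ from funext fun σ => by rw [hF, zero_mul], capFn_mul, zero_mul]

section
variable {A : ℂ} (h0 : 0 < ‖A‖) (h1 : ‖A‖ < 1)
include h0 h1

/-- Transport commutes with capping: the two crossings with the capped strand cancel by
orthogonality. The support condition on `F` accounts for the admissibility condition in the
orthogonality relation. -/
theorem transfer_capFn (pre post : List ℤ) (c : ℤ) {x x' z : ℤ} (hx0 : 0 ≤ x) (hx' : 0 ≤ x')
    (hx : Adj x x')
    (σ : List ℤ) (hσ : σ.length = pre.length + post.length) (F : List ℤ → ℂ)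
    (hF : ∀ τ, F τ ≠ 0 → AdmPath (pre ++ c :: c :: post) x' τ z) :
    transfer A (pre ++ post) x σ x' (capFn A c pre.length x' F) =
      capFn A c pre.length x
        (fun τ => transfer A (pre ++ c :: c :: post) x τ x' F) σ := by
  classical
  induction pre generalizing x x' σ F with
  | nil =>
    simp only [List.nil_append, List.length_nil, transfer, capFn]
    have hF' : ∀ m y τ, F (m :: y :: τ) ≠ 0 → AdmTriple x' m c := fun m y τ h => (hF _ h).1
    set H : ℤ → ℤ → ℂ := fun m' y' => transfer A post x σ y' fun τ => F (m' :: y' :: τ) with hH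
    have e : ∀ m, wt A m * (adjSum m fun m' => wt A m' * rho A c x m x' m' *
        adjSum x fun y' => wt A y' * rho A c m x m' y' * H m' y') =
        adjSum m fun m' => wt A m' * (adjSum x fun y' => wt A y' *
          (wt A m * rho A c x' m' x m * rho A c y' m' x m) * H m' y') := by
      intro m
      rw [mul_adjSum]
      refine adjSum_congr fun m' _ => ?_
      rw [mul_adjSum, mul_adjSum, mul_adjSum]
      refine adjSum_congr fun y' _ => ?_
      rw [rho_symm h0 h1 c x m, rho_swap h0 h1 c m x, rho_symm h0 h1 c x m y' m']
      ring
    rw [Finset.sum_congr rfl fun m _ => e m]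
    -- With the near state `m` summed first, orthogonality forces `y' = x'`, which is the closed
    -- form of the cap on the far side. The factor `wt A y'` of the transport supplies its
    -- normalisation.
    rw [sum_adjSum_comm (M' := x' + c)]
    · have e' : ∀ m', (adjSum m' fun m => wt A m' * (adjSum x fun y' => wt A y' *
          (wt A m * rho A c x' m' x m * rho A c y' m' x m) * H m' y')) =
          if AdmTriple x' m' c then wt A m' * H m' x' else 0 := by
        intro m'
        rw [← mul_adjSum, adjSum_comm]
        have : ∀ y', Adj x y' → (adjSum m' fun m => wt A y' *
            (wt A m * rho A c x' m' x m * rho A c y' m' x m) * H m' y') =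
            if x' = y' then (if AdmTriple x' m' c then H m' y' else 0) else 0 := by
          intro y' hy
          rw [← adjSum_mul, ← mul_adjSum]
          by_cases hxy : x' = y'
          · subst hxy
            rw [adjSum_rho_mul_rho h0 h1 c m' hx.symm hy.symm hx0]
            by_cases g : AdmTriple x' m' c
            · simp [g]
            · simp [g]
          · rw [if_neg hxy, adjSum, rho_orthogonal_of_ne h0 h1 hx.symm hy.symm hxy]
            simp
        rw [adjSum_congr this, adjSum_ite hx]
        by_cases g : AdmTriple x' m' c
        · rw [if_pos g, if_pos g]
        · rw [if_neg g, if_neg g, mul_zero]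
      rw [Finset.sum_congr rfl fun m _ => e' m, transfer_sum]
      refine Finset.sum_congr rfl fun m' _ => ?_
      have : (fun τ => wt A m' * F (m' :: x' :: τ)) = fun τ => F (m' :: x' :: τ) * wt A m' :=
        funext fun τ => mul_comm _ _
      rw [this, transfer_mul]
      by_cases g : AdmTriple x' m' c
      · rw [if_pos g, mul_comm]
      · rw [if_neg g]
        have z : (fun τ => F (m' :: x' :: τ)) = fun τ => F (m' :: x' :: τ) * 0 := by
          funext τ
          rw [mul_zero]
          exact by_contra fun h => g (hF' _ _ _ h)
        rw [z, transfer_mul]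
        ring
    -- The two ranges are justified by the triangle inequalities in the crossing symbols, which
    -- bound `m` by `x + c` and `m'` by `x' + c`.
    · intro m m' hm hne
      have : ∃ y', rho A c x' m' x m * rho A c y' m' x m ≠ 0 := by
        by_contra! hz
        apply hne
        simp only [mul_assoc, adjSum]
        simp only [← mul_assoc]
        simp [mul_assoc _ (rho A c x' m' x m), hz]
      obtain ⟨y', hy⟩ := this
      have := nonneg_of_rho_ne_zero (left_ne_zero_of_mul hy)
      simp only [admTriple_iff] at this
      omega
  | cons c₀ pre ih =>
    match σ, hσ with
    | [], hσ => exact absurd hσ (by simp only [List.length_cons, List.length_nil]; omega)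
    | w :: σ, hσ =>
      simp only [List.cons_append, List.length_cons, transfer, capFn]
      rw [capFn_adjSum]
      refine adjSum_congr fun w' hw => ?_
      rw [capFn_mul]
      by_cases hr : rho A c₀ x w x' w' = 0
      · simp [hr]
      have := nonneg_of_rho_ne_zero hr
      have hF' : ∀ τ, F (w' :: τ) ≠ 0 →
          AdmTriple x' w' c₀ ∧ AdmPath (pre ++ c :: c :: post) w' τ z := fun τ hτ => hF _ hτ
      rw [ih this.1.2.1 this.2.2.1 hw σ (by simp at hσ; omega) _ fun τ hτ => (hF' τ hτ).2]

theorem IsFlat.cap {pre post : List ℤ} {c : ℤ} {W : ℤ → List ℤ → ℂ}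
    (h : IsFlat A (pre ++ c :: c :: post) W) :
    IsFlat A (pre ++ post) fun x => capFn A c pre.length x (W x) where
  supp x σ hσ := by
    have : ∀ x z σ (F : List ℤ → ℂ), capFn A c pre.length x F σ ≠ 0 →
        (∀ τ, F τ ≠ 0 → AdmPath (pre ++ c :: c :: post) x τ z) →
        AdmPath (pre ++ post) x σ z := by
      clear * -
      induction pre with
      | nil =>
        intro x z σ F hσ hF
        obtain ⟨m, -, hm⟩ := Finset.exists_ne_zero_of_sum_ne_zero hσ
        exact (hF _ (right_ne_zero_of_mul hm)).2.2
      | cons c₀ pre ih =>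
        intro x z σ F hσ hF
        match σ, hσ with
        | [], hσ => exact absurd rfl hσ
        | w :: σ, hσ =>
          have hF' : ∀ τ, F (w :: τ) ≠ 0 →
              AdmTriple x w c₀ ∧ AdmPath (pre ++ c :: c :: post) w τ z := fun τ hτ => hF _ hτ
          have := ih w z σ _ hσ fun τ hτ => (hF' τ hτ).2
          refine ⟨?_, this⟩
          obtain ⟨τ, hτ⟩ := exists_ne_zero_of_capFn (n := pre.length) (x := w)
            (F := fun τ => F (w :: τ)) hσ
          exact (hF' τ hτ).1
    exact this x x σ (W x) hσ (h.supp x)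
  flat x x' σ hx hx' hxx' hσ := by
    rw [transfer_capFn h0 h1 pre post c hx hx' hxx' σ (by simp at hσ; omega) _ (h.supp x'),
      ← capFn_mul, ← capFn_mul]
    refine capFn_congr _ _ _ _ fun τ hτ => h.flat x x' τ hx hx' hxx' ?_
    simp at hσ ⊢
    omega

/-! ### Initial and final paths -/

-- The path has to close up at `x'`, so only the term `z' = x'` of the inner sum survives, provided
-- that `x'` is a neighbour of `z`.
omit h0 h1 in
open Classical in
theorem transfer_pair (c x y z x' : ℤ) {F : List ℤ → ℂ} (hF : ∀ y' z', z' ≠ x' → F [y', z'] = 0) :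
    transfer A [c, c] x [y, z] x' F = if Adj z x' then wt A x' *
      adjSum y (fun y' => wt A y' * rho A c x y x' y' * rho A c y z y' x' * F [y', x']) else 0 := by
  simp only [transfer]
  by_cases hz : Adj z x'
  · rw [if_pos hz, mul_adjSum]
    refine adjSum_congr fun y' _ => ?_
    have : (adjSum z fun z' => wt A z' * rho A c y z y' z' * F [y', z']) =
        adjSum z fun z' => if x' = z' then wt A z' * rho A c y z y' z' * F [y', z'] else 0 := by
      refine adjSum_congr fun z' _ => ?_
      split_ifs with h
      · rfl
      · rw [hF y' z' (Ne.symm h), mul_zero]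
    rw [this, adjSum_ite hz]
    ring
  · rw [if_neg hz]
    unfold Adj at hz
    push Not at hz
    simp only [adjSum]
    rw [hF _ _ (Ne.symm hz.1), hF _ _ (Ne.symm hz.2), hF _ _ (Ne.symm hz.1), hF _ _ (Ne.symm hz.2)]
    ring

-- This is the function of a bare strand of colour `c`, the seed from which a spanning tree is
-- grown. Its flatness is the orthogonality relation.
open Classical in
theorem isFlat_pair (c : ℤ) : IsFlat A [c, c] fun x σ =>
    match σ with
    | [y, z] => if x = z ∧ AdmTriple x y c then 1 else 0
    | _ => 0 where
  supp x σ h := by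
    match σ, h with
    | [], h | [_], h | _ :: _ :: _ :: _, h => exact absurd rfl h
    | [y, z], h =>
      simp only [ne_eq, ite_eq_right_iff, not_forall] at h
      obtain ⟨⟨rfl, h⟩, -⟩ := h
      exact ⟨h, admTriple_comm.mp h, rfl⟩
  flat x x' σ hx hx' hxx' hσ := by
    match σ, hσ with
    | [y, z], _ =>
      rw [transfer_pair _ _ _ _ _ fun y' z' h => if_neg fun g => h g.1.symm]
      dsimp only
      by_cases hz : Adj z x'
      · rw [if_pos hz, ← adjSum_rho_mul_rho h0 h1 c y hxx' hz hx', mul_left_comm]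
        congr 2
        refine adjSum_congr fun y' _ => ?_
        rw [rho_swap h0 h1 c y z]
        by_cases hr : rho A c x y x' y' = 0
        · simp [hr]
        · rw [if_pos ⟨rfl, (nonneg_of_rho_ne_zero hr).2⟩, mul_one]
      · rw [if_neg hz, if_neg fun h : x = z ∧ AdmTriple x y c => hz (h.1 ▸ hxx')]
        ring

/-- A flat function of closed paths of length two is constant on admissible paths. -/
theorem IsFlat.pair_symm {c : ℤ} (hc : 0 ≤ c) {W : ℤ → List ℤ → ℂ} (h : IsFlat A [c, c] W) :
    W 0 [c, 0] = W c [0, c] := by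
  -- Along the line where the two states add up to `c`, one of the two terms of the transport drops
  -- out, since its states would add up to less than `c`. Flatness therefore compares just two
  -- values of `W`, and the line leads from `(0, c)` to `(c, 0)`.
  have step : ∀ k, 0 ≤ k → k < c → W (k + 1) [c - k - 1, k + 1] = W k [c - k, k] := by
    intro k hk hkc
    have hadj : Adj (k + 1) k := Or.inr (by ring)
    have hW : ∀ y' z', z' ≠ k → W k [y', z'] = 0 := by
      intro y' z' hz
      by_contra hne
      exact hz (h.supp _ _ hne).2.2
    have e := h.flat (k + 1) k [c - k - 1, k + 1] (by omega) hk hadj rfl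
    rw [transfer_pair _ _ _ _ _ hW, if_pos hadj] at e
    have o := adjSum_rho_mul_rho h0 h1 c (c - k - 1) hadj hadj hk
    rw [if_pos ⟨rfl, by rw [admTriple_iff]; omega⟩] at o
    have z : rho A c (k + 1) (c - k - 1) k (c - k - 1 - 1) = 0 := by
      by_contra hr
      have := (nonneg_of_rho_ne_zero hr).2
      rw [admTriple_iff] at this
      omega
    simp only [adjSum, z, mul_zero, zero_mul, add_zero] at e o
    rw [rho_swap h0 h1 c (c - k - 1)] at e
    rw [show c - k - 1 + 1 = c - k by ring] at e o
    refine (mul_left_cancel₀ (wt_ne_zero h0 h1 hk) ?_).symm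
    rw [← e]
    linear_combination -wt A k * W k [c - k, k] * o
  have all : ∀ n : ℕ, (n : ℤ) ≤ c → W n [c - n, n] = W 0 [c, 0] := by
    intro n
    induction n with
    | zero => simp
    | succ n ih =>
      intro hn
      push_cast at hn ⊢
      rw [← ih (by omega), ← step n (by omega) (by omega)]
      ring_nf
  have := all c.toNat (by omega)
  rw [show ((c.toNat : ℕ) : ℤ) = c by omega, sub_self] at this
  exact this.symm

end
namespace CubicMap

variable {V : Type*} (G : CubicMap V)

/-! ### Darts, edges and faces -/

theorem rot_mk (v : V) (i : Fin 3) : rot (v, i) = (v, i + 1) := rfl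

@[simp]
theorem rot_fst (d : V × Fin 3) : (rot d).1 = d.1 := rfl

theorem rot_rot_rot (d : V × Fin 3) : rot (rot (rot d)) = d := by
  obtain ⟨v, i⟩ := d
  simp only [rot_mk, Prod.mk.injEq, true_and]
  revert i
  decide

theorem rot_ne (d : V × Fin 3) : rot d ≠ d := by
  obtain ⟨v, i⟩ := d
  simp only [rot_mk, ne_eq, Prod.mk.injEq, true_and]
  revert i
  decide

theorem rot_rot_ne (d : V × Fin 3) : rot (rot d) ≠ d := fun h =>
  rot_ne d (by nth_rewrite 1 [← h]; exact rot_rot_rot d)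

theorem eq_or_eq_rot {d e : V × Fin 3} (h : d.1 = e.1) : d = e ∨ d = rot e ∨ d = rot (rot e) := by
  obtain ⟨v, i⟩ := d
  obtain ⟨w, j⟩ := e
  obtain rfl : v = w := h
  simp only [rot_mk, Prod.mk.injEq, true_and]
  revert i j
  decide

theorem edge_opp (d : V × Fin 3) : G.edge (G.opp d) = G.edge d :=
  Quotient.sound ⟨1, by simp [G.opp_opp]⟩

theorem edge_eq_iff {d e : V × Fin 3} : G.edge d = G.edge e ↔ d = e ∨ d = G.opp e := by
  constructor
  · intro h
    obtain ⟨k, hk⟩ : G.opp.SameCycle d e := Quotient.exact h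
    have h2 : G.opp ^ (2 : ℤ) = 1 := by
      ext1 x
      exact G.opp_opp x
    rcases Int.even_or_odd' k with ⟨m, rfl | rfl⟩
    · rw [zpow_mul, h2, one_zpow] at hk
      exact Or.inl hk
    · rw [zpow_add, zpow_mul, h2, one_zpow, one_mul, zpow_one] at hk
      rw [← hk]
      exact Or.inr (G.opp_opp d).symm
  · rintro (rfl | rfl)
    · rfl
    · exact G.edge_opp e

theorem face_next (d : V × Fin 3) : G.face (G.next d) = G.face d :=
  Quotient.sound ⟨-1, by simp⟩

open Classical in
theorem two_mul_card_edge [Fintype V] : 2 * Fintype.card G.Edge = 3 * Fintype.card V := by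
  have h := Finset.card_eq_sum_card_fiberwise (f := G.edge) (s := Finset.univ)
    (t := Finset.univ) (fun _ _ => Finset.mem_univ _)
  have h2 : ∀ e ∈ (Finset.univ : Finset G.Edge),
      (Finset.univ.filter fun d => G.edge d = e).card = 2 := by
    intro e _
    obtain ⟨d, rfl⟩ := Quotient.exists_rep e
    have : (Finset.univ.filter fun x => G.edge x = G.edge d) = {d, G.opp d} := by
      ext x
      simp [edge_eq_iff]
    exact (congrArg Finset.card this).trans (Finset.card_pair (G.opp_ne d).symm)
  rw [Finset.sum_congr rfl h2, Finset.sum_const, Finset.card_univ, Finset.card_univ,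
    Fintype.card_prod, Fintype.card_fin, smul_eq_mul] at h
  omega

/-! ### Vertex weights -/

/-- The factor of a vertex in the weight of a shadow-state. -/
def vertexWeight (A : ℂ) (c : G.Edge → ℤ) (s : G.Face → ℤ) (v : V) : ℂ :=
  tet A (c (G.edge (v, 0))) (c (G.edge (v, 1))) (c (G.edge (v, 2)))
    (s (G.face (v, 2))) (s (G.face (v, 0))) (s (G.face (v, 1)))

/-- By rotation invariance of the tetrahedron, the labelling of the vertex may start at any dart. -/
theorem vertexWeight_eq {A : ℂ} (h0 : 0 < ‖A‖) (h1 : ‖A‖ < 1) (c : G.Edge → ℤ) (s : G.Face → ℤ)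
    (d : V × Fin 3) : G.vertexWeight A c s d.1 =
      vtx A (c (G.edge d)) (c (G.edge (rot d))) (c (G.edge (rot (rot d))))
        (s (G.face (rot d))) (s (G.face (rot (rot d)))) (s (G.face d)) := by
  obtain ⟨v, i⟩ := d
  unfold vtx vertexWeight
  simp only [rot_mk]
  have h3 : ∀ i : Fin 3, i = 0 ∨ i = 1 ∨ i = 2 := by decide
  rcases h3 i with rfl | rfl | rfl
  · rfl
  · rw [tet_rotate h0 h1]
    rfl
  · rw [tet_rotate h0 h1, tet_rotate h0 h1]
    rfl

/-- The vertex weights already enforce the admissibility conditions of a shadow-state, so the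
bracket can be summed over a box of arbitrary states. -/
theorem admTriple_of_vertexWeight_ne_zero {A : ℂ} (h0 : 0 < ‖A‖) (h1 : ‖A‖ < 1) {c : G.Edge → ℤ}
    {s : G.Face → ℤ} {d : V × Fin 3} (h : G.vertexWeight A c s d.1 ≠ 0) :
    AdmTriple (s (G.face d)) (s (G.face (G.opp d))) (c (G.edge d)) := by
  rw [vertexWeight_eq G h0 h1] at h
  have := (not_imp_comm.mp tet_of_not h).2.1
  rw [face_opp]
  exact admTriple_rotate.mp this

theorem weight_eq [Fintype V] (A : ℂ) (c : G.Edge → ℤ) (s : G.Face → ℤ) :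
    G.weight A c s = (∏ r : G.Face, wt A (s r)) * ∏ v : V, G.vertexWeight A c s v := rfl

theorem admTriple_of_weight_ne_zero [Fintype V] {A : ℂ} (h0 : 0 < ‖A‖) (h1 : ‖A‖ < 1)
    {c : G.Edge → ℤ} {s : G.Face → ℤ} (h : G.weight A c s ≠ 0) (d : V × Fin 3) :
    AdmTriple (s (G.face d)) (s (G.face (G.opp d))) (c (G.edge d)) := by
  rw [weight_eq] at h
  exact G.admTriple_of_vertexWeight_ne_zero h0 h1
    (Finset.prod_ne_zero_iff.mp (right_ne_zero_of_mul h) d.1 (Finset.mem_univ _))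

/-- A bound for the shadow-states, and the bracket as a sum over a box that contains all states
within this bound. -/
theorem bracket_eq_sum [Fintype V] [DecidableEq G.Face] {A : ℂ} (h0 : 0 < ‖A‖) (h1 : ‖A‖ < 1)
    (hG : G.IsConnected) (c : G.Edge → ℤ) (r₀ : G.Face) :
    ∃ B₀ : ℤ, (∀ s, G.IsShadowState c r₀ s → ∀ r, s r ≤ B₀) ∧
      ∀ t : G.Face → Finset ℤ, (∀ r, Finset.Icc 0 B₀ ⊆ t r) →
        G.bracket r₀ c A =
          ∑ s ∈ Fintype.piFinset t, if s r₀ = 0 then G.weight A c s else 0 := by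
  obtain ⟨B₀, hB₀⟩ : ∃ B₀ : ℤ, ∀ s, G.IsShadowState c r₀ s → ∀ r, s r ≤ B₀ := by
    have hf := G.finite_shadowStates hG c r₀
    -- Any common bound will do; the sum of the absolute values of all states of all shadow-states
    -- is one.
    refine ⟨∑ s ∈ hf.toFinset, ∑ r, |s r|, fun s hs r => (le_abs_self _).trans ?_⟩
    refine (Finset.single_le_sum (f := fun r => |s r|) (fun r _ => abs_nonneg _)
      (Finset.mem_univ r)).trans ?_
    exact Finset.single_le_sum (f := fun s : G.Face → ℤ => ∑ r, |s r|)
      (fun s _ => Finset.sum_nonneg fun r _ => abs_nonneg _) (hf.mem_toFinset.mpr hs)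
  refine ⟨B₀, hB₀, fun t ht => ?_⟩
  have key : ∀ s, s r₀ = 0 → G.weight A c s ≠ 0 → G.IsShadowState c r₀ s := fun s hs hw =>
    ⟨hs, G.admTriple_of_weight_ne_zero h0 h1 hw⟩
  rw [← Finset.sum_filter, bracket]
  refine finsum_mem_eq_sum_of_inter_support_eq _ (Set.ext fun s => ?_)
  simp only [Set.mem_inter_iff, Set.mem_ofPred_eq, Function.mem_support, Finset.coe_filter,
    Fintype.mem_piFinset]
  constructor
  · rintro ⟨hs, hw⟩
    refine ⟨⟨fun r => ht r (Finset.mem_Icc.mpr ⟨?_, hB₀ s hs r⟩), hs.1⟩, hw⟩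
    obtain ⟨d, rfl⟩ := Quotient.exists_rep r
    exact (hs.2 d).1
  · rintro ⟨⟨-, hs⟩, hw⟩
    exact ⟨key s hs hw, hw⟩

/-- Consequently the sum over admissible perturbations may be extended to all perturbations. -/
theorem bracket_of_not_admissible [Fintype V] (A : ℂ) {c : G.Edge → ℤ} (hc : ¬G.Admissible c)
    (r₀ : G.Face) : G.bracket r₀ c A = 0 := by
  refine finsum_mem_eq_zero_of_forall_eq_zero fun s _ => ?_
  unfold Admissible at hc
  push Not at hc
  obtain ⟨v, hv⟩ := hc
  rw [weight_eq, Finset.prod_eq_zero (Finset.mem_univ v) (tet_of_not fun h => hv h.1), mul_zero]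

end CubicMap

/-- Splits off one variable of a sum over a product of finite sets. -/
theorem sum_piFinset_update {ι : Type*} [Fintype ι] [DecidableEq ι] (t : ι → Finset ℤ) (r : ι)
    (f : (ι → ℤ) → ℂ) : ∑ s ∈ Fintype.piFinset t, f s =
      ∑ s ∈ Fintype.piFinset (Function.update t r {0}), ∑ m ∈ t r, f (Function.update s r m) := by
  rw [← Finset.sum_product']
  refine Finset.sum_nbij' (fun s => (Function.update s r 0, s r))
    (fun p => Function.update p.1 r p.2) ?_ ?_ ?_ ?_ ?_
  · intro s hs
    rw [Fintype.mem_piFinset] at hs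
    rw [Finset.mem_product, Fintype.mem_piFinset]
    refine ⟨fun i => ?_, hs r⟩
    by_cases h : i = r
    · subst h
      simp
    · simp [Function.update_of_ne h, hs i]
  · rintro ⟨s, m⟩ hs
    rw [Finset.mem_product, Fintype.mem_piFinset] at hs
    rw [Fintype.mem_piFinset]
    intro i
    by_cases h : i = r
    · subst h
      simpa using hs.2
    · have := hs.1 i
      simpa [Function.update_of_ne h] using this
  · intro s _
    simp
  · rintro ⟨s, m⟩ hs
    rw [Finset.mem_product, Fintype.mem_piFinset] at hs
    have := hs.1 r
    simp only [Function.update_self, Finset.mem_singleton] at this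
    simp [← this]
  · intro s _
    simp

namespace CubicMap

variable {V : Type*} (G : CubicMap V)

/-! ### Walks along the boundary of a tree -/

/-- The list `L` of darts is crossed by a walk from the region `r` to the region `e` that crosses
every dart from right to left. -/
def Link : G.Face → List (V × Fin 3) → G.Face → Prop
  | r, [], e => r = e
  | r, d :: L, e => G.face d = r ∧ Link (G.face (G.opp d)) L e

theorem link_append {r e : G.Face} {L₁ L₂ : List (V × Fin 3)} :
    G.Link r (L₁ ++ L₂) e ↔ ∃ f, G.Link r L₁ f ∧ G.Link f L₂ e := by
  induction L₁ generalizing r with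
  | nil => simp [Link]
  | cons d L ih =>
    simp only [List.cons_append, Link, ih]
    constructor
    · rintro ⟨h, f, h₁, h₂⟩
      exact ⟨f, ⟨h, h₁⟩, h₂⟩
    · rintro ⟨f, ⟨h, h₁⟩, h₂⟩
      exact ⟨h, f, h₁, h₂⟩

theorem exists_face_eq_of_link {r f : G.Face} {L₁ L₂ : List (V × Fin 3)} (h₁ : G.Link r L₁ f)
    (h₂ : G.Link f L₂ r) (hne : L₁ ++ L₂ ≠ []) : ∃ d ∈ L₁ ++ L₂, G.face d = f := by
  cases L₂ with
  | cons d L => exact ⟨d, by simp, h₂.1⟩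
  | nil =>
    obtain rfl : f = r := h₂
    cases L₁ with
    | cons d L => exact ⟨d, by simp, h₁.1⟩
    | nil => exact absurd rfl hne

/-- The states met along a walk, except for the first one. -/
def pathOf (s : G.Face → ℤ) (L : List (V × Fin 3)) : List ℤ := L.map fun d => s (G.face (G.opp d))

variable {G}

theorem growFn_pathOf (X : ℤ → ℤ → ℤ → ℂ) (s : G.Face → ℤ) {r e : G.Face}
    {pre : List (V × Fin 3)} (h : G.Link r pre e) (F : List ℤ → ℂ) (m y : ℤ) (τ : List ℤ) :
    growFn X pre.length (s r) F (G.pathOf s pre ++ m :: y :: τ) =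
      F (G.pathOf s pre ++ y :: τ) * X (s e) m y := by
  induction pre generalizing r F with
  | nil =>
    obtain rfl : r = e := h
    rfl
  | cons d L ih => exact ih h.2 fun σ => F (s (G.face (G.opp d)) :: σ)

theorem capFn_pathOf (A : ℂ) (c : ℤ) (s : G.Face → ℤ) {r e : G.Face}
    {pre : List (V × Fin 3)} (h : G.Link r pre e) (F : List ℤ → ℂ) (τ : List ℤ) :
    capFn A c pre.length (s r) F (G.pathOf s pre ++ τ) =
      ∑ m ∈ Finset.Icc 0 (s e + c), wt A m * F (G.pathOf s pre ++ m :: s e :: τ) := by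
  induction pre generalizing r F with
  | nil =>
    obtain rfl : r = e := h
    rfl
  | cons d L ih => exact ih h.2 fun σ => F (s (G.face (G.opp d)) :: σ)

theorem admTriple_of_admPath {c : G.Edge → ℤ} (s : G.Face → ℤ) {r e : G.Face}
    {pre : List (V × Fin 3)} (h : G.Link r pre e) {cs τ : List ℤ} {m z c₀ : ℤ}
    (hp : AdmPath (pre.map (fun d => c (G.edge d)) ++ c₀ :: cs) (s r)
      (G.pathOf s pre ++ m :: τ) z) : AdmTriple (s e) m c₀ := by
  induction pre generalizing r with
  | nil =>
    obtain rfl : r = e := h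
    exact hp.1
  | cons d L ih => exact ih h.2 hp.2

variable (G)

/-- `L` is the cyclic list of the darts that leave a subtree with vertex set `U`, starting in the
region `r₀`, and for all colourings the product of the weights of the vertices in `U` comes from a
flat function of closed paths. -/
structure IsTreeBoundary (A : ℂ) (r₀ : G.Face) (U : Finset V) (L : List (V × Fin 3)) : Prop where
  link : G.Link r₀ L r₀
  nodup : L.Nodup
  fst_mem : ∀ d ∈ L, d.1 ∈ U
  opp_fst_mem : ∀ d : V × Fin 3, d.1 ∈ U → d ∉ L → (G.opp d).1 ∈ U
  opp_notMem : ∀ d : V × Fin 3, d.1 ∈ U → d ∉ L → G.opp d ∉ L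
  length : L.length = U.card + 2
  exists_face : ∀ d : V × Fin 3, d.1 ∈ U → ∃ e ∈ L, G.face e = G.face d
  exists_flat : ∀ c : G.Edge → ℤ, ∃ W, IsFlat A (L.map fun d => c (G.edge d)) W ∧
    ∀ s : G.Face → ℤ, W (s r₀) (G.pathOf s L) = ∏ v ∈ U, G.vertexWeight A c s v

variable {G}

theorem isTreeBoundary_singleton {A : ℂ} (h0 : 0 < ‖A‖) (h1 : ‖A‖ < 1) (d : V × Fin 3) :
    G.IsTreeBoundary A (G.face (rot d)) {d.1} [rot d, rot (rot d), d] where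
  link := ⟨rfl, (G.face_opp _).symm, by
    rw [face_opp, rot_rot_rot], G.face_opp d⟩
  nodup := by
    have h₁ := rot_ne d
    have h₂ := rot_rot_ne d
    have h₃ := rot_ne (rot d)
    simp [h₁, h₂, h₃.symm]
  fst_mem := by simp
  opp_fst_mem e he hL := by
    rcases eq_or_eq_rot (Finset.mem_singleton.mp he) with rfl | rfl | rfl <;> simp at hL
  opp_notMem e he hL := by
    rcases eq_or_eq_rot (Finset.mem_singleton.mp he) with rfl | rfl | rfl <;> simp at hL
  length := by simp
  exists_face e he := by
    rcases eq_or_eq_rot (Finset.mem_singleton.mp he) with rfl | rfl | rfl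
    · exact ⟨_, by simp, rfl⟩
    · exact ⟨_, by simp, rfl⟩
    · exact ⟨_, by simp, rfl⟩
  exists_flat c := by
    classical
    -- A single vertex arises from the bare strand of `d` by splitting one of its two ends into the
    -- other two edges.
    have h := IsFlat.grow h0 h1 (pre := []) (c₁ := c (G.edge (rot d)))
      (c₂ := c (G.edge (rot (rot d)))) (isFlat_pair h0 h1 (c (G.edge d)))
    refine ⟨_, h, fun s => ?_⟩
    rw [Finset.prod_singleton, vertexWeight_eq G h0 h1]
    simp only [pathOf, List.map_cons, List.map_nil, face_opp, rot_rot_rot, List.length_nil, growFn]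
    by_cases hv : vtx A (c (G.edge d)) (c (G.edge (rot d))) (c (G.edge (rot (rot d))))
        (s (G.face (rot d))) (s (G.face (rot (rot d)))) (s (G.face d)) = 0
    · rw [hv, mul_zero]
    · have := (not_imp_comm.mp tet_of_not hv).2.1
      rw [if_pos ⟨trivial, admTriple_comm.mp (admTriple_rotate.mp this)⟩, one_mul]

-- The dart `d` of the boundary list is replaced by the two other darts at its far vertex, in the
-- order in which the walk around the enlarged tree crosses them. The weight of the new vertex
-- enters through `growFn`.
open Classical in
theorem IsTreeBoundary.grow {A : ℂ} (h0 : 0 < ‖A‖) (h1 : ‖A‖ < 1) {r₀ : G.Face} {U : Finset V}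
    {pre post : List (V × Fin 3)} {d : V × Fin 3}
    (h : G.IsTreeBoundary A r₀ U (pre ++ d :: post)) (hd : (G.opp d).1 ∉ U) :
    G.IsTreeBoundary A r₀ (insert (G.opp d).1 U)
      (pre ++ rot (G.opp d) :: rot (rot (G.opp d)) :: post) := by
  obtain ⟨f, hpre, hf, hpost⟩ := (link_append G).mp h.link
  have hdU := h.fst_mem d (by simp)
  have hpreU : ∀ e ∈ pre, e.1 ∈ U := fun e he => h.fst_mem e (by simp [he])
  have hpostU : ∀ e ∈ post, e.1 ∈ U := fun e he => h.fst_mem e (by simp [he])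
  have hnew : ∀ e : V × Fin 3, e.1 = (G.opp d).1 → e ∉ pre ∧ e ∉ post := fun e he =>
    ⟨fun h => hd (he ▸ hpreU e h), fun h => hd (he ▸ hpostU e h)⟩
  have hnodup := h.nodup
  rw [List.nodup_middle, List.nodup_cons, List.mem_append, not_or] at hnodup
  have hlink₂ : G.Link f (rot (G.opp d) :: rot (rot (G.opp d)) :: post) r₀ := by
    refine ⟨?_, (G.face_opp _).symm, ?_⟩
    · rw [← face_opp, opp_opp, hf]
    · rw [face_opp, rot_rot_rot]
      exact hpost
  refine ⟨(link_append G).mpr ⟨f, hpre, hlink₂⟩, ?_, ?_, ?_, ?_, ?_, ?_, ?_⟩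
  · rw [List.nodup_middle, List.nodup_cons, List.nodup_middle, List.nodup_cons]
    obtain ⟨a₁, a₂⟩ := hnew (rot (G.opp d)) rfl
    obtain ⟨b₁, b₂⟩ := hnew (rot (rot (G.opp d))) rfl
    refine ⟨?_, ?_, hnodup.2⟩
    · simp [a₁, a₂, (rot_ne (rot (G.opp d))).symm]
    · simp [b₁, b₂]
  · intro e he
    simp only [List.mem_append, List.mem_cons] at he
    rcases he with he | rfl | rfl | he
    · exact Finset.mem_insert_of_mem (hpreU e he)
    · exact Finset.mem_insert_self _ _
    · exact Finset.mem_insert_self _ _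
    · exact Finset.mem_insert_of_mem (hpostU e he)
  · intro e he hL
    simp only [List.mem_append, List.mem_cons, not_or] at hL
    rcases Finset.mem_insert.mp he with he | he
    · rcases eq_or_eq_rot he with rfl | rfl | rfl
      · rw [opp_opp]
        exact Finset.mem_insert_of_mem hdU
      · exact absurd rfl hL.2.1
      · exact absurd rfl hL.2.2.1
    · by_cases hed : e = d
      · subst hed
        exact Finset.mem_insert_self _ _
      · exact Finset.mem_insert_of_mem (h.opp_fst_mem e he (by simp [hL, hed]))
  · intro e he hL
    simp only [List.mem_append, List.mem_cons, not_or] at hL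
    rcases Finset.mem_insert.mp he with he | he
    · rcases eq_or_eq_rot he with rfl | rfl | rfl
      · rw [opp_opp]
        have a₁ : d ≠ rot (G.opp d) := fun h => hd (by
          have := congrArg Prod.fst h
          rw [rot_fst] at this
          rwa [← this])
        have a₂ : d ≠ rot (rot (G.opp d)) := fun h => hd (by
          have := congrArg Prod.fst h
          rw [rot_fst, rot_fst] at this
          rwa [← this])
        simp [a₁, a₂, hnodup.1.1, hnodup.1.2]
      · exact absurd rfl hL.2.1
      · exact absurd rfl hL.2.2.1
    · by_cases hed : e = d
      · subst hed
        obtain ⟨a₁, a₂⟩ := hnew (G.opp e) rfl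
        simp [a₁, a₂, (rot_ne (G.opp e)).symm, (rot_rot_ne (G.opp e)).symm]
      · have hU := h.opp_fst_mem e he (by simp [hL, hed])
        have hn := h.opp_notMem e he (by simp [hL, hed])
        simp only [List.mem_append, List.mem_cons, not_or] at hn ⊢
        refine ⟨hn.1, fun h => hd ?_, fun h => hd ?_, hn.2.2⟩
        · rw [h, rot_fst] at hU
          exact hU
        · rw [h, rot_fst, rot_fst] at hU
          exact hU
  · have := h.length
    rw [Finset.card_insert_of_notMem hd]
    simp only [List.length_append, List.length_cons] at this ⊢
    omega
  · have old : ∀ e ∈ pre ++ d :: post, ∃ e' ∈ pre ++ rot (G.opp d) :: rot (rot (G.opp d)) :: post,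
        G.face e' = G.face e := by
      intro e he
      simp only [List.mem_append, List.mem_cons] at he
      rcases he with he | rfl | he
      · exact ⟨e, by simp [he], rfl⟩
      · exact ⟨rot (G.opp e), by simp, by rw [← face_opp, opp_opp]⟩
      · exact ⟨e, by simp [he], rfl⟩
    intro e he
    rcases Finset.mem_insert.mp he with he | he
    · rcases eq_or_eq_rot he with rfl | rfl | rfl
      · have l₁ : G.Link r₀ (pre ++ [rot (G.opp d), rot (rot (G.opp d))]) (G.face (G.opp d)) := by
          refine (link_append G).mpr ⟨f, hpre, hlink₂.1, hlink₂.2.1, ?_⟩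
          change G.face (G.opp (rot (rot (G.opp d)))) = _
          rw [face_opp, rot_rot_rot]
        obtain ⟨e, he, hef⟩ := exists_face_eq_of_link G l₁ hpost (by simp)
        exact ⟨e, by simpa using he, hef⟩
      · exact ⟨_, by simp, rfl⟩
      · exact ⟨_, by simp, rfl⟩
    · obtain ⟨e', he', hf'⟩ := h.exists_face e he
      obtain ⟨e'', he'', hf''⟩ := old e' he'
      exact ⟨e'', he'', hf''.trans hf'⟩
  · intro c
    obtain ⟨W, hW, hs⟩ := h.exists_flat c
    rw [List.map_append, List.map_cons] at hW
    have hW' := IsFlat.grow h0 h1 (c₁ := c (G.edge (rot (G.opp d))))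
      (c₂ := c (G.edge (rot (rot (G.opp d))))) hW
    refine ⟨_, by simpa using hW', fun s => ?_⟩
    rw [Finset.prod_insert hd, ← hs s, vertexWeight_eq G h0 h1, edge_opp]
    simp only [pathOf, List.map_append, List.map_cons]
    have := growFn_pathOf (vtx A (c (G.edge d)) (c (G.edge (rot (G.opp d))))
      (c (G.edge (rot (rot (G.opp d)))))) s hpre (W (s r₀)) (s (G.face (G.opp (rot (G.opp d)))))
      (s (G.face (G.opp (rot (rot (G.opp d)))))) (G.pathOf s post)
    unfold pathOf at this
    rw [this, face_opp G (rot (rot _)), rot_rot_rot, face_opp G (rot _), mul_comm,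
      ← face_opp G (G.opp d), opp_opp, hf]

-- As long as a vertex is missing, connectedness provides a dart from `U` to its complement, and
-- such a dart is in the boundary list; the tree grows along it.
open Classical in
theorem exists_isTreeBoundary [Fintype V] {A : ℂ} (h0 : 0 < ‖A‖) (h1 : ‖A‖ < 1)
    (hG : G.IsConnected) (r₀ : G.Face) : ∃ L, G.IsTreeBoundary A r₀ Finset.univ L := by
  obtain ⟨d, hd⟩ : ∃ d, G.face (rot d) = r₀ := by
    obtain ⟨d, rfl⟩ := Quotient.exists_rep r₀
    exact ⟨rot (rot d), by rw [rot_rot_rot]; rfl⟩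
  have key : ∀ n : ℕ, n < Fintype.card V → ∃ U L, U.card = n + 1 ∧ G.IsTreeBoundary A r₀ U L := by
    intro n
    induction n with
    | zero =>
      intro _
      subst hd
      exact ⟨_, _, Finset.card_singleton _, isTreeBoundary_singleton h0 h1 d⟩
    | succ n ih =>
      intro hn
      obtain ⟨U, L, hU, h⟩ := ih (by omega)
      obtain ⟨w, hw⟩ : ∃ w, w ∉ U := by
        by_contra! hall
        have := Finset.card_eq_iff_eq_univ U |>.mpr (Finset.eq_univ_of_forall hall)
        omega
      obtain ⟨v, hv⟩ : U.Nonempty := Finset.card_pos.mp (by omega)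
      obtain ⟨e, heU, he⟩ : ∃ e : V × Fin 3, e.1 ∈ U ∧ (G.opp e).1 ∉ U := by
        by_contra! hclosed
        have : ∀ w, Relation.ReflTransGen (fun x y => ∃ i, (G.opp (x, i)).1 = y) v w → w ∈ U := by
          intro w hvw
          induction hvw with
          | refl => exact hv
          | tail _ hxy ih =>
            obtain ⟨i, rfl⟩ := hxy
            exact hclosed _ ih
        exact hw (this w (hG v w))
      have heL : e ∈ L := by
        by_contra hL
        exact he (h.opp_fst_mem e heU hL)
      obtain ⟨pre, post, rfl⟩ := List.append_of_mem heL
      exact ⟨_, _, by rw [Finset.card_insert_of_notMem he, hU], h.grow h0 h1 he⟩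
  have hV : 0 < Fintype.card V := Fintype.card_pos_iff.mpr ⟨d.1⟩
  obtain ⟨U, L, hU, h⟩ := key (Fintype.card V - 1) (by omega)
  obtain rfl : U = Finset.univ := (Finset.card_eq_iff_eq_univ U).mp (by omega)
  exact ⟨L, h⟩

/-! ### Capping off the edges outside of a spanning tree -/

open Classical in
/-- The states of the regions in `R` that take the values `u` at `r₀` and `v` at `r₁` and are at
most `B` elsewhere, extended by zero. -/
def boundedStates [Fintype V] (r₀ r₁ : G.Face) (u v B : ℤ) (R : Finset G.Face) : Finset (G.Face → ℤ) :=
  Fintype.piFinset fun r =>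
    if r = r₀ then {u} else if r = r₁ then {v} else if r ∈ R then Finset.Icc 0 B else {0}

open Classical in
/-- The sum over the states of the regions in `R` of a function of paths. -/
def pathSum [Fintype V] (A : ℂ) (r₀ r₁ : G.Face) (u v B : ℤ) (R : Finset G.Face) (L : List (V × Fin 3))
    (W : ℤ → List ℤ → ℂ) : ℂ :=
  ∑ s ∈ boundedStates r₀ r₁ u v B R,
    (∏ r ∈ (R.erase r₀).erase r₁, wt A (s r)) * W (s r₀) (G.pathOf s L)

/-- The states with values `u` at `r₀` and `v` at `r₁` are bounded by `B` in the support
of `W`. -/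
def IsBound (r₀ r₁ : G.Face) (u v B : ℤ) (R : Finset G.Face) (L : List (V × Fin 3))
    (W : ℤ → List ℤ → ℂ) : Prop :=
  ∀ s : G.Face → ℤ, s r₀ = u → s r₁ = v → W (s r₀) (G.pathOf s L) ≠ 0 → ∀ r ∈ R, s r ≤ B

theorem pathOf_update_of_forall [DecidableEq G.Face] {s : G.Face → ℤ} {r : G.Face} {m : ℤ}
    {L : List (V × Fin 3)} (h : ∀ d ∈ L, G.face (G.opp d) ≠ r) :
    G.pathOf (Function.update s r m) L = G.pathOf s L :=
  List.map_congr_left fun d hd => Function.update_of_ne (h d hd) _ _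

-- The walk enters the region behind `p` once and leaves at once through `G.opp p`. Its state
-- therefore enters `W` in one place only, and summing it out, with its weight, is the cap.
open Classical in
theorem pathSum_cap [Fintype V] {A : ℂ} {r₀ r₁ : G.Face} {u v B : ℤ} {R : Finset G.Face}
    {pre post : List (V × Fin 3)} {p : V × Fin 3} {W : ℤ → List ℤ → ℂ} {c : G.Edge → ℤ}
    (hlink : G.Link r₀ pre (G.face p))
    (hW : ∀ x σ, W x σ ≠ 0 →
      AdmPath ((pre ++ p :: G.opp p :: post).map fun d => c (G.edge d)) x σ x)
    (hB : IsBound r₀ r₁ u v B R (pre ++ p :: G.opp p :: post) W)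
    (hr : G.face (G.opp p) ∈ R) (hr₀ : G.face (G.opp p) ≠ r₀) (hr₁ : G.face (G.opp p) ≠ r₁)
    (h10 : r₁ ≠ r₀) (hp : G.face p ≠ G.face (G.opp p))
    (hpre : ∀ d ∈ pre, G.face (G.opp d) ≠ G.face (G.opp p))
    (hpost : ∀ d ∈ post, G.face (G.opp d) ≠ G.face (G.opp p)) :
    pathSum A r₀ r₁ u v B R (pre ++ p :: G.opp p :: post) W =
        pathSum A r₀ r₁ u v B (R.erase (G.face (G.opp p))) (pre ++ post)
          (fun x => capFn A (c (G.edge p)) pre.length x (W x)) ∧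
      IsBound r₀ r₁ u v B (R.erase (G.face (G.opp p))) (pre ++ post)
          (fun x => capFn A (c (G.edge p)) pre.length x (W x)) := by
  set r := G.face (G.opp p) with hrdef
  have hpath : ∀ (s : G.Face → ℤ) (m : ℤ),
      G.pathOf (Function.update s r m) (pre ++ p :: G.opp p :: post) =
        G.pathOf s pre ++ m :: s (G.face p) :: G.pathOf s post := by
    intro s m
    have h₁ := pathOf_update_of_forall (s := s) (m := m) hpre
    have h₂ := pathOf_update_of_forall (s := s) (m := m) hpost
    unfold pathOf at h₁ h₂ ⊢
    rw [List.map_append, List.map_cons, List.map_cons, h₁, h₂, opp_opp,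
      Function.update_of_ne hp, ← hrdef, Function.update_self]
  have hcap : ∀ s : G.Face → ℤ, capFn A (c (G.edge p)) pre.length (s r₀) (W (s r₀))
      (G.pathOf s (pre ++ post)) = ∑ m ∈ Finset.Icc 0 (s (G.face p) + c (G.edge p)),
        wt A m * W (s r₀) (G.pathOf (Function.update s r m) (pre ++ p :: G.opp p :: post)) := by
    intro s
    rw [show G.pathOf s (pre ++ post) = G.pathOf s pre ++ G.pathOf s post from List.map_append,
      capFn_pathOf A (c (G.edge p)) s hlink]
    simp only [hpath]
  have hadm : ∀ (s : G.Face → ℤ) (m : ℤ),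
      W (s r₀) (G.pathOf (Function.update s r m) (pre ++ p :: G.opp p :: post)) ≠ 0 →
        AdmTriple (s (G.face p)) m (c (G.edge p)) := by
    intro s m h
    have := hW _ _ h
    rw [hpath, List.map_append, List.map_cons] at this
    exact admTriple_of_admPath s hlink this
  constructor
  · unfold pathSum boundedStates
    rw [sum_piFinset_update _ r, if_neg hr₀, if_neg hr₁, if_pos hr]
    have ht : Function.update (fun r => if r = r₀ then {u} else if r = r₁ then {v} else
        if r ∈ R then Finset.Icc 0 B else {0}) r {0} = fun x : G.Face => if x = r₀ then {u} else
        if x = r₁ then {v} else if x ∈ R.erase r then Finset.Icc 0 B else {0} := by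
      funext x
      by_cases hx : x = r
      · subst hx
        simp [hr₀, hr₁]
      · simp [hx]
    rw [ht]
    refine Finset.sum_congr rfl fun s hs => ?_
    rw [Fintype.mem_piFinset] at hs
    have hs₀ : s r₀ = u := by simpa using hs r₀
    have hs₁ : r₁ ≠ r₀ → s r₁ = v := fun h => by simpa [h] using hs r₁
    have hset : ((R.erase r₀).erase r₁) = insert r (((R.erase r).erase r₀).erase r₁) := by
      ext x
      simp only [Finset.mem_erase, Finset.mem_insert]
      by_cases hx : x = r
      · subst hx
        simp [hr₀, hr₁, hr]
      · simp [hx]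
    have hprod : ∀ m, ∏ x ∈ (R.erase r₀).erase r₁, wt A (Function.update s r m x) =
        wt A m * ∏ x ∈ ((R.erase r).erase r₀).erase r₁, wt A (s x) := by
      intro m
      rw [hset, Finset.prod_insert (by simp), Function.update_self]
      congr 1
      refine Finset.prod_congr rfl fun x hx => ?_
      rw [Function.update_of_ne]
      rintro rfl
      simp at hx
    simp only [hprod]
    rw [hcap, Finset.mul_sum]
    -- The box and the cap sum `m` over different ranges. The summand is supported in both: by the
    -- bound `hB` and by the triangle inequality at the edge of `p`.
    have hzero : ∀ m, W (s r₀) (G.pathOf (Function.update s r m) (pre ++ p :: G.opp p :: post)) ≠ 0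
        → m ∈ Finset.Icc 0 B ∧ m ∈ Finset.Icc 0 (s (G.face p) + c (G.edge p)) := by
      intro m h
      have h₁ := hadm s m h
      have h₁' := admTriple_iff.mp h₁
      have h₂ : m ≤ B := by
        have := hB (Function.update s r m) (by rw [Function.update_of_ne hr₀.symm, hs₀])
          (by rw [Function.update_of_ne hr₁.symm, hs₁ h10])
          (by rwa [Function.update_of_ne hr₀.symm]) r hr
        rwa [Function.update_self] at this
      have := h₁.2.1
      simp only [Finset.mem_Icc]
      omega
    simp only [Function.update_of_ne hr₀.symm]
    rw [← Finset.sum_subset (s₁ := Finset.Icc 0 B ∩ Finset.Icc 0 (s (G.face p) + c (G.edge p)))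
      Finset.inter_subset_left, ← Finset.sum_subset (s₂ := Finset.Icc 0 (s (G.face p) + _))
      (s₁ := Finset.Icc 0 B ∩ Finset.Icc 0 (s (G.face p) + c (G.edge p)))
      Finset.inter_subset_right]
    · refine Finset.sum_congr rfl fun m _ => ?_
      ring
    · intro m _ hm
      rw [by_contra fun h => hm (Finset.mem_inter.mpr (hzero m h))]
      ring
    · intro m _ hm
      rw [by_contra fun h => hm (Finset.mem_inter.mpr (hzero m h))]
      ring
  · intro s hs₀ hs₁ hne x hx
    dsimp only at hne
    rw [hcap] at hne
    obtain ⟨m, -, hm⟩ := Finset.exists_ne_zero_of_sum_ne_zero hne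
    have := hB (Function.update s r m) (by rw [Function.update_of_ne hr₀.symm, hs₀])
      (by rw [Function.update_of_ne hr₁.symm, hs₁])
      (by rw [Function.update_of_ne hr₀.symm]; exact right_ne_zero_of_mul hm) x
      (Finset.mem_of_mem_erase hx)
    rwa [Function.update_of_ne (Finset.ne_of_mem_erase hx)] at this

/-- A closed walk that crosses every dart together with its opposite, and fewer than twice as many
darts as there are regions, has a dead end away from two given adjacent regions, unless it only
goes back and forth between them. -/
theorem exists_dead_end {r₀ r₁ : G.Face} {R : Finset G.Face} {L : List (V × Fin 3)}
    {x : V × Fin 3} (hlink : G.Link r₀ L r₀) (hL : L.Nodup) (hopp : ∀ d ∈ L, G.opp d ∈ L)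
    (hR : ∀ r, r ∈ R ↔ ∃ d ∈ L, G.face d = r) (hlen : L.length = 2 * (R.card - 1)) (hx : x ∈ L)
    (hx₀ : G.face x = r₀) (hx₁ : G.face (G.opp x) = r₁) (h10 : r₁ ≠ r₀) :
    L = [x, G.opp x] ∨
      ∃ y ∈ L, G.face y ≠ r₀ ∧ G.face y ≠ r₁ ∧ ∀ z ∈ L, G.face z = G.face y → z = y := by
  classical
  by_contra! hcon
  obtain ⟨hne, hcon⟩ := hcon
  -- `k r` counts the visits to `r`. Without a dead end all regions except `r₀` and `r₁` are visited
  -- at least twice, and the total `2 (|R| - 1)` then allows one visit each to `r₀` and `r₁`. Such a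
  -- walk can only be `x` followed by its opposite.
  set k : G.Face → ℕ := fun r => (L.toFinset.filter fun d => G.face d = r).card with hk
  have hsum : L.length = ∑ r ∈ R, k r := by
    rw [← List.toFinset_card_of_nodup hL]
    exact Finset.card_eq_sum_card_fiberwise fun d hd =>
      Finset.mem_coe.mpr ((hR _).mpr ⟨d, by simpa using hd, rfl⟩)
  have hpos : ∀ r ∈ R, 1 ≤ k r := by
    intro r hr
    obtain ⟨d, hd, hdr⟩ := (hR r).mp hr
    exact Finset.card_pos.mpr ⟨d, by simp [hd, hdr]⟩
  have htwo : ∀ r ∈ (R.erase r₀).erase r₁, 2 ≤ k r := by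
    intro r hr
    simp only [Finset.mem_erase] at hr
    obtain ⟨d, hd, rfl⟩ := (hR r).mp hr.2.2
    obtain ⟨z, hz, hzd, hne⟩ := hcon d hd hr.2.1 hr.1
    exact Finset.one_lt_card.mpr ⟨z, by simp [hz, hzd], d, by simp [hd], hne⟩
  have hr₀ : r₀ ∈ R := (hR _).mpr ⟨x, hx, hx₀⟩
  have hr₁ : r₁ ∈ R := (hR _).mpr ⟨_, hopp x hx, hx₁⟩
  have hr₁' : r₁ ∈ R.erase r₀ := Finset.mem_erase.mpr ⟨h10, hr₁⟩
  have hrest : ((R.erase r₀).erase r₁).card • 2 ≤ ∑ r ∈ (R.erase r₀).erase r₁, k r :=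
    Finset.card_nsmul_le_sum _ _ _ htwo
  rw [← Finset.add_sum_erase _ _ hr₀, ← Finset.add_sum_erase _ _ hr₁'] at hsum
  have hc₁ := Finset.card_erase_of_mem hr₁'
  have hc₀ := Finset.card_erase_of_mem hr₀
  have hcard : 2 ≤ R.card := Finset.one_lt_card.mpr ⟨r₁, hr₁, r₀, hr₀, h10⟩
  have hp₀ := hpos _ hr₀
  have hp₁ := hpos _ hr₁
  rw [smul_eq_mul] at hrest
  have hk₀ : k r₀ = 1 := by omega
  have hk₁ : k r₁ = 1 := by omega
  have hu : ∀ r, k r = 1 → ∀ d ∈ L, ∀ e ∈ L, G.face d = r → G.face e = r → d = e :=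
    fun r hr d hd e he hdr her =>
      Finset.card_le_one.mp hr.le d (by simp [hd, hdr]) e (by simp [he, her])
  have hu₀ := hu _ hk₀
  have hu₁ := hu _ hk₁
  match L, hlink with
  | [], _ => exact absurd hx (by simp)
  | [d], h => exact h10 (by
      obtain rfl : x = d := by simpa using hx
      exact hx₁.symm.trans h.2)
  | d :: e :: L', h =>
    obtain rfl : d = x := hu₀ d (by simp) x hx h.1 hx₀
    obtain rfl : e = G.opp d := hu₁ e (by simp) _ (hopp d hx) (h.2.1.trans hx₁) hx₁
    match L', h.2.2 with
    | [], _ => exact hne rfl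
    | f :: L'', h' =>
      have : f = d := hu₀ f (by simp) d hx (by rw [h'.1, G.opp_opp, hx₀]) hx₀
      subst this
      simp at hL

/-- Capping off a closed walk across the edges outside of a spanning tree until it goes back and
forth across one edge. -/
theorem exists_isFlat_pair [Fintype V] {A : ℂ} (h0 : 0 < ‖A‖) (h1 : ‖A‖ < 1) (c : G.Edge → ℤ)
    {r₀ r₁ : G.Face} {x : V × Fin 3} (hx₀ : G.face x = r₀) (hx₁ : G.face (G.opp x) = r₁)
    (h10 : r₁ ≠ r₀) {R : Finset G.Face} {L : List (V × Fin 3)} {W : ℤ → List ℤ → ℂ}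
    (hlink : G.Link r₀ L r₀) (hL : L.Nodup) (hopp : ∀ d ∈ L, G.opp d ∈ L)
    (hR : ∀ r, r ∈ R ↔ ∃ d ∈ L, G.face d = r) (hlen : L.length = 2 * (R.card - 1)) (hx : x ∈ L)
    (hW : IsFlat A (L.map fun d => c (G.edge d)) W) :
    ∃ W', IsFlat A [c (G.edge x), c (G.edge x)] W' ∧ ∀ u v B, IsBound r₀ r₁ u v B R L W →
      pathSum A r₀ r₁ u v B R L W = W' u [v, u] := by
  classical
  induction hn : L.length using Nat.strong_induction_on generalizing R L W with
  | _ n ih =>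
  rcases exists_dead_end hlink hL hopp hR hlen hx hx₀ hx₁ h10 with
    rfl | ⟨y, hy, hy₀, hy₁, hyu⟩
  · refine ⟨W, by simpa [edge_opp] using hW, fun u v B _ => ?_⟩
    obtain rfl : R = {r₀, r₁} := by
      ext r
      rw [hR]
      simp [hx₀, hx₁, eq_comm]
    have hs : boundedStates r₀ r₁ u v B {r₀, r₁} =
        {fun r => if r = r₀ then u else if r = r₁ then v else 0} := by
      unfold boundedStates
      rw [← Fintype.piFinset_singleton]
      congr 1
      funext r
      by_cases hr : r = r₀
      · simp [hr]
      · by_cases hr' : r = r₁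
        · simp [hr', h10]
        · simp [hr, hr']
    have he : ((({r₀, r₁} : Finset G.Face).erase r₀).erase r₁) = ∅ := by
      ext r
      simp only [Finset.mem_erase, Finset.mem_insert, Finset.mem_singleton, Finset.notMem_empty]
      tauto
    unfold pathSum
    rw [hs, Finset.sum_singleton, he]
    simp [pathOf, G.opp_opp, hx₀, hx₁, h10]
  · obtain ⟨pre', post, rfl⟩ := List.append_of_mem hy
    obtain ⟨f, hpre', hf, hpost⟩ := (link_append G).mp hlink
    rcases List.eq_nil_or_concat' pre' with rfl | ⟨pre, p, rfl⟩
    · exact absurd (hf.trans hpre'.symm) hy₀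
    obtain ⟨g, hpre, hg, hpf⟩ := (link_append G).mp hpre'
    have hpf : G.face (G.opp p) = f := hpf
    subst hg
    have hmem : ∀ d, d ∈ pre ++ [p] ++ y :: post ↔ d ∈ pre ++ post ∨ d = p ∨ d = y := by
      intro d
      simp only [List.mem_append, List.mem_cons, List.not_mem_nil, or_false]
      tauto
    -- The opposite of the dart `p` before `y` lies in the list and in the region of `y`. Since `y`
    -- is the only such dart, the walk enters and leaves the dead end through the same edge.
    obtain rfl : G.opp p = y :=
      hyu _ (hopp p ((hmem p).mpr (by simp))) (hpf.trans hf.symm)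
    have hLe : pre ++ [p] ++ G.opp p :: post = pre ++ p :: G.opp p :: post := by simp
    have hL' := hL
    rw [hLe, List.nodup_middle, List.nodup_cons, List.nodup_middle, List.nodup_cons] at hL'
    obtain ⟨hp, hop, hnd⟩ := hL'
    have hp' : p ∉ pre ++ post := fun h => hp (by
      simp only [List.mem_append, List.mem_cons] at h ⊢
      tauto)
    have hunique : ∀ d ∈ pre ++ post, G.face (G.opp d) ≠ G.face (G.opp p) := fun d hd he =>
      hp' (G.opp.injective (hyu _ (hopp d ((hmem d).mpr (Or.inl hd))) he) ▸ hd)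
    have hpne : G.face p ≠ G.face (G.opp p) := fun h =>
      G.opp_ne p (hyu p ((hmem p).mpr (by simp)) h).symm
    have hx' : x ∈ pre ++ post := by
      rcases (hmem x).mp hx with h | rfl | rfl
      · exact h
      · exact absurd hx₁ hy₁
      · exact absurd hx₀ hy₀
    have hpost' : G.Link (G.face p) post r₀ := by rwa [G.opp_opp] at hpost
    have hrR : G.face (G.opp p) ∈ R := (hR _).mpr ⟨_, hy, rfl⟩
    rw [hLe] at hW hlen hn
    have hcap := IsFlat.cap (A := A) h0 h1 (c := c (G.edge p))
      (pre := pre.map fun d => c (G.edge d)) (post := post.map fun d => c (G.edge d)) (W := W)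
      (by simpa [edge_opp] using hW)
    rw [List.length_map, ← List.map_append] at hcap
    simp only [List.length_append, List.length_cons] at hn hlen
    obtain ⟨W', hW', hsum⟩ := ih (pre ++ post).length (by simp; omega)
      (R := R.erase (G.face (G.opp p))) (L := pre ++ post)
      ((link_append G).mpr ⟨_, hpre, hpost'⟩) hnd (by
        intro d hd
        rcases (hmem _).mp (hopp d ((hmem d).mpr (Or.inl hd))) with h | h | h
        · exact h
        · rw [← h, G.opp_opp] at hop
          exact absurd hd hop
        · exact absurd (G.opp.injective h ▸ hd) hp') (by
        intro r
        rw [Finset.mem_erase, hR]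
        constructor
        · rintro ⟨hr, d, hd, rfl⟩
          rcases (hmem d).mp hd with h | rfl | rfl
          · exact ⟨d, h, rfl⟩
          · exact exists_face_eq_of_link G hpre hpost' (List.ne_nil_of_mem hx')
          · exact absurd rfl hr
        · rintro ⟨d, hd, rfl⟩
          have hd' := (hmem d).mpr (Or.inl hd)
          exact ⟨fun h => hop (hyu d hd' h ▸ hd), d, hd', rfl⟩) (by
        rw [Finset.card_erase_of_mem hrR, List.length_append]
        omega) hx' hcap rfl
    refine ⟨W', hW', fun u v B hB => ?_⟩
    rw [hLe] at hB ⊢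
    obtain ⟨e₁, e₂⟩ := pathSum_cap (c := c) hpre hW.supp hB hrR hy₀ hy₁ h10 hpne
      (fun d hd => hunique d (List.mem_append_left _ hd))
      (fun d hd => hunique d (List.mem_append_right _ hd))
    rw [e₁, hsum u v B e₂]

/-! ### Independence of the bracket from the distinguished region -/

theorem face_eq_of_link {r e : G.Face} {L : List (V × Fin 3)} (h : G.Link r L e)
    (hL : ∀ d ∈ L, G.face d = r → G.face (G.opp d) = r) : ∀ d ∈ L, G.face d = r := by
  induction L with
  | nil => simp
  | cons d L ih =>
    have hd := hL d (by simp) h.1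
    have h2 := h.2
    rw [hd] at h2
    intro d' hd'
    rcases List.mem_cons.mp hd' with rfl | hd'
    · exact h.1
    · exact ih h2 (fun d hd => hL d (by simp [hd])) d' hd'

theorem Admissible.nonneg {c : G.Edge → ℤ} (hc : G.Admissible c) (d : V × Fin 3) :
    0 ≤ c (G.edge d) := by
  obtain ⟨v, i⟩ := d
  obtain ⟨h₀, h₁, h₂, -⟩ := hc v
  match i with
  | 0 => exact h₀
  | 1 => exact h₁
  | 2 => exact h₂

-- This is used with `q` equal to `r₀` or `r₁`. State 0 on one side of an edge forces the state on
-- the other side to be the colour of the edge. Both states are thus fixed, their weights factor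
-- out, and the rest of the bracket is a path sum.
open Classical in
theorem sum_weight_eq_pathSum [Fintype V] {A : ℂ} (h0 : 0 < ‖A‖)
    (h1 : ‖A‖ < 1) {c : G.Edge → ℤ} {L : List (V × Fin 3)} {W : ℤ → List ℤ → ℂ}
    {r₀ r₁ q : G.Face} {u v B : ℤ} (h10 : r₁ ≠ r₀)
    (hs : ∀ s : G.Face → ℤ, W (s r₀) (G.pathOf s L) = ∏ v, G.vertexWeight A c s v)
    (hB : ∀ s, G.IsShadowState c q s → ∀ r, s r ≤ B) (hu : 0 ≤ u ∧ u ≤ B) (hv : 0 ≤ v ∧ v ≤ B)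
    (hq : ∀ s, G.IsShadowState c q s → s r₀ = u ∧ s r₁ = v)
    (hq' : ∀ s : G.Face → ℤ, s r₀ = u → s r₁ = v → s q = 0) :
    (∑ s ∈ Fintype.piFinset fun _ : G.Face => Finset.Icc 0 B,
        if s q = 0 then G.weight A c s else 0) =
      wt A u * wt A v * pathSum A r₀ r₁ u v B Finset.univ L W ∧
    IsBound r₀ r₁ u v B Finset.univ L W := by
  constructor
  · have hsub : boundedStates r₀ r₁ u v B Finset.univ ⊆
        Fintype.piFinset fun _ : G.Face => Finset.Icc 0 B := by
      unfold boundedStates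
      refine Fintype.piFinset_subset _ _ fun r => ?_
      split_ifs
      · simpa using hu
      · simpa using hv
      · exact subset_rfl
      · simp at *
    rw [← Finset.sum_subset hsub]
    · unfold pathSum
      rw [Finset.mul_sum]
      refine Finset.sum_congr rfl fun s hsm => ?_
      have hsm := Fintype.mem_piFinset.mp hsm
      have hs₀ : s r₀ = u := by simpa using hsm r₀
      have hs₁ : s r₁ = v := by simpa [h10] using hsm r₁
      rw [if_pos (hq' s hs₀ hs₁), hs, weight_eq, ← Finset.mul_prod_erase _ _ (Finset.mem_univ r₀),
        ← Finset.mul_prod_erase _ _ (Finset.mem_erase.mpr ⟨h10, Finset.mem_univ r₁⟩), hs₀, hs₁]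
      ring
    · intro s hsm hns
      by_contra hne
      rw [ite_eq_right_iff, Classical.not_imp] at hne
      have hstate : G.IsShadowState c q s := ⟨hne.1, G.admTriple_of_weight_ne_zero h0 h1 hne.2⟩
      obtain ⟨hs₀, hs₁⟩ := hq s hstate
      refine hns (Fintype.mem_piFinset.mpr fun r => ?_)
      have := Fintype.mem_piFinset.mp hsm r
      split_ifs with hr hr'
      · simp [hr, hs₀]
      · simp [hr', hs₁]
      · exact this
      · simp at *
  · intro s hs₀ hs₁ hne r _
    rw [hs] at hne
    refine hB s ⟨hq' s hs₀ hs₁, fun d => ?_⟩ r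
    exact G.admTriple_of_vertexWeight_ne_zero h0 h1
      (Finset.prod_ne_zero_iff.mp hne d.1 (Finset.mem_univ _))

/-- The bracket does not change if the distinguished region is replaced by a suitable neighbour. -/
theorem exists_bracket_eq [Fintype V] {A : ℂ} (h0 : 0 < ‖A‖) (h1 : ‖A‖ < 1) (hG : G.IsSpherical)
    (r₀ : G.Face) : ∃ r₁ ≠ r₀, ∀ c, G.bracket r₀ c A = G.bracket r₁ c A := by
  classical
  obtain ⟨L, hL⟩ := exists_isTreeBoundary h0 h1 hG.1 r₀
  have hopp : ∀ d ∈ L, G.opp d ∈ L := by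
    intro d hd
    by_contra hn
    have := hL.opp_notMem (G.opp d) (Finset.mem_univ _) hn
    rw [opp_opp] at this
    exact this hd
  have hR : ∀ r, r ∈ (Finset.univ : Finset G.Face) ↔ ∃ d ∈ L, G.face d = r := by
    intro r
    obtain ⟨d, rfl⟩ := Quotient.exists_rep r
    exact ⟨fun _ => hL.exists_face d (Finset.mem_univ _), fun _ => Finset.mem_univ _⟩
  -- Here the sphere enters: `2E = 3V` and `V + F = E + 2` give `V + 2 = 2 (F - 1)`.
  have hlen : L.length = 2 * ((Finset.univ : Finset G.Face).card - 1) := by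
    have h₁ := hL.length
    have h₂ := hG.2
    have h₃ := G.two_mul_card_edge
    rw [Nat.card_eq_fintype_card, Nat.card_eq_fintype_card, Nat.card_eq_fintype_card] at h₂
    rw [Finset.card_univ] at h₁ ⊢
    omega
  -- A walk that never left `r₀` would make `r₀` the only region, and then `hlen` would make the
  -- list empty.
  obtain ⟨x, hx, hx₀, h10⟩ : ∃ x ∈ L, G.face x = r₀ ∧ G.face (G.opp x) ≠ r₀ := by
    by_contra! hcon
    have hall := face_eq_of_link hL.link hcon
    have : (Finset.univ : Finset G.Face).card ≤ 1 := by
      refine Finset.card_le_one.mpr fun a ha b hb => ?_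
      obtain ⟨d, hd, rfl⟩ := (hR a).mp ha
      obtain ⟨e, he, rfl⟩ := (hR b).mp hb
      rw [hall d hd, hall e he]
    have := hL.length
    omega
  -- The neighbour is chosen before the colouring, so one `r₁` serves `c` and all its perturbations.
  refine ⟨_, h10, fun c => ?_⟩
  set r₁ := G.face (G.opp x) with hx₁
  by_cases hc : G.Admissible c
  swap
  · rw [G.bracket_of_not_admissible A hc, G.bracket_of_not_admissible A hc]
  obtain ⟨W, hW, hs⟩ := hL.exists_flat c
  obtain ⟨W', hW', hsum⟩ := exists_isFlat_pair h0 h1 c hx₀ hx₁.symm h10 hL.link hL.nodup hopp hR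
    hlen hx hW
  obtain ⟨B₀, hB₀, e₀⟩ := G.bracket_eq_sum h0 h1 hG.1 c r₀
  obtain ⟨B₁, hB₁, e₁⟩ := G.bracket_eq_sum h0 h1 hG.1 c r₁
  have ha := hc.nonneg x
  obtain ⟨B, hB, hB', hB''⟩ : ∃ B, B₀ ≤ B ∧ B₁ ≤ B ∧ c (G.edge x) ≤ B :=
    ⟨max (max B₀ B₁) (c (G.edge x)), by omega, by omega, by omega⟩
  have key : ∀ s q, G.IsShadowState c q s → AdmTriple (s r₀) (s r₁) (c (G.edge x)) := by
    intro s q h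
    rw [← hx₀]
    exact h.2 x
  obtain ⟨f₀, b₀⟩ := sum_weight_eq_pathSum h0 h1 (c := c) (q := r₀) (u := 0) (v := c (G.edge x))
    h10 hs (fun s h r => (hB₀ s h r).trans hB) ⟨le_rfl, ha.trans hB''⟩ ⟨ha, hB''⟩ (fun s h => by
      have := admTriple_iff.mp (key s _ h)
      have h' := h.1
      omega) (fun s h _ => h)
  obtain ⟨f₁, b₁⟩ := sum_weight_eq_pathSum h0 h1 (c := c) (q := r₁) (u := c (G.edge x)) (v := 0)
    h10 hs (fun s h r => (hB₁ s h r).trans hB') ⟨ha, hB''⟩ ⟨le_rfl, ha.trans hB''⟩ (fun s h => by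
      have := admTriple_iff.mp (key s _ h)
      have h' := h.1
      omega) (fun s _ h => h)
  -- The same flat function `W'` computes both brackets, at the states `(0, c)` and `(c, 0)` of
  -- `(r₀, r₁)`.
  rw [e₀ _ fun _ => Finset.Icc_subset_Icc le_rfl hB,
    e₁ _ fun _ => Finset.Icc_subset_Icc le_rfl hB', f₀, f₁, hsum _ _ _ b₀, hsum _ _ _ b₁, hW'.pair_symm h0 h1 ha]
  ring

end CubicMap

/-! ### Transfer of perturbations along a chain of vertices -/

/-- Sums over sequences of signs `ε₀, …, ε` of length `m + 1` of products of functions of two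
consecutive signs. -/
def chain (T : ℕ → ℤˣ → ℤˣ → ℂ) (ε₀ : ℤˣ) : ℕ → ℤˣ → ℂ
  | 0, ε => if ε = ε₀ then 1 else 0
  | m + 1, ε' => ∑ ε, chain T ε₀ m ε * T m ε ε'

/-- The sum over perturbations with prescribed end values is an entry of a product of transfer
matrices, which can be evaluated one vertex at a time. -/
theorem sum_prod_eq_chain (T : ℕ → ℤˣ → ℤˣ → ℂ) (ε₀ ε : ℤˣ) (m : ℕ) :
    (∑ g : Fin (m + 1) → ℤˣ, if g 0 = ε₀ ∧ g (Fin.last m) = ε then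
      ∏ i : Fin m, T i (g i.castSucc) (g i.succ) else 0) = chain T ε₀ m ε := by
  induction m generalizing ε with
  | zero =>
    rw [← (Equiv.funUnique (Fin 1) ℤˣ).symm.sum_comp]
    simp only [chain, Finset.univ_eq_empty, Finset.prod_empty]
    rw [Finset.sum_eq_single ε (fun b _ hb => if_neg fun h => hb h.2)
      fun h => absurd (Finset.mem_univ _) h]
    simp
  | succ m ih =>
    rw [← (Fin.snocEquiv fun _ : Fin (m + 2) => ℤˣ).sum_comp, Fintype.sum_prod_type]
    have h : ∀ x : ℤˣ, (∑ y : Fin (m + 1) → ℤˣ,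
        if (Fin.snocEquiv fun _ : Fin (m + 2) => ℤˣ) (x, y) 0 = ε₀ ∧
            (Fin.snocEquiv fun _ : Fin (m + 2) => ℤˣ) (x, y) (Fin.last (m + 1)) = ε then
          ∏ i : Fin (m + 1), T i ((Fin.snocEquiv fun _ : Fin (m + 2) => ℤˣ) (x, y) i.castSucc)
            ((Fin.snocEquiv fun _ : Fin (m + 2) => ℤˣ) (x, y) i.succ) else 0) =
        if x = ε then ∑ z, chain T ε₀ m z * T m z x else 0 := by
      intro x
      have h₀ : ∀ y : Fin (m + 1) → ℤˣ,
          (Fin.snoc y x : Fin (m + 2) → ℤˣ) 0 = y 0 := fun y => by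
        rw [← Fin.castSucc_zero, Fin.snoc_castSucc]
      simp only [Fin.snocEquiv, Equiv.coe_fn_mk, Fin.snoc_last, Fin.snoc_castSucc, h₀,
        Fin.prod_univ_castSucc, Fin.succ_last, ← Fin.castSucc_succ]
      split_ifs with hx
      · simp only [← ih, Finset.sum_mul]
        rw [Finset.sum_comm]
        refine Finset.sum_congr rfl fun y _ => ?_
        rw [Finset.sum_eq_single (y (Fin.last m))]
        · by_cases hy : y 0 = ε₀
          · simp [hy, hx]
          · simp [hy]
        · intro z _ hz
          rw [if_neg fun h => hz h.2.symm, zero_mul]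
        · exact fun h => absurd (Finset.mem_univ _) h
      · exact Finset.sum_eq_zero fun y _ => if_neg fun h => hx h.2
    rw [Finset.sum_congr rfl fun x _ => h x, Finset.sum_ite_eq' Finset.univ ε,
      if_pos (Finset.mem_univ _)]
    rfl

theorem sum_units (y : ℤ) (f : ℤ → ℂ) : ∑ ε : ℤˣ, f (y + ε) = adjSum y f := by
  rw [UnitsInt.univ, Finset.sum_pair (by decide)]
  rfl

theorem adj_add_units (y : ℤ) (ε : ℤˣ) : Adj y (y + ε) := by
  rcases Int.units_eq_one_or ε with rfl | rfl
  · exact Or.inl rfl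
  · exact Or.inr rfl

section

variable {A : ℂ} (h0 : 0 < ‖A‖) (h1 : ‖A‖ < 1)

include h0 h1

theorem tet_swap_flip (a b c d e f : ℤ) : tet A a b c d e f = tet A e d c b a f := by
  rw [tet_rotate h0 h1, tet_rotate h0 h1, tet_flip h0 h1, tet_rotate h0 h1, tet_swap h0 h1]

/-- The pentagon identity at a vertex between two perturbed edges. -/
theorem tet_mul_tet (b w w' u : ℤ) {x y x' y' : ℤ} (hx : Adj x x') (hy : Adj y y') :
    tet A x y b w' w u * tet A x y b y' x' 1 = adjSum u fun u' =>
      wt A u' * tet A x' y' b w' w u' * rho A w x u x' u' * rho A w' y u y' u' := by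
  have h := pentagon h0 h1 (a := w) (b := w') (c := b) (f := u) hy hx
  have e : tet A x y b y' x' 1 = rho A b y x y' x' := by
    rw [rho, tet_flip h0 h1 y, tet_swap h0 h1]
  rw [tet_swap_flip h0 h1, e, h]
  simp only [adjSum, tet_swap_flip h0 h1 x' y']
  ring

variable (a b w : ℕ → ℤ)

/-- The sum over the perturbations of a chain of edges, for fixed states of the regions. -/
theorem chain_eq (ε₀ : ℤˣ) {u : ℤ} (hu : 0 ≤ u) (m : ℕ) (ε : ℤˣ) :
    chain (fun i ε ε' => (if i = 0 then 1 else wt A (a i + ε)) *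
        (tet A (a i) (a (i + 1)) (b i) (a (i + 1) + ε') (a i + ε) 1 *
          tet A (a i + ε) (a (i + 1) + ε') (b i) (w (i + 1)) (w i) u)) ε₀ (m + 1) ε =
      adjSum u fun v => wt A v *
        (∏ i ∈ Finset.range (m + 1), tet A (a i) (a (i + 1)) (b i) (w (i + 1)) (w i) v) *
          rho A (w 0) (a 0) v (a 0 + ε₀) u * rho A (w (m + 1)) (a (m + 1)) v (a (m + 1) + ε) u := by
  -- The pentagon identity at vertex `i`, with the perturbed colours as the starting colours,
  -- returns the unperturbed vertex.
  have step : ∀ i (ε ε' : ℤˣ), tet A (a i) (a (i + 1)) (b i) (a (i + 1) + ε') (a i + ε) 1 *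
      tet A (a i + ε) (a (i + 1) + ε') (b i) (w (i + 1)) (w i) u = adjSum u fun v =>
        wt A v * tet A (a i) (a (i + 1)) (b i) (w (i + 1)) (w i) v *
          rho A (w i) (a i) v (a i + ε) u *
          rho A (w (i + 1)) (a (i + 1)) v (a (i + 1) + ε') u := by
    intro i ε ε'
    rw [mul_comm, tet_swap_flip h0 h1 (a i), tet_mul_tet h0 h1 _ _ _ _ (adj_add_units _ _).symm
      (adj_add_units _ _).symm]
    refine adjSum_congr fun v _ => ?_
    rw [rho_symm h0 h1 (w i), rho_symm h0 h1 (w (i + 1))]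
  induction m generalizing ε with
  | zero =>
    rw [chain, Finset.sum_eq_single ε₀]
    · rw [chain, if_pos rfl, if_pos rfl, one_mul, one_mul, step]
      simp
    · intro z _ hz
      rw [chain, if_neg hz, zero_mul]
    · exact fun h => absurd (Finset.mem_univ _) h
  | succ m ih =>
    rw [chain]
    simp only [ih]
    simp only [step, if_neg (Nat.succ_ne_zero m)]
    rw [sum_units (a (m + 1)) fun z => (adjSum u fun v => wt A v *
        (∏ i ∈ Finset.range (m + 1), tet A (a i) (a (i + 1)) (b i) (w (i + 1)) (w i) v) *
          rho A (w 0) (a 0) v (a 0 + ε₀) u * rho A (w (m + 1)) (a (m + 1)) v z u) *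
        (wt A z * adjSum u fun v => wt A v *
          tet A (a (m + 1)) (a (m + 1 + 1)) (b (m + 1)) (w (m + 1 + 1)) (w (m + 1)) v *
          rho A (w (m + 1)) (a (m + 1)) v z u *
          rho A (w (m + 1 + 1)) (a (m + 1 + 1)) v (a (m + 1 + 1) + ε) u)]
    simp only [adjSum_mul, mul_adjSum]
    rw [adjSum_comm]
    refine adjSum_congr fun v hv => ?_
    rw [adjSum_comm]
    trans adjSum u fun v' => if v = v' then wt A v * ((∏ i ∈ Finset.range (m + 1 + 1),
        tet A (a i) (a (i + 1)) (b i) (w (i + 1)) (w i) v) *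
        rho A (w 0) (a 0) v (a 0 + ε₀) u) *
        rho A (w (m + 1 + 1)) (a (m + 1 + 1)) v (a (m + 1 + 1) + ε) u else 0
    · refine adjSum_congr fun v' hv' => ?_
      -- The sum over the perturbed colour of the edge shared by the chain and the new vertex is an
      -- orthogonality sum, and it identifies the state `v'` of the chain with the state `v` of the
      -- new vertex.
      have orth := adjSum_rho_mul_rho h0 h1 (w (m + 1)) (a (m + 1)) hv'.symm hv.symm hu
      simp only [rho_swap h0 h1 (w (m + 1)) _ (a (m + 1))] at orth
      trans (∏ i ∈ Finset.range (m + 1), tet A (a i) (a (i + 1)) (b i) (w (i + 1)) (w i) v') *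
          rho A (w 0) (a 0) v' (a 0 + ε₀) u * wt A v *
          tet A (a (m + 1)) (a (m + 1 + 1)) (b (m + 1)) (w (m + 1 + 1)) (w (m + 1)) v *
          rho A (w (m + 1 + 1)) (a (m + 1 + 1)) v (a (m + 1 + 1) + ε) u *
          (wt A v' * adjSum (a (m + 1)) fun y' => wt A y' *
            rho A (w (m + 1)) (a (m + 1)) v' y' u * rho A (w (m + 1)) (a (m + 1)) v y' u)
      · simp only [mul_adjSum]
        refine adjSum_congr fun z _ => ?_
        ring
      rw [orth]
      by_cases hvv : v = v'
      · subst hvv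
        rw [if_pos rfl, Finset.prod_range_succ _ (m + 1)]
        by_cases hadm : AdmTriple v (a (m + 1)) (w (m + 1))
        · rw [if_pos ⟨rfl, hadm⟩]
          ring
        · rw [if_neg fun h => hadm h.2, tet_of_not (a := a (m + 1)) fun h => hadm
            (admTriple_rotate.mp (admTriple_rotate.mp h.2.1))]
          ring
      · rw [if_neg hvv, if_neg fun h => hvv h.1.symm, mul_zero]
    · rw [adjSum_ite hv]
      ring

/-- The circle recursion for fixed states of all regions but one. -/
theorem sum_wt_mul_chain {N : ℤ} {m : ℕ} (hm : m ≠ 0) (ha : a (m + 1) = a 0) (hw : w (m + 1) = w 0)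
    (hN : a 0 + w 0 + 1 ≤ N) (ε₀ ε₁ : ℤˣ) :
    (∑ u ∈ Finset.Icc 0 N, wt A u * (chain (fun i ε ε' => (if i = 0 then 1 else wt A (a i + ε)) *
        (tet A (a i) (a (i + 1)) (b i) (a (i + 1) + ε') (a i + ε) 1 *
          tet A (a i + ε) (a (i + 1) + ε') (b i) (w (i + 1)) (w i) u)) ε₀ m ε₁ *
        tet A (a m + ε₁) (a (m + 1) + ε₀) (b m) (w (m + 1)) (w m) u)) =
      tet A (a m) (a (m + 1)) (b m) (a (m + 1) + ε₀) (a m + ε₁) 1 *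
        ∑ u ∈ Finset.Icc 0 N, wt A u *
          ∏ i ∈ Finset.range (m + 1), tet A (a i) (a (i + 1)) (b i) (w (i + 1)) (w i) u := by
  obtain ⟨m, rfl⟩ := Nat.exists_eq_succ_of_ne_zero hm
  trans ∑ u ∈ Finset.Icc 0 N, adjSum u fun v => wt A u * (wt A v *
        (∏ i ∈ Finset.range (m + 1), tet A (a i) (a (i + 1)) (b i) (w (i + 1)) (w i) v) *
          rho A (w 0) (a 0) v (a 0 + ε₀) u * rho A (w (m + 1)) (a (m + 1)) v (a (m + 1) + ε₁) u *
        tet A (a (m + 1) + ε₁) (a (m + 1 + 1) + ε₀) (b (m + 1)) (w (m + 1 + 1)) (w (m + 1)) u)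
  · refine Finset.sum_congr rfl fun u hu => ?_
    rw [Nat.succ_eq_add_one, chain_eq h0 h1 a b w ε₀ (Finset.mem_Icc.mp hu).1 m ε₁,
      adjSum_mul, mul_adjSum]
  -- For fixed `v`, the two open crossings of the chain and the perturbed last vertex, summed over
  -- `u`, form the right side of `tet_mul_tet`.
  rw [sum_adjSum_comm (M' := N), Finset.mul_sum]
  · refine Finset.sum_congr rfl fun v _ => ?_
    have := tet_mul_tet h0 h1 (b (m + 1)) (w (m + 1)) (w (m + 1 + 1)) v
      (adj_add_units (a (m + 1)) ε₁) (adj_add_units (a (m + 1 + 1)) ε₀)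
    rw [Nat.succ_eq_add_one, Finset.prod_range_succ _ (m + 1)]
    trans wt A v * (∏ i ∈ Finset.range (m + 1), tet A (a i) (a (i + 1)) (b i) (w (i + 1)) (w i) v) *
      (tet A (a (m + 1)) (a (m + 1 + 1)) (b (m + 1)) (w (m + 1 + 1)) (w (m + 1)) v *
        tet A (a (m + 1)) (a (m + 1 + 1)) (b (m + 1)) (a (m + 1 + 1) + ε₀) (a (m + 1) + ε₁) 1)
    · rw [this, mul_adjSum]
      refine adjSum_congr fun u _ => ?_
      rw [← ha, ← hw]
      ring
    · ring
  -- The crossing of the first edge bounds `v` by `a 0 + w 0` and `u` by one more; hence the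
  -- requirement on `N`.
  · intro u v _ hne
    have hr : rho A (w 0) (a 0) v (a 0 + ε₀) u ≠ 0 := fun h => hne (by rw [h]; ring)
    obtain ⟨h₁, h₂⟩ := nonneg_of_rho_ne_zero hr
    have h₁' := admTriple_iff.mp h₁
    have h₂' := admTriple_iff.mp h₂
    have := adj_add_units (a 0) ε₀
    have p₁ := h₁.2.1
    have p₂ := h₂.2.1
    unfold Adj at this
    omega

/-- A quotient of tetrahedra as a product. -/
theorem tet_div_tet (a a₁ a' a₁' b : ℤ) : tet A a a₁ b a₁' a' 1 / tet A a' a₁' b a₁' a' 0 =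
    tet A a a₁ b a₁' a' 1 * (sqrtWt A a' * sqrtWt A a₁') := by
  by_cases h : AdmTriple a' a₁' b
  · have := tet_zero_mul h0 h1 h
    rw [div_eq_iff (left_ne_zero_of_mul (this.trans_ne one_ne_zero)), mul_assoc, mul_comm (_ * _),
      this, mul_one]
  -- The numerator contains the same triple, so it vanishes as well and the convention `𝕍 = 0` is
  -- respected.
  · rw [tet_of_not (a := a) fun g => h (admTriple_comm.mp g.2.2.2), zero_div, zero_mul]

end
namespace CubicMap

variable {V : Type*} (G : CubicMap V)

/-! ### The boundary of a region -/

/-- The darts of the boundary walk of the region to the right of `d`. -/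
def bDart (d : V × Fin 3) (i : ℕ) : V × Fin 3 := (G.next ^ i) d

theorem bDart_succ (d : V × Fin 3) (i : ℕ) : G.bDart d (i + 1) = rot (G.opp (G.bDart d i)) := by
  unfold bDart
  rw [pow_succ']
  rfl

theorem face_bDart (d : V × Fin 3) (i : ℕ) : G.face (G.bDart d i) = G.face d := by
  induction i with
  | zero => rfl
  | succ i ih =>
    rw [← ih, bDart_succ]
    exact G.face_next _

theorem bDart_faceLength (d : V × Fin 3) : G.bDart d (G.faceLength d) = d := by
  unfold bDart faceLength
  rw [← Equiv.Perm.iterate_eq_pow, Function.iterate_minimalPeriod]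

theorem exists_bDart_eq [Finite V] {d x : V × Fin 3} (hx : G.face x = G.face d)
    (hp : 0 < G.faceLength d) : ∃ i < G.faceLength d, x = G.bDart d i := by
  obtain ⟨i, hi⟩ := Equiv.Perm.SameCycle.exists_nat_pow_eq (Quotient.exact hx.symm)
  refine ⟨i % G.faceLength d, Nat.mod_lt _ hp, ?_⟩
  rw [← hi, bDart, faceLength, ← Equiv.Perm.iterate_eq_pow, ← Equiv.Perm.iterate_eq_pow,
    Function.iterate_mod_minimalPeriod_eq]

theorem bDart_injOn (d : V × Fin 3) {i j : ℕ} (hi : i < G.faceLength d) (hj : j < G.faceLength d)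
    (h : G.bDart d i = G.bDart d j) : i = j := by
  unfold bDart at h
  rw [← Equiv.Perm.iterate_eq_pow, ← Equiv.Perm.iterate_eq_pow] at h
  exact (Function.iterate_eq_iterate_iff_of_lt_minimalPeriod hi hj).mp h

variable {G}

/-- Otherwise the opposite dart and the next boundary dart would be two distinct darts of the walk
at one vertex. Hence `D` lies on only one side of each boundary edge, and its state can be varied
alone. -/
theorem face_opp_bDart_ne {d : V × Fin 3} (hd : G.IsEmbeddedFace d) (i : ℕ) :
    G.face (G.opp (G.bDart d i)) ≠ G.face d := by
  intro h
  have := hd _ _ h (G.face_bDart d (i + 1)) (by rw [bDart_succ, rot_fst])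
  rw [bDart_succ] at this
  exact rot_ne _ this.symm

theorem bDart_eq_of_edge_eq {d : V × Fin 3} (hd : G.IsEmbeddedFace d) {i j : ℕ}
    (h : G.edge (G.bDart d i) = G.edge (G.bDart d j)) : G.bDart d i = G.bDart d j := by
  rcases G.edge_eq_iff.mp h with h | h
  · exact h
  · exact absurd (h ▸ G.face_bDart d i) (face_opp_bDart_ne hd j)

/-- The third edges keep their colours under a perturbation, because the walk passes each vertex
only once. -/
theorem edge_rot_notMem_bdry {d : V × Fin 3} (hd : G.IsEmbeddedFace d) (i : ℕ) :
    G.edge (rot (G.bDart d i)) ∉ G.bdry d := by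
  rintro ⟨j, hj⟩
  rcases G.edge_eq_iff.mp hj with h | h
  · have := hd _ _ ((congrArg G.face h).trans (G.face_bDart d j)) (G.face_bDart d i) (rot_fst _)
    exact rot_ne _ this
  · have := hd _ _ (G.face_bDart d (j + 1)) (G.face_bDart d i) (by
      rw [bDart_succ, bDart, ← h, rot_fst, rot_fst])
    rw [bDart_succ, bDart, ← h] at this
    exact rot_rot_ne _ this

theorem edge_notMem_bdry {d : V × Fin 3} {x : V × Fin 3}
    (hx : ∀ i, (G.bDart d i).1 ≠ x.1) : G.edge x ∉ G.bdry d := by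
  rintro ⟨j, hj⟩
  rcases G.edge_eq_iff.mp hj with h | h
  · exact hx j (congrArg Prod.fst h).symm
  · exact hx (j + 1) (by rw [bDart_succ, rot_fst, h]; rfl)

theorem face_ne_of_notMem [Finite V] {d : V × Fin 3} (hp : 0 < G.faceLength d) {x : V × Fin 3}
    (hx : ∀ i, (G.bDart d i).1 ≠ x.1) : G.face x ≠ G.face d := by
  intro h
  obtain ⟨i, -, rfl⟩ := G.exists_bDart_eq h hp
  exact hx i rfl

theorem vertexWeight_bDart {A : ℂ} (h0 : 0 < ‖A‖) (h1 : ‖A‖ < 1) (c : G.Edge → ℤ)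
    (s : G.Face → ℤ) (d : V × Fin 3) (i : ℕ) : G.vertexWeight A c s (G.bDart d (i + 1)).1 =
      tet A (c (G.edge (G.bDart d i))) (c (G.edge (G.bDart d (i + 1)))) (c (G.legEdge d i))
        (s (G.face (G.opp (G.bDart d (i + 1))))) (s (G.face (G.opp (G.bDart d i))))
        (s (G.face d)) := by
  rw [vertexWeight_eq G h0 h1, vtx, tet_rotate h0 h1, tet_rotate h0 h1, face_bDart, face_opp]
  rw [show rot (rot (G.bDart d (i + 1))) = G.opp (G.bDart d i) by
    rw [bDart_succ, rot_rot_rot], edge_opp]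
  rfl

variable (G)

open Classical in
/-- The vertices of the boundary walk of a region. -/
def bVerts [Fintype V] (d : V × Fin 3) : Finset V :=
  (Finset.range (G.faceLength d)).image fun i => (G.bDart d (i + 1)).1

open Classical in
/-- The part of the weight of a shadow-state that does not depend on the state of the region to
the right of `d`. -/
def outerWeight [Fintype V] (A : ℂ) (d : V × Fin 3) (c : G.Edge → ℤ) (s : G.Face → ℤ) : ℂ :=
  (∏ r ∈ Finset.univ.erase (G.face d), wt A (s r)) * ∏ v ∈ (G.bVerts d)ᶜ, G.vertexWeight A c s v

variable {G}

-- Only the vertices on the boundary of `D` touch `D` or a perturbed edge. All other factors are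
-- common to `c` and its perturbations and do not depend on the state `u` of `D`.
open Classical in
theorem weight_update [Fintype V] {A : ℂ} (h0 : 0 < ‖A‖) (h1 : ‖A‖ < 1) {d : V × Fin 3}
    (hd : G.IsEmbeddedFace d) (hp : 0 < G.faceLength d) {c c' : G.Edge → ℤ}
    (hc : ∀ e ∉ G.bdry d, c' e = c e) (s : G.Face → ℤ) (u : ℤ) :
    G.weight A c' (Function.update s (G.face d) u) = G.outerWeight A d c s * (wt A u *
      ∏ i ∈ Finset.range (G.faceLength d), tet A (c' (G.bEdge d i)) (c' (G.bEdge d (i + 1)))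
        (c (G.legEdge d i)) (s (G.face (G.opp (G.bDart d (i + 1)))))
        (s (G.face (G.opp (G.bDart d i)))) u) := by
  have hinj : Set.InjOn (fun i => (G.bDart d (i + 1)).1) (Finset.range (G.faceLength d)) := by
    intro i hi j hj h
    have := hd _ _ (G.face_bDart d _) (G.face_bDart d _) h
    rw [bDart_succ, bDart_succ] at this
    exact G.bDart_injOn d (Finset.mem_range.mp hi) (Finset.mem_range.mp hj)
      (G.opp.injective (rot.injective this))
  have hverts : ∀ v ∉ G.bVerts d, ∀ i, (G.bDart d i).1 ≠ v := by
    rintro v hv i rfl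
    obtain ⟨j, hj, hji⟩ := G.exists_bDart_eq (x := G.opp (rot.symm (G.bDart d i))) (d := d) (by
      rw [← G.face_next, ← G.face_bDart d i]
      change G.face (rot (G.opp (G.opp _))) = _
      rw [opp_opp, Equiv.apply_symm_apply]) hp
    refine hv (Finset.mem_image.mpr ⟨j, Finset.mem_range.mpr hj, ?_⟩)
    rw [bDart_succ, ← hji, opp_opp, Equiv.apply_symm_apply]
  rw [weight_eq, ← Finset.mul_prod_erase _ _ (Finset.mem_univ (G.face d)), Function.update_self,
    ← Finset.prod_mul_prod_compl (G.bVerts d), outerWeight]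
  have e₁ : ∏ r ∈ Finset.univ.erase (G.face d), wt A (Function.update s (G.face d) u r) =
      ∏ r ∈ Finset.univ.erase (G.face d), wt A (s r) :=
    Finset.prod_congr rfl fun r hr => by rw [Function.update_of_ne (Finset.ne_of_mem_erase hr)]
  have e₂ : ∏ v ∈ (G.bVerts d)ᶜ, G.vertexWeight A c' (Function.update s (G.face d) u) v =
      ∏ v ∈ (G.bVerts d)ᶜ, G.vertexWeight A c s v := by
    refine Finset.prod_congr rfl fun v hv => ?_
    have hv' := hverts v (Finset.mem_compl.mp hv)
    have he : ∀ i, c' (G.edge (v, i)) = c (G.edge (v, i)) := fun i => hc _ (edge_notMem_bdry hv')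
    have hf : ∀ i, Function.update s (G.face d) u (G.face (v, i)) = s (G.face (v, i)) := fun i =>
      Function.update_of_ne (face_ne_of_notMem hp hv') _ _
    simp only [vertexWeight, he, hf]
  have e₃ : ∏ v ∈ G.bVerts d, G.vertexWeight A c' (Function.update s (G.face d) u) v =
      ∏ i ∈ Finset.range (G.faceLength d), tet A (c' (G.bEdge d i)) (c' (G.bEdge d (i + 1)))
        (c (G.legEdge d i)) (s (G.face (G.opp (G.bDart d (i + 1)))))
        (s (G.face (G.opp (G.bDart d i)))) u := by
    rw [bVerts, Finset.prod_image hinj]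
    refine Finset.prod_congr rfl fun i _ => ?_
    rw [vertexWeight_bDart h0 h1, hc (G.legEdge d i) (edge_rot_notMem_bdry hd (i + 1)),
      Function.update_of_ne (face_opp_bDart_ne hd _), Function.update_of_ne (face_opp_bDart_ne hd _),
      Function.update_self]
    rfl
  rw [e₁, e₂, e₃]
  ring

/-- The boundary edges of a region, indexed by the boundary walk. -/
theorem bijective_bEdge [Finite V] {d : V × Fin 3} (hd : G.IsEmbeddedFace d)
    (hp : 0 < G.faceLength d) :
    Function.Bijective fun i : Fin (G.faceLength d) => G.bEdge d i := by
  constructor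
  · intro i j h
    exact Fin.ext (G.bDart_injOn d i.2 j.2 (bDart_eq_of_edge_eq hd (congrArg Subtype.val h)))
  · rintro ⟨_, i, rfl⟩
    obtain ⟨j, hj, hji⟩ := G.exists_bDart_eq (G.face_bDart d i) hp
    exact ⟨⟨j, hj⟩, Subtype.ext (congrArg G.edge hji.symm)⟩

theorem perturb_bEdge (d : V × Fin 3) (c : G.Edge → ℤ) (δ : G.bdry d → ℤˣ) (i : ℕ) :
    G.perturb d c δ (G.bEdge d i) = c (G.bEdge d i) + δ (G.bEdge d i) :=
  dif_pos (G.bEdge d i).2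

theorem perturb_of_notMem {d : V × Fin 3} (c : G.Edge → ℤ) (δ : G.bdry d → ℤˣ) {e : G.Edge}
    (he : e ∉ G.bdry d) : G.perturb d c δ e = c e :=
  dif_neg he

theorem exists_perturbation_equiv [Finite V] {d : V × Fin 3} (hd : G.IsEmbeddedFace d) {m : ℕ}
    (hm : G.faceLength d = m + 1) : ∃ e : (Fin (m + 1) → ℤˣ) ≃ (G.bdry d → ℤˣ),
      ∀ g (i : Fin (m + 1)), e g (G.bEdge d i) = g i := by
  have hb := bijective_bEdge hd (by omega)
  rw [hm] at hb
  refine ⟨(Equiv.ofBijective _ hb).arrowCongr (Equiv.refl _), fun g i => ?_⟩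
  exact congrArg g ((Equiv.ofBijective _ hb).symm_apply_apply i)

theorem bEdge_faceLength (d : V × Fin 3) : G.bEdge d (G.faceLength d) = G.bEdge d 0 :=
  Subtype.ext (congrArg G.edge (G.bDart_faceLength d))

end CubicMap

/-! ### The circle recursion for the bracket -/

theorem prod_mul_succ (f : ℕ → ℂ) (m : ℕ) : ∏ i ∈ Finset.range (m + 1), (f i * f (i + 1)) =
    f 0 * f (m + 1) * ∏ i ∈ Finset.range (m + 1), if i = 0 then 1 else f i ^ 2 := by
  induction m with
  | zero => simp
  | succ m ih =>
    rw [Finset.prod_range_succ, ih, Finset.prod_range_succ _ (m + 1), if_neg (Nat.succ_ne_zero m)]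
    ring

namespace CubicMap

variable {V : Type*} {G : CubicMap V}

/-- Each `𝕍(i)` contributes the square roots of the weights of `a'ᵢ` and `a'ᵢ₊₁`. Every inner edge
thus gets its full weight, as the chain requires, while `e₀` and `e_{p-1}` keep one square root
each, the same two that occur in `Z`. -/
theorem coeffK_mul_prod {A : ℂ} (h0 : 0 < ‖A‖) (h1 : ‖A‖ < 1) {d : V × Fin 3}
    {c : G.Edge → ℤ} (hc : G.Admissible c) {m : ℕ} (hm : m ≠ 0) (hp : G.faceLength d = m + 1)
    (δ : G.bdry d → ℤˣ) (w : ℕ → ℤ) (u : ℤ) :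
    G.coeffK d c A δ * ∏ i ∈ Finset.range (m + 1),
        tet A (G.perturb d c δ (G.bEdge d i)) (G.perturb d c δ (G.bEdge d (i + 1)))
          (c (G.legEdge d i)) (w (i + 1)) (w i) u =
      sqrtWt A (c (G.bEdge d 0) + δ (G.bEdge d 0)) * sqrtWt A (c (G.bEdge d m) + δ (G.bEdge d m)) *
        ((∏ i ∈ Finset.range m, (if i = 0 then 1 else wt A (c (G.bEdge d i) + δ (G.bEdge d i))) *
          (tet A (c (G.bEdge d i)) (c (G.bEdge d (i + 1))) (c (G.legEdge d i))
            (c (G.bEdge d (i + 1)) + δ (G.bEdge d (i + 1))) (c (G.bEdge d i) + δ (G.bEdge d i)) 1 *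
          tet A (c (G.bEdge d i) + δ (G.bEdge d i)) (c (G.bEdge d (i + 1)) + δ (G.bEdge d (i + 1)))
            (c (G.legEdge d i)) (w (i + 1)) (w i) u)) *
        tet A (c (G.bEdge d m) + δ (G.bEdge d m)) (c (G.bEdge d (m + 1)) + δ (G.bEdge d 0))
            (c (G.legEdge d m)) (w (m + 1)) (w m) u) := by
  have hq : ∀ i, G.quot d c A i (δ (G.bEdge d i)) (δ (G.bEdge d (i + 1))) =
      tet A (c (G.bEdge d i)) (c (G.bEdge d (i + 1))) (c (G.legEdge d i))
        (c (G.bEdge d (i + 1)) + δ (G.bEdge d (i + 1))) (c (G.bEdge d i) + δ (G.bEdge d i)) 1 *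
      (sqrtWt A (c (G.bEdge d i) + δ (G.bEdge d i)) *
        sqrtWt A (c (G.bEdge d (i + 1)) + δ (G.bEdge d (i + 1)))) := fun i =>
    tet_div_tet h0 h1 _ _ _ _ _
  have hs : ∀ i, sqrtWt A (c (G.bEdge d i) + δ (G.bEdge d i)) ^ 2 =
      wt A (c (G.bEdge d i) + δ (G.bEdge d i)) := by
    intro i
    have h : 0 ≤ c (G.bEdge d i) := hc.nonneg (G.bDart d i)
    have := adj_add_units (c (G.bEdge d i)) (δ (G.bEdge d i))
    unfold Adj at this
    exact sqrtWt_sq h0 h1 (by omega)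
  have hlast : G.bEdge d (m + 1) = G.bEdge d 0 := by rw [← hp, bEdge_faceLength]
  simp only [coeffK, hp, Nat.add_sub_cancel, hq, perturb_bEdge]
  rw [Finset.prod_range_succ, Finset.prod_mul_distrib]
  obtain ⟨n, rfl⟩ := Nat.exists_eq_succ_of_ne_zero hm
  simp only [Nat.succ_eq_add_one] at *
  rw [prod_mul_succ fun i => sqrtWt A (c (G.bEdge d i) + δ (G.bEdge d i))]
  simp only [hs, Finset.prod_mul_distrib]
  rw [hlast]
  ring

open Classical in
/-- The circle recursion around a region that is not the distinguished one. -/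
theorem circle_recursion_of_ne [Fintype V] {A : ℂ} (h0 : 0 < ‖A‖) (h1 : ‖A‖ < 1)
    (hG : G.IsConnected) {r₀ : G.Face} {c : G.Edge → ℤ} (hc : G.Admissible c) {d : V × Fin 3}
    (hd : G.IsEmbeddedFace d) (hp : 2 ≤ G.faceLength d) (hr₀ : r₀ ≠ G.face d) (ε₀ ε₁ : ℤˣ) :
    ∑ δ ∈ G.admPerturbations d c ε₀ ε₁, G.coeffK d c A δ * G.bracket r₀ (G.perturb d c δ) A =
      G.coeffZ d c A ε₀ ε₁ * G.bracket r₀ c A := by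
  obtain ⟨m, hm⟩ : ∃ m, G.faceLength d = m + 1 := ⟨G.faceLength d - 1, by omega⟩
  have hm0 : m ≠ 0 := by omega
  obtain ⟨e, he⟩ := exists_perturbation_equiv hd hm
  choose B₀ hB₀ hbr₀ using fun c => G.bracket_eq_sum h0 h1 hG c r₀
  -- One box of states has to serve `c` and its finitely many perturbations. The range of `D` is
  -- enlarged to `N`, which covers the neighbouring states that occur in `sum_wt_mul_chain`.
  obtain ⟨B₁, hB₁⟩ := (Set.finite_range fun g => B₀ (G.perturb d c (e g))).bddAbove
  obtain ⟨B, hBc, hBδ⟩ : ∃ B, B₀ c ≤ B ∧ ∀ g, B₀ (G.perturb d c (e g)) ≤ B :=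
    ⟨max (B₀ c) B₁, by omega, fun g => by have := hB₁ ⟨g, rfl⟩; dsimp only at this; omega⟩
  have ha0 : 0 ≤ c (G.bEdge d 0) := hc.nonneg _
  set N := c (G.bEdge d 0) + B + 1 with hN
  set t : G.Face → Finset ℤ := fun r => Finset.Icc 0 (if r = G.face d then N else B) with ht
  have hbr : ∀ c' : G.Edge → ℤ, (∀ e ∉ G.bdry d, c' e = c e) → B₀ c' ≤ B →
      G.bracket r₀ c' A = ∑ s ∈ Fintype.piFinset (Function.update t (G.face d) {0}),
        if s r₀ = 0 then G.outerWeight A d c s * ∑ u ∈ Finset.Icc 0 N, wt A u *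
          ∏ i ∈ Finset.range (m + 1), tet A (c' (G.bEdge d i)) (c' (G.bEdge d (i + 1)))
            (c (G.legEdge d i)) (s (G.face (G.opp (G.bDart d (i + 1)))))
            (s (G.face (G.opp (G.bDart d i)))) u else 0 := by
    intro c' hc' hB
    rw [hbr₀ c' t fun r => Finset.Icc_subset_Icc le_rfl (by split_ifs <;> omega),
      sum_piFinset_update t (G.face d)]
    refine Finset.sum_congr rfl fun s _ => ?_
    rw [show t (G.face d) = Finset.Icc 0 N by simp [ht]]
    simp only [Function.update_of_ne hr₀]
    by_cases hs : s r₀ = 0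
    · simp only [if_pos hs]
      rw [Finset.mul_sum]
      refine Finset.sum_congr rfl fun u _ => ?_
      rw [weight_update h0 h1 hd (by omega) hc', hm]
    · simp only [if_neg hs, Finset.sum_const_zero]
  have hsum : ∑ δ ∈ G.admPerturbations d c ε₀ ε₁,
        G.coeffK d c A δ * G.bracket r₀ (G.perturb d c δ) A =
      ∑ g : Fin (m + 1) → ℤˣ, if g 0 = ε₀ ∧ g (Fin.last m) = ε₁ then
        G.coeffK d c A (e g) * G.bracket r₀ (G.perturb d c (e g)) A else 0 := by
    have hends : ∀ g, G.bEdge d 0 = G.bEdge d (0 : Fin (m + 1)) ∧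
        e g (G.bEdge d (G.faceLength d - 1)) = g (Fin.last m) := by
      intro g
      rw [hm]
      exact ⟨rfl, he g (Fin.last m)⟩
    rw [← Finset.sum_filter]
    symm
    refine Finset.sum_bij_ne_zero (fun g _ _ => e g) ?_ (fun _ _ _ _ _ _ h => e.injective h) ?_ ?_
    · intro g hg hne
      rw [Finset.mem_filter] at hg
      have hadm : G.Admissible (G.perturb d c (e g)) := by
        by_contra hcon
        rw [bracket_of_not_admissible G A hcon, mul_zero] at hne
        exact hne rfl
      simp only [admPerturbations, Finset.mem_filter, Finset.mem_univ, true_and]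
      refine ⟨hadm, ?_, ?_⟩
      · rw [(hends g).1, he, hg.2.1]
      · rw [(hends g).2, hg.2.2]
    · intro δ hδ hne
      simp only [admPerturbations, Finset.mem_filter, Finset.mem_univ, true_and] at hδ
      refine ⟨e.symm δ, ?_, by rwa [e.apply_symm_apply], e.apply_symm_apply δ⟩
      rw [Finset.mem_filter]
      have h₁ := (hends (e.symm δ)).2
      have h₂ := he (e.symm δ) 0
      rw [e.apply_symm_apply] at h₁ h₂
      exact ⟨Finset.mem_univ _, h₂.symm.trans hδ.2.1, h₁.symm.trans hδ.2.2⟩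
    · exact fun _ _ _ => rfl
  rw [hsum]
  have hbδ : ∀ g, G.bracket r₀ (G.perturb d c (e g)) A = _ := fun g =>
    hbr _ (fun e' he' => perturb_of_notMem c _ he') (hBδ g)
  rw [hbr c (fun _ _ => rfl) hBc]
  simp only [hbδ]
  -- The sum over perturbations is moved inside the sum over the states of the other regions, where
  -- the recursion holds for each of these states separately.
  trans ∑ s ∈ Fintype.piFinset (Function.update t (G.face d) {0}), if s r₀ = 0 then
    G.outerWeight A d c s * ∑ u ∈ Finset.Icc 0 N, wt A u *
      ∑ g : Fin (m + 1) → ℤˣ, if g 0 = ε₀ ∧ g (Fin.last m) = ε₁ then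
        G.coeffK d c A (e g) * ∏ i ∈ Finset.range (m + 1),
          tet A (G.perturb d c (e g) (G.bEdge d i)) (G.perturb d c (e g) (G.bEdge d (i + 1)))
            (c (G.legEdge d i)) (s (G.face (G.opp (G.bDart d (i + 1)))))
            (s (G.face (G.opp (G.bDart d i)))) u else 0 else 0
  · simp only [Finset.mul_sum, ← Finset.sum_filter]
    rw [Finset.sum_comm]
    refine Finset.sum_congr rfl fun s _ => ?_
    rw [Finset.sum_comm]
    refine Finset.sum_congr rfl fun u _ => Finset.sum_congr rfl fun g _ => ?_
    ring
  rw [Finset.mul_sum]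
  refine Finset.sum_congr rfl fun s hs => ?_
  split_ifs
  swap
  · rw [mul_zero]
  have hrec := sum_wt_mul_chain h0 h1 (fun i => c (G.bEdge d i)) (fun i => c (G.legEdge d i))
    (fun i => s (G.face (G.opp (G.bDart d i)))) (N := N) hm0
    (by rw [← hm, bEdge_faceLength]) (by rw [← hm, bDart_faceLength]; rfl)
    (by
      have := Fintype.mem_piFinset.mp hs (G.face (G.opp (G.bDart d 0)))
      rw [Function.update_of_ne (face_opp_bDart_ne hd 0), ht] at this
      simp only [if_neg (face_opp_bDart_ne hd 0), Finset.mem_Icc] at this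
      omega) ε₀ ε₁
  have hinner : ∀ u, (∑ g : Fin (m + 1) → ℤˣ, if g 0 = ε₀ ∧ g (Fin.last m) = ε₁ then
        G.coeffK d c A (e g) * ∏ i ∈ Finset.range (m + 1),
          tet A (G.perturb d c (e g) (G.bEdge d i)) (G.perturb d c (e g) (G.bEdge d (i + 1)))
            (c (G.legEdge d i)) (s (G.face (G.opp (G.bDart d (i + 1)))))
            (s (G.face (G.opp (G.bDart d i)))) u else 0) =
      sqrtWt A (c (G.bEdge d 0) + ε₀) * sqrtWt A (c (G.bEdge d m) + ε₁) *
        (chain (fun i ε ε' => (if i = 0 then 1 else wt A (c (G.bEdge d i) + ε)) *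
          (tet A (c (G.bEdge d i)) (c (G.bEdge d (i + 1))) (c (G.legEdge d i))
            (c (G.bEdge d (i + 1)) + ε') (c (G.bEdge d i) + ε) 1 *
          tet A (c (G.bEdge d i) + ε) (c (G.bEdge d (i + 1)) + ε') (c (G.legEdge d i))
            (s (G.face (G.opp (G.bDart d (i + 1))))) (s (G.face (G.opp (G.bDart d i)))) u))
          ε₀ m ε₁ *
        tet A (c (G.bEdge d m) + ε₁) (c (G.bEdge d (m + 1)) + ε₀) (c (G.legEdge d m))
          (s (G.face (G.opp (G.bDart d (m + 1))))) (s (G.face (G.opp (G.bDart d m)))) u) := by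
    intro u
    rw [← sum_prod_eq_chain, Finset.sum_mul, Finset.mul_sum]
    refine Finset.sum_congr rfl fun g _ => ?_
    split_ifs with hg
    swap
    · ring
    rw [coeffK_mul_prod h0 h1 hc hm0 hm (e g) (fun i => s (G.face (G.opp (G.bDart d i)))) u]
    have g₀ : e g (G.bEdge d 0) = ε₀ := (he g 0).trans hg.1
    have g₁ : e g (G.bEdge d m) = ε₁ := (he g (Fin.last m)).trans hg.2
    rw [g₀, g₁, Finset.prod_range]
    congr 3
    funext i
    have i₀ : e g (G.bEdge d i) = g i.castSucc := he g i.castSucc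
    have i₁ : e g (G.bEdge d (i + 1)) = g i.succ := he g i.succ
    rw [i₀, i₁]
  simp only [hinner]
  have hZ : G.coeffZ d c A ε₀ ε₁ = tet A (c (G.bEdge d m)) (c (G.bEdge d (m + 1)))
      (c (G.legEdge d m)) (c (G.bEdge d (m + 1)) + ε₀) (c (G.bEdge d m) + ε₁) 1 *
        (sqrtWt A (c (G.bEdge d m) + ε₁) * sqrtWt A (c (G.bEdge d 0) + ε₀)) := by
    rw [coeffZ, hm, Nat.add_sub_cancel, quot, tet_div_tet h0 h1, ← hm, bEdge_faceLength]
  rw [hZ]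
  trans G.outerWeight A d c s * (sqrtWt A (c (G.bEdge d 0) + ε₀) *
    sqrtWt A (c (G.bEdge d m) + ε₁) * ∑ u ∈ Finset.Icc 0 N, wt A u *
      (chain (fun i ε ε' => (if i = 0 then 1 else wt A (c (G.bEdge d i) + ε)) *
          (tet A (c (G.bEdge d i)) (c (G.bEdge d (i + 1))) (c (G.legEdge d i))
            (c (G.bEdge d (i + 1)) + ε') (c (G.bEdge d i) + ε) 1 *
          tet A (c (G.bEdge d i) + ε) (c (G.bEdge d (i + 1)) + ε') (c (G.legEdge d i))
            (s (G.face (G.opp (G.bDart d (i + 1))))) (s (G.face (G.opp (G.bDart d i)))) u))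
          ε₀ m ε₁ *
        tet A (c (G.bEdge d m) + ε₁) (c (G.bEdge d (m + 1)) + ε₀) (c (G.legEdge d m))
          (s (G.face (G.opp (G.bDart d (m + 1))))) (s (G.face (G.opp (G.bDart d m)))) u))
  · congr 1
    rw [Finset.mul_sum]
    refine Finset.sum_congr rfl fun u _ => ?_
    ring
  rw [hrec]
  ring

/-- If `D` itself is distinguished, all brackets are first rewritten with another distinguished
region. This is the only place that needs the surface to be a sphere. -/
theorem circle_recursion [Fintype V] {A : ℂ} (h0 : 0 < ‖A‖) (h1 : ‖A‖ < 1)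
    (hG : G.IsSpherical) (r₀ : G.Face) {c : G.Edge → ℤ} (hc : G.Admissible c) {d : V × Fin 3}
    (hd : G.IsEmbeddedFace d) (hp : 2 ≤ G.faceLength d) (ε₀ ε₁ : ℤˣ) :
    ∑ δ ∈ G.admPerturbations d c ε₀ ε₁, G.coeffK d c A δ * G.bracket r₀ (G.perturb d c δ) A =
      G.coeffZ d c A ε₀ ε₁ * G.bracket r₀ c A := by
  by_cases hr₀ : r₀ = G.face d
  · obtain ⟨r₁, hr₁, h⟩ := exists_bracket_eq h0 h1 hG r₀
    simp only [h]
    exact circle_recursion_of_ne h0 h1 hG.1 hc hd hp (hr₀ ▸ hr₁) ε₀ ε₁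
  · exact circle_recursion_of_ne h0 h1 hG.1 hc hd hp hr₀ ε₀ ε₁

end CubicMap

end CircleRec

end

theorem proposition4p2 {V : Type*} [Fintype V] (G : CircleRec.CubicMap V) (hG : G.IsSpherical)
    (r₀ : G.Face) (c : G.Edge → ℤ) (hc : G.Admissible c)
    (d : V × Fin 3) (hd : G.IsEmbeddedFace d) (hp : 2 ≤ G.faceLength d)
    (ε₀ ε₁ : ℤˣ) (A : ℂ) (hA0 : 0 < ‖A‖) (hA1 : ‖A‖ < 1) :
    ∑ δ ∈ G.admPerturbations d c ε₀ ε₁,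
        G.coeffK d c A δ * G.bracket r₀ (G.perturb d c δ) A =
      G.coeffZ d c A ε₀ ε₁ * G.bracket r₀ c A :=
  CircleRec.CubicMap.circle_recursion hA0 hA1 hG r₀ hc hd hp ε₀ ε₁
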